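/- Let $W(r)=\frac14(1-r^2)^2$ and let $q:\mathbb R\to(-1,1)$ be the optimal profile: $-q''+W'(q)=0$, $q(\pm\infty)=\pm1$, $q(0)=0$. Let $0<\lambda<1$, $0<\overline\lambda<1$ with $\overline\lambda^{-1}(1-\lambda)<1$, and let $\widetilde W\in C_c^\infty(\mathbb R)$ satisfy $\widetilde W(s)=1$ for $|s|\le 1-\lambda$, $\widetilde W(s)=0$ for $|s|>\overline\lambda^{-1}(1-\lambda)$, and be monotone on each of the two remaining intervals. Let $\eta\in C^\infty(\mathbb R;[0,1])$ be even, nonincreasing on $[0,\infty)$, with $\eta=1$ on $[-1,1]$ and $\eta(r)=0$ for $|r|\ge2$. Let $n\in\{2,3\}$, let $\Omega\subset\mathbb R^n$ be open, and let $E\subset\mathbb R^n$ be a bounded open set whose boundary $\partial E\subset\Omega$ is a connected (nonempty, compact) embedded $C^2$ hypersurface with area $\mathcal H^{n-1}(\partial E)=S>0$. Let $d$ be the signed distance from $\partial E$, positive inside $E$, and let $\delta>0$ be such that $d$ is of class $C^2$ on $\{x\in\Omega:\operatorname{dist}(x,\partial E)\le\delta\}$. For $\varepsilon>0$ put $$q_\varepsilon(r)=\eta\big(\tfrac{2r}{\delta}\big)q\big(\tfrac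 r\varepsilon\big)+\operatorname{sgn}(r)\big(1-\eta\big(\tfrac{2r}{\delta}\big)\big),\qquad u_\varepsilon(x)=q_\varepsilon(d(x)).$$ For an open set $U\subset\mathbb R^n$ and $\phi\in BV(U;\{-1,+1\})$ put $$\tilde{\mathcal A}_{u_\varepsilon,\varepsilon}(\phi)=\Big|\int_U\tfrac1\varepsilon\widetilde W(u_\varepsilon)\,\phi\,dx\Big|+\int_U\varepsilon^{-3/2}\,\widetilde W(\overline\lambda u_\varepsilon)\,d|\nabla\phi| .$$ (a) Let $U=\mathcal U_{r(\varepsilon)}:=\{x:\operatorname{dist}(x,\partial E)<r(\varepsilon)\}$ with $r(\varepsilon)=\varepsilon q^{-1}(1-\lambda)$. There is a constant $\tilde c_0>0$, independent of $\varepsilon$, $n$, $\Omega$, $E$, $\delta$ and $\eta$, and for all $n,\Omega,E,\delta$ as above there are $\varepsilon_0>0$ and $C$, independent of $\eta$, such that for every $0<\varepsilon<\varepsilon_0$ the constant function $\phi\equiv1$ minimizes $\tilde{\mathcal A}_{u_\varepsilon,\varepsilon}$ over $BV(U;\{-1,+1\})$ and its value satisfies $$\min_{\phi\in BV(U;\{-1,+1\})}\tilde{\mathcal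 A}_{u_\varepsilon,\varepsilon}(\phi)=\tilde{\mathcal A}_{u_\varepsilon,\varepsilon}(1),\qquad \big|\tilde{\mathcal A}_{u_\varepsilon,\varepsilon}(1)-\tilde c_0S\big|\le C\varepsilon^2 .$$ (b) If $\widetilde W$ is even, the same assertion (with a possibly different constant $\tilde c_0>0$) holds for $U=\{x\in\mathbb R^n:\widetilde W(u_\varepsilon(x))>0\}$. -/

import Mathlib

open MeasureTheory Set Filter Topology
open scoped ContDiff Gradient

namespace DiffuseWillmore

noncomputable section

/-- Euclidean `n`-space. -/
abbrev Space (n : ℕ) : Type := EuclideanSpace ℝ (Fin n)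

/-- The double well potential `W(r) = (1 - r²)² / 4`. -/
def doubleWell (r : ℝ) : ℝ := (1 - r ^ 2) ^ 2 / 4

/-- The optimal one-dimensional profile `q : ℝ → (-1, 1)`: a `C²` solution of `-q'' + W'(q) = 0`
with `q(-∞) = -1`, `q(+∞) = 1`, `q(0) = 0`. -/
structure IsOptimalProfile (q : ℝ → ℝ) : Prop where
  contDiff : ContDiff ℝ 2 q
  mem_Ioo : ∀ r, q r ∈ Ioo (-1 : ℝ) 1
  ode : ∀ r, -deriv (deriv q) r + deriv doubleWell (q r) = 0
  tendsto_atBot : Tendsto q atBot (𝓝 (-1))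
  tendsto_atTop : Tendsto q atTop (𝓝 1)
  zero : q 0 = 0

/-- The weight `W̃ ∈ C_c^∞(ℝ)` with its parameters `λ` and `λ̄`: it is `1` on `|s| ≤ 1 - λ`, it is
`0` on `|s| > λ̄⁻¹ (1 - λ)`, and it is monotone on each of the two remaining intervals. The
parameters satisfy `0 < λ < 1`, `0 < λ̄ < 1` and `λ̄⁻¹ (1 - λ) < 1`. -/
structure IsLayerWeight (lam lamBar : ℝ) (Wt : ℝ → ℝ) : Prop where
  lam_pos : 0 < lam
  lam_lt_one : lam < 1
  lamBar_pos : 0 < lamBar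
  lamBar_lt_one : lamBar < 1
  threshold_lt_one : lamBar⁻¹ * (1 - lam) < 1
  contDiff : ContDiff ℝ ∞ Wt
  eq_one : ∀ s, |s| ≤ 1 - lam → Wt s = 1
  eq_zero : ∀ s, lamBar⁻¹ * (1 - lam) < |s| → Wt s = 0
  antitoneOn : AntitoneOn Wt (Icc (1 - lam) (lamBar⁻¹ * (1 - lam)))
  monotoneOn : MonotoneOn Wt (Icc (-(lamBar⁻¹ * (1 - lam))) (-(1 - lam)))

/-- A smooth symmetric cut-off function `η`, equal to `1` on `[-1, 1]` and to `0` for `|r| ≥ 2`,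
with values in `[0, 1]` and nonincreasing in `|r|`. -/
structure IsCutoff (η : ℝ → ℝ) : Prop where
  contDiff : ContDiff ℝ ∞ η
  even : ∀ r, η (-r) = η r
  mem_Icc : ∀ r, η r ∈ Icc (0 : ℝ) 1
  eq_one : ∀ r ∈ Icc (-1 : ℝ) 1, η r = 1
  eq_zero : ∀ r, 2 ≤ |r| → η r = 0
  antitoneOn : AntitoneOn η (Ici 0)

/-- `Σ ⊆ ℝⁿ` is an embedded `C²` hypersurface (without boundary): near each of its points it is the
zero set of a `C²` function with nonvanishing differential. -/
def IsC2Hypersurface {n : ℕ} (Sig : Set (Space n)) : Prop :=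
  ∀ z ∈ Sig, ∃ V : Set (Space n), IsOpen V ∧ z ∈ V ∧ ∃ f : Space n → ℝ,
    ContDiffOn ℝ 2 f V ∧ (∀ x ∈ V, fderiv ℝ f x ≠ 0) ∧ Sig ∩ V = {x ∈ V | f x = 0}

/-- `E` is the (open, bounded) region enclosed by a connected compact embedded `C²` hypersurface
`∂E` in the open set `Ω`, whose surface area is `S > 0`. Compactness of `∂E` follows from
boundedness of `E`, and a connected set is nonempty. -/
structure IsEnclosedRegion {n : ℕ} (Ω E : Set (Space n)) (S : ℝ) : Prop where
  isOpen_container : IsOpen Ω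
  isOpen : IsOpen E
  isBounded : Bornology.IsBounded E
  frontier_subset : frontier E ⊆ Ω
  isConnected_frontier : IsConnected (frontier E)
  isC2Hypersurface_frontier : IsC2Hypersurface (frontier E)
  area_pos : 0 < S
  area_eq : μHE[n - 1] (frontier E) = ENNReal.ofReal S

open Classical in
/-- The signed distance from `∂E`, taken positive inside `E`. -/
def signedDist {n : ℕ} (E : Set (Space n)) (x : Space n) : ℝ :=
  if x ∈ E then Metric.infDist x (frontier E) else -Metric.infDist x (frontier E)

/-- `δ > 0` is such that the signed distance from `∂E` is of class `C²` on
`{x ∈ Ω : dist (x, ∂E) ≤ δ}`. -/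
def IsTubeWidth {n : ℕ} (Ω E : Set (Space n)) (δ : ℝ) : Prop :=
  0 < δ ∧ ContDiffOn ℝ 2 (signedDist E) {x ∈ Ω | Metric.infDist x (frontier E) ≤ δ}

/-- `q_ε(r) = η(2r/δ) q(r/ε) + sgn(r) (1 - η(2r/δ))`. -/
def scaledProfile (q η : ℝ → ℝ) (δ ε r : ℝ) : ℝ :=
  η (2 * r / δ) * q (r / ε) + Real.sign r * (1 - η (2 * r / δ))

/-- The optimal-profile phase field `u_ε(x) = q_ε(d(x))`, `d` the signed distance from `∂E`. -/
def phaseField {n : ℕ} (q η : ℝ → ℝ) (E : Set (Space n)) (δ ε : ℝ) (x : Space n) : ℝ :=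
  scaledProfile q η δ ε (signedDist E x)

/-- The tube `U_r = {x : dist (x, ∂E) < r}`. -/
def tube {n : ℕ} (E : Set (Space n)) (r : ℝ) : Set (Space n) :=
  {x | Metric.infDist x (frontier E) < r}

/-- `m` is the total variation measure `|∇φ|` on the open set `U`: the distributional gradient of
`φ` on `U` is the vector measure `σ m` with `m` a finite Borel measure on `U` and `|σ| = 1`
`m`-almost everywhere. -/
def IsTotalVariation {n : ℕ} (U : Set (Space n)) (φ : Space n → ℝ) (m : Measure (Space n)) : Prop :=
  IsFiniteMeasure m ∧ m Uᶜ = 0 ∧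
    ∃ σ : Space n → Space n, Measurable σ ∧ (∀ᵐ x ∂m, ‖σ x‖ = 1) ∧
      ∀ g : Space n → ℝ, ContDiff ℝ 1 g → HasCompactSupport g → tsupport g ⊆ U →
        ∫ x in U, φ x • ∇ g x = -∫ x, g x • σ x ∂m

/-- `φ ∈ BV(U; {-1, +1})`: `φ` is integrable on `U`, takes the values `-1` and `+1` almost
everywhere in `U`, and its distributional gradient is a finite vector measure on `U`. -/
def IsSignBV {n : ℕ} (U : Set (Space n)) (φ : Space n → ℝ) : Prop :=
  IntegrableOn φ U ∧ (∀ᵐ x ∂(volume.restrict U), φ x = -1 ∨ φ x = 1) ∧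
    ∃ m, IsTotalVariation U φ m

open Classical in
/-- The total variation measure `|∇φ|` on `U` of a function of bounded variation. -/
def totalVariation {n : ℕ} (U : Set (Space n)) (φ : Space n → ℝ) : Measure (Space n) :=
  if h : ∃ m, IsTotalVariation U φ m then h.choose else 0

/-- The modified sharp functional
`Ã_{u,ε}(φ) = |∫_U ε⁻¹ W̃(u) φ dx| + ∫_U ε^{-3/2} W̃(λ̄ u) d|∇φ|` on `BV(U; {-1, +1})`. -/
def sharpFunctional {n : ℕ} (lamBar : ℝ) (Wt : ℝ → ℝ) (U : Set (Space n)) (u : Space n → ℝ)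
    (ε : ℝ) (φ : Space n → ℝ) : ℝ :=
  |∫ x in U, 1 / ε * Wt (u x) * φ x| +
    ∫ x in U, 1 / ε ^ (3 / 2 : ℝ) * Wt (lamBar * u x) ∂(totalVariation U φ)

/-- The total variation measure of a function is unique, so that `totalVariation` is the measure
that `IsTotalVariation` describes. -/
theorem IsTotalVariation.unique {n : ℕ} {U : Set (Space n)} (hU : IsOpen U) {φ : Space n → ℝ}
    {m m' : Measure (Space n)} (h : IsTotalVariation U φ m) (h' : IsTotalVariation U φ m') :
    m = m' := by
  obtain ⟨hf, hz, σ, hσ, hσ1, hi⟩ := h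
  obtain ⟨hf', hz', τ, hτ, hτ1, hi'⟩ := h'
  have : IsFiniteMeasure m := hf
  have : IsFiniteMeasure m' := hf'
  set M := m + m' with hM
  have : IsFiniteMeasure M := by rw [hM]; infer_instance
  have : m.HaveLebesgueDecomposition M :=
    Measure.haveLebesgueDecomposition_of_sigmaFinite m M
  have : m'.HaveLebesgueDecomposition M :=
    Measure.haveLebesgueDecomposition_of_sigmaFinite m' M
  have hac : m ≪ M := Measure.absolutelyContinuous_of_le (Measure.le_add_right le_rfl)
  have hac' : m' ≪ M := Measure.absolutelyContinuous_of_le (Measure.le_add_left le_rfl)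
  set f := m.rnDeriv M with hfdef
  set f' := m'.rnDeriv M with hfdef'
  have hmf : Measurable f := Measure.measurable_rnDeriv _ _
  have hmf' : Measurable f' := Measure.measurable_rnDeriv _ _
  have e : M.withDensity f = m := Measure.withDensity_rnDeriv_eq _ _ hac
  have e' : M.withDensity f' = m' := Measure.withDensity_rnDeriv_eq _ _ hac'
  have ft : ∀ᵐ x ∂M, f x < ⊤ := Measure.rnDeriv_lt_top _ _
  have ft' : ∀ᵐ x ∂M, f' x < ⊤ := Measure.rnDeriv_lt_top _ _
  have n1 : ∀ᵐ x ∂M, f x ≠ 0 → ‖σ x‖ = 1 := by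
    rw [← e] at hσ1
    exact (ae_withDensity_iff hmf).1 hσ1
  have n1' : ∀ᵐ x ∂M, f' x ≠ 0 → ‖τ x‖ = 1 := by
    rw [← e'] at hτ1
    exact (ae_withDensity_iff hmf').1 hτ1
  have tr : ∀ g : Space n → ℝ, ∫ x, g x • σ x ∂m = ∫ x, g x • ((f x).toReal • σ x) ∂M := by
    intro g
    rw [← e, integral_withDensity_eq_integral_toReal_smul hmf ft]
    exact integral_congr_ae (Eventually.of_forall fun x => smul_comm _ _ _)
  have tr' : ∀ g : Space n → ℝ, ∫ x, g x • τ x ∂m' = ∫ x, g x • ((f' x).toReal • τ x) ∂M := by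
    intro g
    rw [← e', integral_withDensity_eq_integral_toReal_smul hmf' ft']
    exact integral_congr_ae (Eventually.of_forall fun x => smul_comm _ _ _)
  have I : Integrable (fun x => (f x).toReal • σ x) M := by
    have : Integrable σ m := Integrable.of_bound hσ.aestronglyMeasurable 1
      (hσ1.mono fun x hx => hx.le)
    rw [← e] at this
    exact (integrable_withDensity_iff_integrable_smul₀' hmf.aemeasurable ft).1 this
  have I' : Integrable (fun x => (f' x).toReal • τ x) M := by
    have : Integrable τ m' := Integrable.of_bound hτ.aestronglyMeasurable 1
      (hτ1.mono fun x hx => hx.le)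
    rw [← e'] at this
    exact (integrable_withDensity_iff_integrable_smul₀' hmf'.aemeasurable ft').1 this
  have key : ∀ᵐ x ∂M, x ∈ U → (f x).toReal • σ x - (f' x).toReal • τ x = 0 := by
    apply hU.ae_eq_zero_of_integral_contDiff_smul_eq_zero
    · exact (I.sub I').locallyIntegrable.locallyIntegrableOn U
    · intro g hg hgc hgU
      have hg1 : ContDiff ℝ 1 g := hg.of_le (by exact_mod_cast le_top)
      have h1 := hi g hg1 hgc hgU
      have h2 := hi' g hg1 hgc hgU
      obtain ⟨C, hC⟩ := hgc.exists_bound_of_continuous hg.continuous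
      have J : Integrable (fun x => g x • ((f x).toReal • σ x)) M :=
        I.bdd_smul C hg.continuous.aestronglyMeasurable (Eventually.of_forall hC)
      have J' : Integrable (fun x => g x • ((f' x).toReal • τ x)) M :=
        I'.bdd_smul C hg.continuous.aestronglyMeasurable (Eventually.of_forall hC)
      simp only [smul_sub]
      rw [integral_sub J J', ← tr, ← tr', sub_eq_zero]
      exact neg_injective (h1.symm.trans h2)
  have hMU : ∀ᵐ x ∂M, x ∈ U := by
    rw [ae_iff]
    change M Uᶜ = 0
    simp [hM, hz, hz']
  have : f =ᵐ[M] f' := by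
    filter_upwards [key, hMU, n1, n1', ft, ft'] with x k u a a' t t'
    have k := congrArg norm (sub_eq_zero.1 (k u))
    rw [norm_smul, norm_smul] at k
    simp only [Real.norm_eq_abs, abs_of_nonneg ENNReal.toReal_nonneg] at k
    have z : (f x).toReal * ‖σ x‖ = (f x).toReal := by
      by_cases hx : f x = 0
      · simp [hx]
      · rw [a hx, mul_one]
    have z' : (f' x).toReal * ‖τ x‖ = (f' x).toReal := by
      by_cases hx : f' x = 0
      · simp [hx]
      · rw [a' hx, mul_one]
    rw [z, z'] at k
    exact (ENNReal.toReal_eq_toReal_iff' t.ne t'.ne).1 k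
  rw [← e, ← e', withDensity_congr_ae this]

end

end DiffuseWillmore

open DiffuseWillmore

/-!
The minimality of the constant function and the value of the functional are separate matters, and
both rest on the geometry of thin tubes `{|d| < r}` around the compact connected hypersurface `∂E`.

**Reduction.** For small `ε` the cut-off `η` is invisible to the weight: where `η (2 d / δ) ≠ 1` the
phase field lies in the zero set of the weight (`IsLayerWeight.comp_scaledProfile`), so that the
weight is `W̃ (q (d / ε))`. The profile is `q(r) = tanh (r / √2)` (`IsOptimalProfile.log_eq`), hence
odd and strictly increasing. In both parts `U` is therefore a tube of radius `ε a` with `a > 0`, on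
which `W̃ (u_ε)` has values in `(0, 1]` and `W̃ (λ̄ u_ε) = 1`. The sharp functional becomes
`|∫_U ε⁻¹ W̃ (u_ε) φ| + ε ^ (-3/2) |∇φ|(U)`.

**Minimality of `1`.** Thin tubes satisfy an `L¹` Poincaré inequality
`∬ |f(x) - f(y)| ≤ C r ∫ |∇f|` with a constant `C` independent of the radius `r`
(`IsTubularDist.exists_poincare`). Locally the hypersurface can be straightened, and the inequality
holds on convex slabs because averages over segments are controlled by averages over the slab;
compactness and connectedness of `∂E` chain the local inequalities together. Mollification carries
the inequality over to functions of bounded variation. For `φ = ±1` the left-hand side is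
`|U|² - (∫ φ)²`, and `|U|` is of order `r`, so that replacing `φ` by `1` increases the first term
of the functional by at most `C ε⁻¹ |∇φ|(U)`
(`IsTubularDist.exists_integral_weight_tube_le`). For small `ε` this is less than the gain
`ε ^ (-3/2) |∇φ|(U)` in the second term (`exists_isLeast_sharpFunctional`).

**The value.** The tube of radius `r` has volume `2 r S + O(r³)`
(`IsTubularDist.exists_volume_tube_sub_le`). Moving the shell `{-w ≤ d < w}` along the normals by
`± s` multiplies the volume element by `|det (1 ± s D²d)|`; in the sum over both signs the linear
term in `s` cancels, so that two opposite shells have twice the volume of the central one, up to a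
relative error `O(s²)`. Cutting a tube into thin shells compares its volume with the Minkowski
content of `∂E`, and the latter is the Hausdorff measure of `∂E`: charts whose derivative is
the identity at a point are nearly isometric nearby, and they turn a shell into a right cylinder
(`IsTubularDist.tendsto_volume_shell`). In the first part the weight is `1` on the tube, and the
constant is `2 q⁻¹(1 - λ)`. In the second part the superlevel sets of the weight are tubes because
the weight is even, and the layer cake formula gives the constant `∫ W̃ (q t) dt`
(`IsTubularDist.integral_comp_sub_le`).
-/

namespace DiffuseWillmore

open scoped NNReal ENNReal Convolution

/-! ### The optimal profile -/

theorem hasDerivAt_doubleWell (s : ℝ) : HasDerivAt doubleWell (-(1 - s ^ 2) * s) s := by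
  have : HasDerivAt (fun s : ℝ => (1 - s ^ 2) ^ 2 / 4) (-(1 - s ^ 2) * s) s := by
    have := ((((hasDerivAt_id s).pow 2).const_sub 1).pow 2).div_const 4
    refine this.congr_deriv ?_
    simp; ring
  exact this

namespace IsOptimalProfile

variable {q : ℝ → ℝ}

theorem differentiable (hq : IsOptimalProfile q) : Differentiable ℝ q :=
  hq.contDiff.differentiable (by norm_num)

theorem differentiable_deriv (hq : IsOptimalProfile q) : Differentiable ℝ (deriv q) :=
  ((contDiff_succ_iff_deriv (n := 1)).1 hq.contDiff).2.2.differentiable (by norm_num)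

/-- The discrepancy `q'² / 2 - W(q)` is constant by the equation, and the constant is `0` because
`q' (ξ k) = q (k + 1) - q k → 0` and `W(q (ξ k)) → W(1) = 0` along points `ξ k → ∞`. -/
theorem deriv_sq (hq : IsOptimalProfile q) (r : ℝ) : deriv q r ^ 2 = (1 - q r ^ 2) ^ 2 / 2 := by
  have hE : ∀ t, HasDerivAt (fun t => deriv q t ^ 2 / 2 - doubleWell (q t)) 0 t := by
    intro t
    have h1 := (hq.differentiable_deriv t).hasDerivAt
    have h2 := (hq.differentiable t).hasDerivAt
    have h3 := ((h1.pow 2).div_const 2).sub ((hasDerivAt_doubleWell (q t)).comp t h2)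
    have ode := hq.ode t
    rw [(hasDerivAt_doubleWell (q t)).deriv] at ode
    refine h3.congr_deriv ?_
    have : deriv (deriv q) t = -(1 - q t ^ 2) * q t := by linarith
    rw [this]; simp; ring
  have hc : ∀ t, deriv q t ^ 2 / 2 - doubleWell (q t) = deriv q r ^ 2 / 2 - doubleWell (q r) :=
    fun t => is_const_of_deriv_eq_zero (fun s => (hE s).differentiableAt)
      (fun s => (hE s).deriv) t r
  set c := deriv q r ^ 2 / 2 - doubleWell (q r) with hcdef
  have hmv : ∀ k : ℕ, ∃ ξ ∈ Ioo (k : ℝ) (k + 1), deriv q ξ = q (k + 1) - q k := by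
    intro k
    obtain ⟨ξ, h1, h2⟩ := exists_deriv_eq_slope q (show (k : ℝ) < k + 1 by linarith)
      hq.differentiable.continuous.continuousOn hq.differentiable.differentiableOn
    exact ⟨ξ, h1, by simpa using h2⟩
  choose ξ hξ hξd using hmv
  have hk : Tendsto (fun k : ℕ => (k : ℝ)) atTop atTop := tendsto_natCast_atTop_atTop
  have hξt : Tendsto ξ atTop atTop := tendsto_atTop_mono (fun k => (hξ k).1.le) hk
  have hW : Continuous doubleWell :=
    continuous_iff_continuousAt.2 fun s => (hasDerivAt_doubleWell s).continuousAt
  have l1 : Tendsto (fun k => deriv q (ξ k) ^ 2 / 2 - doubleWell (q (ξ k))) atTop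
      (𝓝 ((1 - 1) ^ 2 / 2 - doubleWell 1)) := by
    refine Tendsto.sub ?_ ((hW.tendsto 1).comp (hq.tendsto_atTop.comp hξt))
    refine (Tendsto.pow ?_ 2).div_const 2
    simp_rw [hξd]
    exact (hq.tendsto_atTop.comp (tendsto_atTop_add_const_right _ _ hk)).sub
      (hq.tendsto_atTop.comp hk)
  have l2 : c = 0 := by
    simp_rw [hc] at l1
    rw [tendsto_nhds_unique tendsto_const_nhds l1]
    simp [doubleWell]
  rw [l2] at hcdef
  unfold doubleWell at hcdef
  linarith

theorem one_sub_sq_pos (hq : IsOptimalProfile q) (r : ℝ) : 0 < 1 - q r ^ 2 := by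
  have := hq.mem_Ioo r
  nlinarith [this.1, this.2]

/-- The sign in `q' = ± (1 - q²) / √2` is constant, as `q'` has no zeros, and it is positive because
`q` increases from `q(0) = 0` to `1`. -/
theorem deriv_eq (hq : IsOptimalProfile q) (r : ℝ) : deriv q r = (1 - q r ^ 2) / √2 := by
  have hne : ∀ t, deriv q t ≠ 0 := by
    intro t h
    have := hq.deriv_sq t
    rw [h] at this
    nlinarith [hq.one_sub_sq_pos t, sq_pos_of_pos (hq.one_sub_sq_pos t)]
  have hpos : ∀ t, 0 < deriv q t := by
    by_contra! hcon
    obtain ⟨t, ht⟩ := hcon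
    have hneg : ∀ s, deriv q s ≤ 0 := by
      intro s
      by_contra! hs
      obtain ⟨x, -, hx⟩ := (isPreconnected_univ (α := ℝ)).intermediate_value (mem_univ t)
        (mem_univ s) hq.differentiable_deriv.continuous.continuousOn ⟨ht, hs.le⟩
      exact hne x hx
    have anti : Antitone q := antitone_of_deriv_nonpos hq.differentiable hneg
    have h1 : (1 : ℝ) ≤ q 0 := anti.le_of_tendsto hq.tendsto_atTop 0
    rw [hq.zero] at h1
    linarith
  have h2 : (0 : ℝ) < √2 := by positivity
  have h3 : deriv q r ^ 2 = ((1 - q r ^ 2) / √2) ^ 2 := by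
    rw [hq.deriv_sq, div_pow, Real.sq_sqrt (by norm_num)]
  exact (pow_left_inj₀ (hpos r).le (div_pos (hq.one_sub_sq_pos r) h2).le two_ne_zero).1 h3

theorem strictMono (hq : IsOptimalProfile q) : StrictMono q :=
  strictMono_of_deriv_pos fun r => by
    rw [hq.deriv_eq]; exact div_pos (hq.one_sub_sq_pos r) (by positivity)

/-- Integrating `q' = (1 - q²) / √2` gives `log ((1 + q) / (1 - q)) = √2 r`, that is
`q(r) = tanh (r / √2)`. -/
theorem log_eq (hq : IsOptimalProfile q) (r : ℝ) :
    Real.log (1 + q r) - Real.log (1 - q r) = √2 * r := by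
  have hd : ∀ t, HasDerivAt (fun t => Real.log (1 + q t) - Real.log (1 - q t) - √2 * t) 0 t := by
    intro t
    have h0 := hq.mem_Ioo t
    have h1 := (hq.differentiable t).hasDerivAt
    have h2 : 1 + q t ≠ 0 := by linarith [h0.1]
    have h3 : 1 - q t ≠ 0 := by linarith [h0.2]
    have := (((h1.const_add 1).log h2).sub ((h1.const_sub 1).log h3)).sub
      ((hasDerivAt_id t).const_mul √2)
    refine this.congr_deriv ?_
    rw [hq.deriv_eq]
    have h4 : √2 ≠ 0 := by positivity
    have h5 : √2 ^ 2 = 2 := Real.sq_sqrt (by norm_num)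
    field_simp
    rw [h5]; ring
  have := is_const_of_deriv_eq_zero (fun s => (hd s).differentiableAt) (fun s => (hd s).deriv) r 0
  simp [hq.zero] at this
  linarith

theorem odd (hq : IsOptimalProfile q) (r : ℝ) : q (-r) = -q r := by
  have h1 := hq.log_eq r
  have h2 := hq.log_eq (-r)
  have a := hq.mem_Ioo r
  have b := hq.mem_Ioo (-r)
  have a1 : 0 < 1 + q r := by linarith [a.1]
  have a2 : 0 < 1 - q r := by linarith [a.2]
  have b1 : 0 < 1 + q (-r) := by linarith [b.1]
  have b2 : 0 < 1 - q (-r) := by linarith [b.2]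
  have h3 : Real.log ((1 + q r) * (1 + q (-r))) = Real.log ((1 - q r) * (1 - q (-r))) := by
    rw [Real.log_mul a1.ne' b1.ne', Real.log_mul a2.ne' b2.ne']
    linarith
  have h4 := Real.log_injOn_pos (mul_pos a1 b1) (mul_pos a2 b2) h3
  linarith

theorem exists_eq (hq : IsOptimalProfile q) {s : ℝ} (hs : s ∈ Ioo (-1 : ℝ) 1) : ∃ r, q r = s := by
  have h1 := (hq.tendsto_atBot.eventually_lt_const hs.1).exists
  have h2 := (hq.tendsto_atTop.eventually_const_lt hs.2).exists
  obtain ⟨x, hx⟩ := h1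
  obtain ⟨y, hy⟩ := h2
  exact mem_range_of_exists_le_of_exists_ge hq.differentiable.continuous ⟨x, hx.le⟩ ⟨y, hy.le⟩

theorem abs_eq (hq : IsOptimalProfile q) (r : ℝ) : |q r| = q |r| := by
  have h0 := hq.zero
  rcases le_total 0 r with h | h
  · rw [abs_of_nonneg h, abs_of_nonneg (h0 ▸ hq.strictMono.monotone h)]
  · rw [abs_of_nonpos h, abs_of_nonpos (h0 ▸ hq.strictMono.monotone h), hq.odd]

theorem pos_of_pos (hq : IsOptimalProfile q) {r : ℝ} (h : 0 < q r) : 0 < r :=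
  hq.strictMono.lt_iff_lt.1 (by rwa [hq.zero])

end IsOptimalProfile

/-! ### Signed distance near a compact hypersurface -/

/-- `d` is a signed distance from the compact set `Sig` that is `C²` on the open tube
`{|d| < R}`, with unit gradient and with second derivatives bounded by `K` there. Off the
tube `d` is only required to be measurable with `|d| = dist (·, Sig)`. -/
structure IsTubularDist {n : ℕ} (Sig : Set (Space n)) (d : Space n → ℝ) (R K : ℝ) : Prop where
  pos : 0 < R
  isCompact : IsCompact Sig
  nonempty : Sig.Nonempty
  measurable : Measurable d
  abs_eq : ∀ x, |d x| = Metric.infDist x Sig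
  contDiffAt : ∀ x, |d x| < R → ContDiffAt ℝ 2 d x
  norm_gradient : ∀ x, |d x| < R → ‖∇ d x‖ = 1
  norm_fderiv_gradient_le : ∀ x, |d x| < R → ‖fderiv ℝ (∇ d) x‖ ≤ K

theorem inner_gradient {n : ℕ} (d : Space n → ℝ) (x v : Space n) :
    inner ℝ (∇ d x) v = fderiv ℝ d x v := by
  rw [← toDual_gradient, InnerProductSpace.toDual_apply_apply]

theorem contDiffAt_gradient {n : ℕ} {d : Space n → ℝ} {x : Space n} (h : ContDiffAt ℝ 2 d x) :
    ContDiffAt ℝ 1 (∇ d) x := by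
  have h1 : ContDiffAt ℝ 1 (fderiv ℝ d) x := h.fderiv_right (by norm_num)
  exact (InnerProductSpace.toDual ℝ (Space n)).symm.contDiff.contDiffAt.comp x h1

theorem fderiv_gradient_apply {n : ℕ} {d : Space n → ℝ} {x : Space n} (h : ContDiffAt ℝ 2 d x)
    (u v : Space n) : inner ℝ (fderiv ℝ (∇ d) x u) v = fderiv ℝ (fderiv ℝ d) x u v := by
  have h1 : DifferentiableAt ℝ (∇ d) x := (contDiffAt_gradient h).differentiableAt (by norm_num)
  have h2 : fderiv ℝ d = fun y => InnerProductSpace.toDual ℝ (Space n) (∇ d y) :=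
    (toDual_comp_gradient).symm
  have h3 : HasFDerivAt (fun y => InnerProductSpace.toDual ℝ (Space n) (∇ d y)) _ x :=
    HasFDerivAt.comp x (InnerProductSpace.toDual ℝ
      (Space n)).toContinuousLinearEquiv.toContinuousLinearMap.hasFDerivAt h1.hasFDerivAt
  rw [h2, h3.fderiv]
  simp

namespace IsTubularDist

variable {n : ℕ} {Sig : Set (Space n)} {d : Space n → ℝ} {R K : ℝ}

theorem abs_le_add_dist (h : IsTubularDist Sig d R K) (x y : Space n) :
    |d x| ≤ |d y| + dist x y := by
  rw [h.abs_eq, h.abs_eq]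
  exact Metric.infDist_le_infDist_add_dist

theorem continuous_abs (h : IsTubularDist Sig d R K) : Continuous fun x => |d x| := by
  simp_rw [h.abs_eq]
  exact Metric.continuous_infDist_pt _

theorem mem_iff (h : IsTubularDist Sig d R K) {x : Space n} : x ∈ Sig ↔ d x = 0 := by
  rw [← abs_eq_zero, h.abs_eq]
  exact h.isCompact.isClosed.mem_iff_infDist_zero h.nonempty

theorem K_nonneg (h : IsTubularDist Sig d R K) : 0 ≤ K := by
  obtain ⟨x, hx⟩ := h.nonempty
  have := h.norm_fderiv_gradient_le x (by rw [h.mem_iff.1 hx, abs_zero]; exact h.pos)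
  exact (norm_nonneg _).trans this

theorem isOpen_tube (h : IsTubularDist Sig d R K) (r : ℝ) : IsOpen {x | |d x| < r} :=
  isOpen_lt h.continuous_abs continuous_const

theorem hasFDerivAt (h : IsTubularDist Sig d R K) {x : Space n} (hx : |d x| < R) :
    HasFDerivAt d (fderiv ℝ d x) x :=
  ((h.contDiffAt x hx).differentiableAt (by norm_num)).hasFDerivAt

theorem hasFDerivAt_gradient (h : IsTubularDist Sig d R K) {x : Space n} (hx : |d x| < R) :
    HasFDerivAt (∇ d) (fderiv ℝ (∇ d) x) x :=
  ((contDiffAt_gradient (h.contDiffAt x hx)).differentiableAt (by norm_num)).hasFDerivAt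

/-- The gradient is a null vector of the second derivative: differentiate `|∇d|² = 1` and use the
symmetry of the second derivative. -/
theorem fderiv_gradient_gradient (h : IsTubularDist Sig d R K) {x : Space n} (hx : |d x| < R) :
    fderiv ℝ (∇ d) x (∇ d x) = 0 := by
  refine ext_inner_right ℝ fun v => ?_
  rw [inner_zero_left, fderiv_gradient_apply (h.contDiffAt x hx)]
  have hs : IsSymmSndFDerivAt ℝ d x :=
    (h.contDiffAt x hx).isSymmSndFDerivAt (by simp)
  rw [hs.eq, ← fderiv_gradient_apply (h.contDiffAt x hx)]
  have h1 : HasFDerivAt (fun y => inner ℝ (∇ d y) (∇ d y)) _ x :=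
    (h.hasFDerivAt_gradient hx).inner ℝ (h.hasFDerivAt_gradient hx)
  have h2 : (fun y => inner ℝ (∇ d y) (∇ d y)) =ᶠ[𝓝 x] fun _ => (1 : ℝ) := by
    filter_upwards [(h.isOpen_tube R).mem_nhds hx] with y hy
    rw [real_inner_self_eq_norm_sq, h.norm_gradient y hy, one_pow]
  have h3 := (h1.congr_of_eventuallyEq h2.symm).unique (hasFDerivAt_const (1 : ℝ) x)
  have h4 := congrArg (fun L => L v) h3
  simp only [ContinuousLinearMap.comp_apply, ContinuousLinearMap.prod_apply,
    fderivInnerCLM_apply, zero_apply] at h4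
  rw [real_inner_comm] at h4
  linarith

theorem abs_add_smul_gradient_le (h : IsTubularDist Sig d R K) {x : Space n} (hx : |d x| < R)
    (s : ℝ) : |d (x + s • ∇ d x)| ≤ |d x| + |s| := by
  refine (h.abs_le_add_dist _ x).trans ?_
  rw [dist_eq_norm, add_sub_cancel_left, norm_smul, h.norm_gradient x hx, mul_one,
    Real.norm_eq_abs]

/-- Along the line `γ(t) = x + t s ∇d(x)` the difference `v = ∇d(γ) - ∇d(x)` satisfies
`v' = -s D²d(γ) v`, because `D²d(γ) ∇d(γ) = 0`; hence `v = 0` by Grönwall's inequality. -/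
theorem gradient_add_smul_segment (h : IsTubularDist Sig d R K) {x : Space n} {s : ℝ}
    (hx : |d x| + |s| < R) {t : ℝ} (ht : t ∈ Icc (0 : ℝ) 1) :
    ∇ d (x + (t * s) • ∇ d x) = ∇ d x := by
  have hx0 : |d x| < R := by linarith [abs_nonneg s]
  have hγ : ∀ t ∈ Icc (0 : ℝ) 1, |d (x + (t * s) • ∇ d x)| < R := by
    intro t ht
    refine (h.abs_add_smul_gradient_le hx0 _).trans_lt ?_
    rw [abs_mul, abs_of_nonneg ht.1]
    nlinarith [abs_nonneg s, ht.2]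
  have hline : ∀ t, HasDerivAt (fun t : ℝ => x + (t * s) • ∇ d x) (s • ∇ d x) t := by
    intro t
    have := (((hasDerivAt_id t).mul_const s).smul_const (∇ d x)).const_add x
    simpa using this
  have hv : ∀ t ∈ Icc (0 : ℝ) 1, HasDerivAt (fun t : ℝ => ∇ d (x + (t * s) • ∇ d x) - ∇ d x)
      (fderiv ℝ (∇ d) (x + (t * s) • ∇ d x) (s • ∇ d x)) t := by
    intro t ht
    exact ((h.hasFDerivAt_gradient (hγ t ht)).comp_hasDerivAt t (hline t)).sub_const _
  have key := eq_zero_of_abs_deriv_le_mul_abs_self_of_eq_zero_right (K := K * |s|)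
    (f := fun t : ℝ => ∇ d (x + (t * s) • ∇ d x) - ∇ d x) (a := 0) (b := 1)
    (fun t ht => (hv t ht).continuousAt.continuousWithinAt)
    (fun t ht => (hv t ⟨ht.1, ht.2.le⟩).hasDerivWithinAt) (by simp) ?_ t ht
  · exact sub_eq_zero.1 key
  · intro t ht
    have ht' : t ∈ Icc (0 : ℝ) 1 := ⟨ht.1, ht.2.le⟩
    set y := x + (t * s) • ∇ d x
    have e : fderiv ℝ (∇ d) y (s • ∇ d x) = -(s • fderiv ℝ (∇ d) y (∇ d y - ∇ d x)) := by
      rw [map_sub, h.fderiv_gradient_gradient (hγ t ht'), map_smul]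
      simp
    rw [e, norm_neg, norm_smul, Real.norm_eq_abs]
    have := (fderiv ℝ (∇ d) y).le_of_opNorm_le (h.norm_fderiv_gradient_le y (hγ t ht'))
      (∇ d y - ∇ d x)
    calc |s| * ‖fderiv ℝ (∇ d) y (∇ d y - ∇ d x)‖ ≤ |s| * (K * ‖∇ d y - ∇ d x‖) := by gcongr
      _ = _ := by ring

theorem gradient_add_smul (h : IsTubularDist Sig d R K) {x : Space n} {s : ℝ}
    (hx : |d x| + |s| < R) : ∇ d (x + s • ∇ d x) = ∇ d x := by
  simpa using h.gradient_add_smul_segment hx (t := 1) (by simp)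

/-- Moving by `s` along the normal direction changes `d` by exactly `s`. -/
theorem dist_add_smul (h : IsTubularDist Sig d R K) {x : Space n} {s : ℝ}
    (hx : |d x| + |s| < R) : d (x + s • ∇ d x) = d x + s := by
  have hx0 : |d x| < R := by linarith [abs_nonneg s]
  have hγ : ∀ t ∈ Icc (0 : ℝ) 1, |d (x + (t * s) • ∇ d x)| < R := by
    intro t ht
    refine (h.abs_add_smul_gradient_le hx0 _).trans_lt ?_
    rw [abs_mul, abs_of_nonneg ht.1]
    nlinarith [abs_nonneg s, ht.2]
  have hline : ∀ t, HasDerivAt (fun t : ℝ => x + (t * s) • ∇ d x) (s • ∇ d x) t := by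
    intro t
    have := (((hasDerivAt_id t).mul_const s).smul_const (∇ d x)).const_add x
    simpa using this
  have hv : ∀ t ∈ Icc (0 : ℝ) 1, HasDerivAt (fun t : ℝ => d (x + (t * s) • ∇ d x)) s t := by
    intro t ht
    refine ((h.hasFDerivAt (hγ t ht)).comp_hasDerivAt t (hline t)).congr_deriv ?_
    rw [← inner_gradient, h.gradient_add_smul_segment hx ht, inner_smul_right,
      real_inner_self_eq_norm_sq, h.norm_gradient x hx0]
    simp
  have hw : ∀ t ∈ Icc (0 : ℝ) 1,
      HasDerivAt (fun t : ℝ => d (x + (t * s) • ∇ d x) - t * s) 0 t := by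
    intro t ht
    refine ((hv t ht).sub ((hasDerivAt_id t).mul_const s)).congr_deriv (by simp)
  have := constant_of_has_deriv_right_zero
    (fun t ht => (hw t ht).continuousAt.continuousWithinAt)
    (fun t ht => (hw t ⟨ht.1, ht.2.le⟩).hasDerivWithinAt) 1 (by simp)
  simp at this
  linarith

/-- The nearest point projection `x - d(x) ∇d(x)` takes values in `Sig`. -/
theorem sub_smul_gradient_mem (h : IsTubularDist Sig d R K) {x : Space n} (hx : |d x| < R / 2) :
    x - d x • ∇ d x ∈ Sig := by
  rw [h.mem_iff, sub_eq_add_neg, ← neg_smul, h.dist_add_smul, add_neg_cancel]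
  rw [abs_neg]; linarith

end IsTubularDist

/-! ### The signed distance of an enclosed region -/

theorem abs_signedDist {n : ℕ} (E : Set (Space n)) (x : Space n) :
    |signedDist E x| = Metric.infDist x (frontier E) := by
  unfold signedDist
  split_ifs
  · exact abs_of_nonneg Metric.infDist_nonneg
  · rw [abs_neg, abs_of_nonneg Metric.infDist_nonneg]

/-- Off the boundary the signed distance is locally `± dist (·, ∂E)`, with a fixed sign. -/
theorem eventually_signedDist {n : ℕ} {E : Set (Space n)} (hE : IsOpen E)
    (hne : (frontier E).Nonempty) {x : Space n} (hx : signedDist E x ≠ 0) :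
    ∃ σ : ℝ, |σ| = 1 ∧ ∀ᶠ y in 𝓝 x, signedDist E y = σ * Metric.infDist y (frontier E) := by
  by_cases hxE : x ∈ E
  · refine ⟨1, by simp, ?_⟩
    filter_upwards [hE.mem_nhds hxE] with y hy
    simp [signedDist, hy]
  · refine ⟨-1, by simp, ?_⟩
    have : x ∉ closure E := by
      intro hc
      apply hx
      rw [← abs_eq_zero, abs_signedDist]
      exact (isClosed_frontier.mem_iff_infDist_zero hne).1 ⟨hc, by rwa [hE.interior_eq]⟩
    filter_upwards [isClosed_closure.isOpen_compl.mem_nhds this] with y hy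
    have : y ∉ E := fun h => hy (subset_closure h)
    simp [signedDist, this]

/-- Away from the boundary the signed distance has unit gradient: it is `1`-Lipschitz, and it
decreases at unit speed towards a nearest boundary point. -/
theorem norm_gradient_signedDist {n : ℕ} {E : Set (Space n)} (hE : IsOpen E)
    (hc : IsCompact (frontier E)) (hne : (frontier E).Nonempty) {x : Space n}
    (hx : signedDist E x ≠ 0) (hd : DifferentiableAt ℝ (signedDist E) x) :
    ‖∇ (signedDist E) x‖ = 1 := by
  obtain ⟨σ, hσ, hev⟩ := eventually_signedDist hE hne hx
  set ρ := fun y => Metric.infDist y (frontier E) with hρ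
  have hx0 : 0 < ρ x := by
    have := abs_pos.2 hx
    rwa [abs_signedDist] at this
  have hnorm : ‖∇ (signedDist E) x‖ = ‖fderiv ℝ (signedDist E) x‖ := by
    rw [← toDual_gradient, LinearIsometryEquiv.norm_map]
  apply le_antisymm
  · rw [hnorm]
    refine norm_fderiv_le_of_lip' ℝ zero_le_one ?_
    filter_upwards [hev] with y hy
    rw [hy, hev.self_of_nhds, ← mul_sub, norm_mul, Real.norm_eq_abs, hσ, one_mul, one_mul,
      ← dist_eq_norm, ← dist_eq_norm]
    simpa using (Metric.lipschitz_infDist_pt (frontier E)).dist_le_mul y x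
  · obtain ⟨y, hy, hxy⟩ := hc.exists_infDist_eq_dist hne x
    -- along the segment from `x` to the nearest point `y` the distance decreases linearly
    have hseg : ∀ t ∈ Icc (0 : ℝ) 1, ρ (x + t • (y - x)) = (1 - t) * ρ x := by
      intro t ht
      have hn : ‖y - x‖ = ρ x := by rw [← dist_eq_norm, dist_comm]; exact hxy.symm
      apply le_antisymm
      · refine (Metric.infDist_le_dist_of_mem hy).trans ?_
        rw [dist_eq_norm, ← hn]
        have : x + t • (y - x) - y = -((1 - t) • (y - x)) := by module
        rw [this, norm_neg, norm_smul, Real.norm_eq_abs, abs_of_nonneg (by linarith [ht.2])]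
      · have h1 : ρ x ≤ ρ (x + t • (y - x)) + dist x (x + t • (y - x)) :=
          Metric.infDist_le_infDist_add_dist
        rw [dist_eq_norm, sub_add_cancel_left, norm_neg, norm_smul, Real.norm_eq_abs,
          abs_of_nonneg ht.1, hn] at h1
        linarith
    have hline : HasDerivAt (fun t : ℝ => x + t • (y - x)) (y - x) 0 := by
      have := ((hasDerivAt_id (0 : ℝ)).smul_const (y - x)).const_add x
      simpa using this
    have hd' : HasFDerivAt (signedDist E) (fderiv ℝ (signedDist E) x) (x + (0 : ℝ) • (y - x)) := by
      simpa using hd.hasFDerivAt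
    have h1 : HasDerivWithinAt (fun t : ℝ => signedDist E (x + t • (y - x)))
        (fderiv ℝ (signedDist E) x (y - x)) (Ici 0) 0 :=
      (HasFDerivAt.comp_hasDerivAt (f := fun t : ℝ => x + t • (y - x)) (0 : ℝ) hd'
        hline).hasDerivWithinAt
    have h2 : HasDerivWithinAt (fun t : ℝ => σ * ((1 - t) * ρ x)) (σ * (-1 * ρ x)) (Ici 0) 0 :=
      ((((hasDerivAt_id (0 : ℝ)).const_sub 1).mul_const (ρ x)).const_mul σ).hasDerivWithinAt
    have h3 : (fun t : ℝ => σ * ((1 - t) * ρ x)) =ᶠ[𝓝[Ici 0] 0]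
        fun t : ℝ => signedDist E (x + t • (y - x)) := by
      have hcont : Tendsto (fun t : ℝ => x + t • (y - x)) (𝓝[Ici 0] 0) (𝓝 x) := by
        have := hline.continuousAt.tendsto
        simp only [zero_smul, add_zero] at this
        exact this.mono_left nhdsWithin_le_nhds
      filter_upwards [hcont.eventually hev, self_mem_nhdsWithin,
        nhdsWithin_le_nhds (Iic_mem_nhds (zero_lt_one' ℝ))] with t h1 h2 h3
      rw [h1, ← hseg t ⟨h2, h3⟩]
    have h4 : fderiv ℝ (signedDist E) x (y - x) = σ * (-1 * ρ x) :=
      (uniqueDiffWithinAt_Ici (0 : ℝ)).eq_deriv _ h1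
        (h2.congr_of_eventuallyEq h3.symm (by simp [hev.self_of_nhds, hρ]))
    have h5 := (fderiv ℝ (signedDist E) x).le_opNorm (y - x)
    rw [h4, norm_mul, norm_mul, Real.norm_eq_abs, hσ, ← dist_eq_norm y, dist_comm, ← hxy] at h5
    change 1 * (‖(-1 : ℝ)‖ * ‖ρ x‖) ≤ _ * ρ x at h5
    rw [norm_neg, norm_one, one_mul, one_mul, Real.norm_eq_abs, abs_of_pos hx0, ← hnorm] at h5
    exact le_of_mul_le_mul_right (by linarith) hx0

theorem measurable_signedDist {n : ℕ} {E : Set (Space n)} (hE : IsOpen E) :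
    Measurable (signedDist E) :=
  Measurable.ite hE.measurableSet (Metric.continuous_infDist_pt _).measurable
    (Metric.continuous_infDist_pt _).measurable.neg

/-- The radius `R` is half of the radius for which `d` is `C²`, so that `D²d` is bounded by
compactness. -/
theorem exists_isTubularDist {n : ℕ} {Ω E : Set (Space n)} {S δ : ℝ} (h : IsEnclosedRegion Ω E S)
    (hδ : IsTubeWidth Ω E δ) :
    ∃ R K, IsTubularDist (frontier E) (signedDist E) R K := by
  have hc : IsCompact (frontier E) :=
    Metric.isCompact_of_isClosed_isBounded isClosed_frontier
      (h.isBounded.closure.subset frontier_subset_closure)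
  have hne : (frontier E).Nonempty := h.isConnected_frontier.nonempty
  obtain ⟨ρ, hρ, hρΩ⟩ := hc.exists_thickening_subset_open h.isOpen_container h.frontier_subset
  set R₀ := min ρ δ with hR₀
  have hR₀pos : 0 < R₀ := lt_min hρ hδ.1
  have hcd : ∀ x, Metric.infDist x (frontier E) < R₀ → ContDiffAt ℝ 2 (signedDist E) x := by
    intro x hx
    refine hδ.2.contDiffAt ?_
    have ho : IsOpen {x | Metric.infDist x (frontier E) < R₀} :=
      isOpen_lt (Metric.continuous_infDist_pt _) continuous_const
    filter_upwards [ho.mem_nhds hx] with y hy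
    refine ⟨hρΩ ?_, (hy.trans_le (min_le_right _ _)).le⟩
    rw [Metric.thickening_eq_biUnion_ball]
    obtain ⟨z, hz, hyz⟩ := (Metric.infDist_lt_iff hne).1 (hy.trans_le (min_le_left _ _))
    exact mem_biUnion hz (by simpa using hyz)
  have hsub : {x | Metric.infDist x (frontier E) ≤ R₀ / 2} ⊆
      Metric.cthickening (R₀ / 2) (frontier E) := by
    intro x hx
    obtain ⟨z, hz, hxz⟩ := hc.exists_infDist_eq_dist hne x
    exact Metric.mem_cthickening_of_dist_le x z _ _ hz (hxz ▸ hx)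
  have hcl : IsCompact {x | Metric.infDist x (frontier E) ≤ R₀ / 2} :=
    hc.cthickening.of_isClosed_subset
      (isClosed_le (Metric.continuous_infDist_pt _) continuous_const) hsub
  have hlt : ∀ x, Metric.infDist x (frontier E) ≤ R₀ / 2 → Metric.infDist x (frontier E) < R₀ :=
    fun x hx => by linarith
  obtain ⟨K, hK⟩ := hcl.exists_bound_of_continuousOn (f := fderiv ℝ (∇ (signedDist E)))
    fun x hx => (((contDiffAt_gradient (hcd x (hlt x hx))).fderiv_right (m := 0)
      (by norm_num)).continuousAt).continuousWithinAt
  refine ⟨R₀ / 2, K, by positivity, hc, hne, measurable_signedDist h.isOpen,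
    abs_signedDist E, fun x hx => ?_, fun x hx => ?_, fun x hx => ?_⟩ <;> rw [abs_signedDist] at hx
  · exact hcd x (hlt x hx.le)
  · by_cases h0 : signedDist E x = 0
    · -- on `∂E` the unit length of the gradient is inherited from nearby points of `E`
      have hxf : x ∈ frontier E := by
        rw [isClosed_frontier.mem_iff_infDist_zero hne, ← abs_signedDist, h0, abs_zero]
      have hfr : ∃ᶠ y in 𝓝 x, y ∈ E := mem_closure_iff_frequently.1 (frontier_subset_closure hxf)
      have ho : IsOpen {x | Metric.infDist x (frontier E) < R₀ / 2} :=
        isOpen_lt (Metric.continuous_infDist_pt _) continuous_const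
      have hfr1 : ∃ᶠ y in 𝓝 x, ‖∇ (signedDist E) y‖ ∈ ({1} : Set ℝ) := by
        refine (hfr.and_eventually (ho.mem_nhds hx)).mono fun y hy => ?_
        refine norm_gradient_signedDist h.isOpen hc hne ?_
          ((hcd y (hlt y (le_of_lt hy.2))).differentiableAt (by norm_num))
        intro hy0
        have : y ∈ frontier E := by
          rw [isClosed_frontier.mem_iff_infDist_zero hne, ← abs_signedDist, hy0, abs_zero]
        exact this.2 (by rw [h.isOpen.interior_eq]; exact hy.1)
      have hcont : ContinuousAt (fun y => ‖∇ (signedDist E) y‖) x :=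
        (contDiffAt_gradient (hcd x (hlt x hx.le))).continuousAt.norm
      exact isClosed_singleton.mem_of_frequently_of_tendsto hfr1 hcont
    · exact norm_gradient_signedDist h.isOpen hc hne h0
        ((hcd x (hlt x hx.le)).differentiableAt (by norm_num))
  · exact hK x hx.le

/-! ### Volume of tubes: opposite shells -/

/-- By Leibniz' formula, the determinant is a polynomial in the matrix entries. -/
theorem contDiff_det (n : ℕ) {m : WithTop ℕ∞} :
    ContDiff ℝ m fun A : Space n →L[ℝ] Space n => A.det := by
  let b := (EuclideanSpace.basisFun (Fin n) ℝ).toBasis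
  have h1 : ∀ i j, ContDiff ℝ m
      fun A : Space n →L[ℝ] Space n => LinearMap.toMatrix b b (A : Space n →ₗ[ℝ] Space n) i j := by
    intro i j
    let L : (Space n →L[ℝ] Space n) →ₗ[ℝ] ℝ :=
      { toFun := fun A => LinearMap.toMatrix b b (A : Space n →ₗ[ℝ] Space n) i j
        map_add' := fun A B => by simp
        map_smul' := fun c A => by simp }
    exact L.toContinuousLinearMap.contDiff
  have h2 : (fun A : Space n →L[ℝ] Space n => A.det) = fun A : Space n →L[ℝ] Space n =>
      ∑ σ : Equiv.Perm (Fin n), ((Equiv.Perm.sign σ : ℤ) : ℝ) *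
        ∏ i, LinearMap.toMatrix b b (A : Space n →ₗ[ℝ] Space n) (σ i) i := by
    funext A
    change LinearMap.det (A : Space n →ₗ[ℝ] Space n) = _
    rw [← LinearMap.det_toMatrix b, Matrix.det_apply']
  rw [h2]
  exact ContDiff.sum fun σ _ => contDiff_const.mul (contDiff_prod fun i _ => h1 _ _)

/-- The first-order term of the determinant at the identity is odd, so it cancels in the
symmetric sum. -/
theorem exists_abs_det_add_abs_det_sub (n : ℕ) : ∃ C b : ℝ, 0 ≤ C ∧ 0 < b ∧
    ∀ B : Space n →L[ℝ] Space n, ‖B‖ ≤ b →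
      |(|(1 + B).det| + |(1 - B).det| - 2)| ≤ C * ‖B‖ ^ 2 := by
  set f : (Space n →L[ℝ] Space n) → ℝ := fun B => (1 + B).det with hf
  have hfc : ContDiff ℝ 2 f := (contDiff_det n).comp (contDiff_const.add contDiff_id)
  have hf0 : f 0 = 1 := by
    simp only [hf, add_zero]
    exact LinearMap.det_id
  have hfd : Differentiable ℝ f := hfc.differentiable (by norm_num)
  obtain ⟨K, t, ht, hK⟩ :=
    ((hfc.fderiv_right (m := 1) (by norm_num)).contDiffAt (x := 0)).exists_lipschitzOnWith
  have hpos : ∀ᶠ B in 𝓝 (0 : Space n →L[ℝ] Space n), 0 < f B :=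
    hfc.continuous.continuousAt.eventually_const_lt (by rw [hf0]; norm_num)
  obtain ⟨b, hb, hball⟩ := Metric.mem_nhds_iff.1 (inter_mem ht hpos)
  have hexp : ∀ B : Space n →L[ℝ] Space n, ‖B‖ ≤ b / 2 →
      |f B - 1 - fderiv ℝ f 0 B| ≤ K * ‖B‖ ^ 2 := by
    intro B hB
    have hin : ∀ A ∈ Metric.closedBall (0 : Space n →L[ℝ] Space n) ‖B‖, A ∈ Metric.ball 0 b := by
      intro A hA
      rw [mem_closedBall_zero_iff] at hA
      rw [mem_ball_zero_iff]; linarith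
    have := (convex_closedBall (0 : Space n →L[ℝ] Space n) ‖B‖).norm_image_sub_le_of_norm_fderiv_le'
      (𝕜 := ℝ) (f := f) (φ := fderiv ℝ f 0) (C := K * ‖B‖) (x := 0) (y := B)
      (fun A _ => hfd A) (fun A hA => ?_) (by simp) (by simp)
    · rw [hf0, sub_zero, Real.norm_eq_abs] at this
      linarith
    · have h1 := hK.dist_le_mul A (hball (hin A hA)).1 0
        (hball (hin 0 (by simp))).1
      rw [dist_eq_norm, dist_zero_right] at h1
      refine h1.trans ?_
      rw [mem_closedBall_zero_iff] at hA
      gcongr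
  refine ⟨2 * K, b / 2, by positivity, by positivity, fun B hB => ?_⟩
  have hin : ∀ A : Space n →L[ℝ] Space n, ‖A‖ ≤ b / 2 → 0 < f A := by
    intro A hA
    exact (hball (mem_ball_zero_iff.2 (by linarith))).2
  have e1 : |(1 + B).det| = f B := abs_of_pos (hin B hB)
  have e2 : |(1 - B).det| = f (-B) := by
    have := hin (-B) (by rwa [norm_neg])
    simp only [hf, ← sub_eq_add_neg] at this ⊢
    exact abs_of_pos this
  rw [e1, e2]
  have h1 := hexp B hB
  have h2 := hexp (-B) (by rwa [norm_neg])
  rw [norm_neg, map_neg] at h2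
  rw [abs_le] at h1 h2 ⊢
  constructor <;> linarith [h1.1, h1.2, h2.1, h2.2]

namespace IsTubularDist

variable {n : ℕ} {Sig : Set (Space n)} {d : Space n → ℝ} {R K : ℝ}

theorem add_smul_neg (h : IsTubularDist Sig d R K) {x : Space n} {s : ℝ}
    (hx : |d x| + |s| < R) :
    (x + s • ∇ d x) + (-s) • ∇ d (x + s • ∇ d x) = x := by
  rw [h.gradient_add_smul hx]
  module

/-- The shift by `s` along the normals maps shells onto shells. -/
theorem image_shift (h : IsTubularDist Sig d R K) {a b s : ℝ}
    (ha : |a| + 2 * |s| < R) (hb : |b| + 2 * |s| < R) :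
    (fun x => x + s • ∇ d x) '' (d ⁻¹' Ico a b) = d ⁻¹' Ico (a + s) (b + s) := by
  have hs := abs_nonneg s
  have hs' := le_abs_self s
  have hs'' := neg_abs_le s
  rw [← lt_sub_iff_add_lt, abs_lt] at ha hb
  apply Subset.antisymm
  · rintro _ ⟨x, ⟨h1, h2⟩, rfl⟩
    have hx : |d x| + |s| < R := by
      rw [← lt_sub_iff_add_lt, abs_lt]; constructor <;> linarith [ha.1, hb.2]
    simp only [mem_preimage, h.dist_add_smul hx, mem_Ico]
    constructor <;> linarith
  · rintro z ⟨h1, h2⟩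
    have hz : |d z| + |(-s)| < R := by
      rw [abs_neg, ← lt_sub_iff_add_lt, abs_lt]; constructor <;> linarith [ha.1, hb.2]
    refine ⟨z + (-s) • ∇ d z, ?_, ?_⟩
    · simp only [mem_preimage, h.dist_add_smul hz, mem_Ico]
      constructor <;> linarith
    · have := h.add_smul_neg hz
      rwa [neg_neg] at this

/-- Change of variables for the shift along the normals, whose derivative is `1 + s D²d`. -/
theorem volume_shift (h : IsTubularDist Sig d R K) {a b s : ℝ}
    (ha : |a| + 2 * |s| < R) (hb : |b| + 2 * |s| < R) :
    ∫⁻ x in d ⁻¹' Ico a b, ENNReal.ofReal |(1 + s • fderiv ℝ (∇ d) x).det| =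
      volume (d ⁻¹' Ico (a + s) (b + s)) := by
  rw [← h.image_shift ha hb]
  have hs := abs_nonneg s
  have hx : ∀ x ∈ d ⁻¹' Ico a b, |d x| + |s| < R := by
    rintro x ⟨h1, h2⟩
    rw [← lt_sub_iff_add_lt, abs_lt] at ha hb ⊢
    constructor <;> linarith [ha.1, hb.2]
  refine lintegral_abs_det_fderiv_eq_addHaar_image volume (h.measurable measurableSet_Ico)
    (f' := fun x => 1 + s • fderiv ℝ (∇ d) x) (fun x hxm => ?_) ?_
  · have hx0 : |d x| < R := by linarith [hx x hxm]
    exact ((hasFDerivAt_id x).add ((h.hasFDerivAt_gradient hx0).const_smul s)).hasFDerivWithinAt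
  · intro x hxm y hym hxy
    rw [← h.add_smul_neg (hx x hxm), ← h.add_smul_neg (hx y hym)]
    simp only at hxy
    rw [hxy]

theorem volume_shell_lt_top (h : IsTubularDist Sig d R K) (a b : ℝ) :
    volume (d ⁻¹' Ico a b) < ⊤ := by
  obtain ⟨x, hx⟩ := h.nonempty
  refine (measure_mono ?_).trans_lt (h.isCompact.isBounded.cthickening
    (δ := max |a| |b|)).measure_lt_top
  rintro y ⟨h1, h2⟩
  obtain ⟨z, hz, hyz⟩ := h.isCompact.exists_infDist_eq_dist h.nonempty y
  refine Metric.mem_cthickening_of_dist_le y z _ _ hz ?_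
  rw [← hyz, ← h.abs_eq]
  rcases le_total 0 (d y) with h0 | h0
  · rw [abs_of_nonneg h0]
    exact h2.le.trans ((le_abs_self b).trans (le_max_right _ _))
  · rw [abs_of_nonpos h0]
    exact (neg_le_neg h1).trans ((neg_le_abs a).trans (le_max_left _ _))

theorem measureReal_shift (h : IsTubularDist Sig d R K) {a b s : ℝ}
    (ha : |a| + 2 * |s| < R) (hb : |b| + 2 * |s| < R) :
    IntegrableOn (fun x => |(1 + s • fderiv ℝ (∇ d) x).det|) (d ⁻¹' Ico a b) ∧
    ∫ x in d ⁻¹' Ico a b, |(1 + s • fderiv ℝ (∇ d) x).det| =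
      volume.real (d ⁻¹' Ico (a + s) (b + s)) := by
  have hs := abs_nonneg s
  have hx : ∀ x ∈ d ⁻¹' Ico a b, |d x| < R := by
    rintro x ⟨h1, h2⟩
    rw [← lt_sub_iff_add_lt, abs_lt] at ha hb
    rw [abs_lt]
    constructor <;> linarith [ha.1, hb.2]
  have hm : AEStronglyMeasurable (fun x => |(1 + s • fderiv ℝ (∇ d) x).det|)
      (volume.restrict (d ⁻¹' Ico a b)) := by
    refine ContinuousOn.aestronglyMeasurable (fun x hxm => ?_) (h.measurable measurableSet_Ico)
    have h1 : ContinuousAt (fderiv ℝ (∇ d)) x :=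
      ((contDiffAt_gradient (h.contDiffAt x (hx x hxm))).fderiv_right (m := 0)
        (by norm_num)).continuousAt
    have h2 : ContinuousAt (fun x => (1 : Space n →L[ℝ] Space n) + s • fderiv ℝ (∇ d) x) x :=
      continuousAt_const.add (h1.const_smul s)
    exact (ContinuousLinearMap.continuous_det.continuousAt.comp h2).abs.continuousWithinAt
  have hl := h.volume_shift ha hb
  constructor
  · refine ⟨hm, ?_⟩
    rw [hasFiniteIntegral_iff_ofReal (Eventually.of_forall fun x => abs_nonneg _), hl]
    exact h.volume_shell_lt_top _ _
  · rw [integral_eq_lintegral_of_nonneg_ae (Eventually.of_forall fun x => abs_nonneg _) hm, hl]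
    rfl

/-- Two shells at opposite heights have together twice the volume of the central shell, up to a
relative error of second order. -/
theorem exists_volume_shift_pair (h : IsTubularDist Sig d R K) : ∃ C s₀ : ℝ, 0 ≤ C ∧ 0 < s₀ ∧
    ∀ w s : ℝ, 0 < w → w ≤ s₀ → |s| ≤ s₀ →
      |volume.real (d ⁻¹' Ico (-w + s) (w + s)) + volume.real (d ⁻¹' Ico (-w - s) (w - s)) -
        2 * volume.real (d ⁻¹' Ico (-w) w)| ≤ C * s ^ 2 * volume.real (d ⁻¹' Ico (-w) w) := by
  obtain ⟨C, b, hC, hb, hdet⟩ := exists_abs_det_add_abs_det_sub n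
  have hK := h.K_nonneg
  have hR := h.pos
  refine ⟨C * K ^ 2, min (R / 6) (b / (K + 1)), by positivity, by positivity, ?_⟩
  intro w s hw hw0 hs0
  have hw1 := hw0.trans (min_le_left _ _)
  have hs1 := hs0.trans (min_le_left _ _)
  have hs2 := hs0.trans (min_le_right _ _)
  rw [le_div_iff₀ (by positivity)] at hs2
  have hsn := abs_nonneg s
  have a1 : |(-w)| + 2 * |s| < R := by rw [abs_neg, abs_of_pos hw]; linarith
  have a2 : |w| + 2 * |s| < R := by rw [abs_of_pos hw]; linarith
  obtain ⟨i1, e1⟩ := h.measureReal_shift a1 a2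
  obtain ⟨i2, e2⟩ := h.measureReal_shift (a := -w) (b := w) (s := -s)
    (by rwa [abs_neg s]) (by rwa [abs_neg s])
  rw [sub_eq_add_neg (-w), sub_eq_add_neg w, ← e1, ← e2]
  have i3 : IntegrableOn (fun _ => (2 : ℝ)) (d ⁻¹' Ico (-w) w) :=
    integrableOn_const (h.volume_shell_lt_top _ _).ne
  have e4 : 2 * volume.real (d ⁻¹' Ico (-w) w) = ∫ x in d ⁻¹' Ico (-w) w, (2 : ℝ) := by
    simp [mul_comm]
  have e5 := integral_sub (i1.add i2) i3
  simp only [Pi.add_apply] at e5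
  rw [e4, ← integral_add i1 i2, ← e5, ← Real.norm_eq_abs]
  refine (norm_setIntegral_le_of_norm_le_const (h.volume_shell_lt_top _ _)
    (C := C * K ^ 2 * s ^ 2) fun x hx => ?_)
  have hx0 : |d x| < R := by
    rw [abs_lt]; constructor <;> linarith [hx.1, hx.2]
  have hB : ‖s • fderiv ℝ (∇ d) x‖ ≤ |s| * K := by
    rw [norm_smul, Real.norm_eq_abs]
    exact mul_le_mul_of_nonneg_left (h.norm_fderiv_gradient_le x hx0) hsn
  have := hdet (s • fderiv ℝ (∇ d) x) (hB.trans (by nlinarith))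
  have e6 : (1 : Space n →L[ℝ] Space n) + -s • fderiv ℝ (∇ d) x = 1 - s • fderiv ℝ (∇ d) x := by
    ext1 v
    simp [sub_eq_add_neg]
  rw [Real.norm_eq_abs, e6]
  refine this.trans ?_
  calc C * ‖s • fderiv ℝ (∇ d) x‖ ^ 2 ≤ C * (|s| * K) ^ 2 := by gcongr
    _ = C * K ^ 2 * s ^ 2 := by rw [mul_pow, sq_abs]; ring

/-- Cut the shell `{-r ≤ d < r}`, `r = 2kw`, into `k` pairs of opposite shells of thickness `2w`,
centred at the heights `± (2j + 1) w`, `j < k`. -/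
theorem exists_volume_shell_sub_le (h : IsTubularDist Sig d R K) : ∃ C s₀ : ℝ, 0 ≤ C ∧ 0 < s₀ ∧
    ∀ w : ℝ, 0 < w → ∀ k : ℕ, 2 * k * w ≤ s₀ →
      |volume.real (d ⁻¹' Ico (-(2 * k * w)) (2 * k * w)) -
        2 * k * volume.real (d ⁻¹' Ico (-w) w)| ≤
        C * (2 * k * w) ^ 2 * (k * volume.real (d ⁻¹' Ico (-w) w)) := by
  obtain ⟨C, s₀, hC, hs₀, hpair⟩ := h.exists_volume_shift_pair
  refine ⟨C, s₀, hC, hs₀, fun w hw k => ?_⟩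
  have hsplit : ∀ a b c : ℝ, a ≤ b → b ≤ c → volume.real (d ⁻¹' Ico a c) =
      volume.real (d ⁻¹' Ico a b) + volume.real (d ⁻¹' Ico b c) := by
    intro a b c hab hbc
    rw [← Ico_union_Ico_eq_Ico hab hbc, preimage_union]
    exact measureReal_union (disjoint_left.2 fun x h1 h2 => absurd h1.2 (not_lt.2 h2.1))
      (h.measurable measurableSet_Ico) (h.volume_shell_lt_top _ _).ne
      (h.volume_shell_lt_top _ _).ne
  induction k with
  | zero => intro _; simp
  | succ k ih =>
    intro hk
    push_cast at hk ⊢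
    have hkw : (0 : ℝ) ≤ k * w := by positivity
    have ih := ih (by nlinarith)
    have h1 := hpair w ((2 * k + 1) * w) hw (by nlinarith) (by
      rw [abs_of_nonneg (by positivity)]; nlinarith)
    have e1 : -w + (2 * k + 1) * w = 2 * k * w := by ring
    have e2 : w + (2 * k + 1) * w = 2 * (k + 1) * w := by ring
    have e3 : -w - (2 * k + 1) * w = -(2 * (k + 1) * w) := by ring
    have e4 : w - (2 * k + 1) * w = -(2 * k * w) := by ring
    rw [e1, e2, e3, e4] at h1
    rw [hsplit (-(2 * (k + 1) * w)) (-(2 * k * w)) (2 * (k + 1) * w) (by nlinarith) (by nlinarith),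
      hsplit (-(2 * k * w)) (2 * k * w) (2 * (k + 1) * w) (by nlinarith) (by nlinarith)]
    set V := volume.real (d ⁻¹' Ico (-w) w)
    have hV : 0 ≤ V := measureReal_nonneg
    have b1 : C * ((2 * k + 1) * w) ^ 2 * V ≤ C * (2 * (k + 1) * w) ^ 2 * V := by
      gcongr; linarith
    have b2 : C * (2 * k * w) ^ 2 * (k * V) ≤ C * (2 * (k + 1) * w) ^ 2 * (k * V) := by
      gcongr; linarith
    rw [abs_le] at ih h1 ⊢
    constructor <;> linarith [ih.1, ih.2, h1.1, h1.2]

/-- If the two-sided Minkowski content of `Sig` is `S`, the tube of radius `r` has volume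
`2 r S + O(r³)`. -/
theorem exists_volume_tube_sub_le (h : IsTubularDist Sig d R K) {S : ℝ}
    (hS : Tendsto (fun w => volume.real (d ⁻¹' Ico (-w) w) / (2 * w)) (𝓝[>] 0) (𝓝 S)) :
    ∃ C s₀ : ℝ, 0 ≤ C ∧ 0 < s₀ ∧ ∀ r : ℝ, 0 < r → r ≤ s₀ →
      |volume.real {x | |d x| < r} - 2 * r * S| ≤ C * r ^ 3 := by
  obtain ⟨C, s₀, hC, hs₀, hshell⟩ := h.exists_volume_shell_sub_le
  have hS0 : 0 ≤ S := by
    refine ge_of_tendsto hS ?_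
    filter_upwards [self_mem_nhdsWithin] with w hw
    have : (0 : ℝ) < w := hw
    positivity
  -- let the number of shells tend to infinity in the previous estimate
  have key : ∀ r : ℝ, 0 < r → r ≤ s₀ →
      |volume.real (d ⁻¹' Ico (-r) r) - 2 * r * S| ≤ C * S * r ^ 3 := by
    intro r hr hr0
    have hw : Tendsto (fun k : ℕ => r / (2 * (k + 1 : ℕ))) atTop (𝓝[>] 0) := by
      rw [tendsto_nhdsWithin_iff]
      constructor
      · have h1 : Tendsto (fun k : ℕ => ((k + 1 : ℕ) : ℝ)) atTop atTop :=
          tendsto_natCast_atTop_atTop.comp (tendsto_add_atTop_nat 1)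
        exact (h1.const_mul_atTop (by norm_num : (0 : ℝ) < 2)).const_div_atTop r
      · exact Eventually.of_forall fun k => mem_Ioi.2 (by positivity)
    have hlim := hS.comp hw
    refine le_of_tendsto_of_tendsto
      (f := fun k : ℕ => |volume.real (d ⁻¹' Ico (-r) r) - 2 * r *
        ((fun w => volume.real (d ⁻¹' Ico (-w) w) / (2 * w)) ∘
          fun k : ℕ => r / (2 * (k + 1 : ℕ))) k|)
      (g := fun k : ℕ => C * ((fun w => volume.real (d ⁻¹' Ico (-w) w) / (2 * w)) ∘
          fun k : ℕ => r / (2 * (k + 1 : ℕ))) k * r ^ 3)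
      (((hlim.const_mul _).const_sub _).abs) ((hlim.const_mul C).mul_const _) ?_
    refine Eventually.of_forall fun k => ?_
    have hk : (0 : ℝ) < (k + 1 : ℕ) := by positivity
    have e : 2 * ((k + 1 : ℕ) : ℝ) * (r / (2 * (k + 1 : ℕ))) = r := by field_simp
    have := hshell (r / (2 * (k + 1 : ℕ))) (by positivity) (k + 1) (by rw [e]; exact hr0)
    rw [e] at this
    simp only [Function.comp]
    set V := volume.real (d ⁻¹' Ico (-(r / (2 * (k + 1 : ℕ)))) (r / (2 * (k + 1 : ℕ))))
    have e1 : 2 * r * (V / (2 * (r / (2 * (k + 1 : ℕ))))) = 2 * (k + 1 : ℕ) * V := by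
      field_simp
    have e2 : C * (V / (2 * (r / (2 * (k + 1 : ℕ))))) * r ^ 3 = C * r ^ 2 * ((k + 1 : ℕ) * V) := by
      field_simp
    rw [e1, e2]
    exact this
  refine ⟨C * S, s₀, by positivity, hs₀, fun r hr hr0 => ?_⟩
  have hfin : ∀ a b, volume (d ⁻¹' Ico a b) ≠ ⊤ := fun a b => (h.volume_shell_lt_top a b).ne
  have hsub : {x | |d x| < r} ⊆ d ⁻¹' Ico (-r) r := fun x hx =>
    ⟨(abs_lt.1 hx).1.le, (abs_lt.1 hx).2⟩
  have up : volume.real {x | |d x| < r} ≤ volume.real (d ⁻¹' Ico (-r) r) :=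
    measureReal_mono hsub (hfin _ _)
  -- the open tube is exhausted by the half-open shells of radius `r' < r`
  have low : ∀ r' ∈ Ioo 0 r, 2 * r' * S - C * S * r ^ 3 ≤ volume.real {x | |d x| < r} := by
    intro r' hr'
    have h1 : volume.real (d ⁻¹' Ico (-r') r') ≤ volume.real {x | |d x| < r} := by
      refine measureReal_mono (fun x hx => ?_) (measure_ne_top_of_subset hsub (hfin _ _))
      exact abs_lt.2 ⟨by linarith [hx.1, hr'.2], hx.2.trans hr'.2⟩
    have h2 := (abs_le.1 (key r' hr'.1 (hr'.2.le.trans hr0))).1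
    have h3 : C * S * r' ^ 3 ≤ C * S * r ^ 3 := by
      have := hr'.1.le
      have := hr'.2.le
      gcongr
    linarith
  have low' : 2 * r * S - C * S * r ^ 3 ≤ volume.real {x | |d x| < r} := by
    have hc : Continuous fun r' : ℝ => 2 * r' * S - C * S * r ^ 3 := by fun_prop
    refine le_of_tendsto (hc.continuousWithinAt (s := Iio r) (x := r)).tendsto ?_
    filter_upwards [Ioo_mem_nhdsLT hr] with r' hr' using low r' hr'
  have h2 := (abs_le.1 (key r hr hr0)).2
  rw [abs_le]
  constructor <;> linarith

end IsTubularDist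

/-! ### Hausdorff measure and near-isometries -/

theorem euclideanHausdorffMeasure_image_le {n : ℕ} {f : Space n → Space n} {s : Set (Space n)}
    {L : ℝ≥0} (hf : LipschitzOnWith L f s) (k : ℕ) :
    μHE[k] (f '' s) ≤ (L : ℝ≥0∞) ^ k * μHE[k] s := by
  have h := hf.hausdorffMeasure_image_le (d := k) (by positivity)
  rw [ENNReal.rpow_natCast] at h
  rw [Measure.euclideanHausdorffMeasure_def, Measure.smul_apply, Measure.smul_apply,
    ENNReal.smul_def, ENNReal.smul_def, smul_eq_mul, smul_eq_mul, mul_left_comm]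
  gcongr

/-- `f` is injective on `s`, and `f` and its inverse are Lipschitz with the same constant `L`. -/
def BiLipschitzOn {n : ℕ} (L : ℝ≥0) (f : Space n → Space n) (s : Set (Space n)) : Prop :=
  ∀ x ∈ s, ∀ y ∈ s, dist (f x) (f y) ≤ L * dist x y ∧ dist x y ≤ L * dist (f x) (f y)

namespace BiLipschitzOn

variable {n : ℕ} {L : ℝ≥0} {f : Space n → Space n} {s t : Set (Space n)}

theorem mono (h : BiLipschitzOn L f t) (hst : s ⊆ t) : BiLipschitzOn L f s :=
  fun x hx y hy => h x (hst hx) y (hst hy)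

theorem measure_image_le (h : BiLipschitzOn L f s) (k : ℕ) :
    μHE[k] (f '' s) ≤ (L : ℝ≥0∞) ^ k * μHE[k] s :=
  euclideanHausdorffMeasure_image_le
    (LipschitzOnWith.of_dist_le_mul fun x hx y hy => (h x hx y hy).1) k

theorem measure_le_image (h : BiLipschitzOn L f s) (k : ℕ) :
    μHE[k] s ≤ (L : ℝ≥0∞) ^ k * μHE[k] (f '' s) := by
  have hinj : InjOn f s := fun x hx y hy hxy => by
    have := (h x hx y hy).2
    rw [hxy, dist_self, mul_zero] at this
    exact dist_le_zero.1 this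
  have hinv : LeftInvOn (Function.invFunOn f s) f s := hinj.leftInvOn_invFunOn
  have e : Function.invFunOn f s '' (f '' s) = s := hinv.image_image
  have := euclideanHausdorffMeasure_image_le (f := Function.invFunOn f s) (s := f '' s) (L := L)
    (LipschitzOnWith.of_dist_le_mul ?_) k
  · rwa [e] at this
  · rintro _ ⟨x, hx, rfl⟩ _ ⟨y, hy, rfl⟩
    rw [hinv hx, hinv hy]
    exact (h x hx y hy).2

theorem volume_image_le (h : BiLipschitzOn L f s) :
    volume (f '' s) ≤ (L : ℝ≥0∞) ^ n * volume s := by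
  have := h.measure_image_le n
  rwa [EuclideanSpace.euclideanHausdorffMeasure_eq_volume] at this

theorem volume_le_image (h : BiLipschitzOn L f s) :
    volume s ≤ (L : ℝ≥0∞) ^ n * volume (f '' s) := by
  have := h.measure_le_image n
  rwa [EuclideanSpace.euclideanHausdorffMeasure_eq_volume] at this

end BiLipschitzOn

/-- A map whose strict derivative at `z` is the identity is nearly isometric near `z`: it suffices
that `f - id` has Lipschitz constant `1 - L⁻¹`. -/
theorem exists_biLipschitzOn {n : ℕ} {f : Space n → Space n} {z : Space n}
    (hf : HasStrictFDerivAt f (ContinuousLinearMap.id ℝ (Space n)) z) {L : ℝ≥0} (hL : 1 < L) :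
    ∃ ρ > 0, BiLipschitzOn L f (Metric.ball z ρ) := by
  have hL' : (1 : ℝ) < L := by exact_mod_cast hL
  have hc : 0 < 1 - (L : ℝ)⁻¹ := sub_pos.2 (inv_lt_one_of_one_lt₀ hL')
  set c : ℝ≥0 := ⟨1 - (L : ℝ)⁻¹, hc.le⟩ with hcdef
  obtain ⟨s, hs, ha⟩ := hf.approximates_deriv_on_nhds (c := c) (Or.inr hc)
  obtain ⟨ρ, hρ, hball⟩ := Metric.mem_nhds_iff.1 hs
  refine ⟨ρ, hρ, fun x hx y hy => ?_⟩
  have h := ha x (hball hx) y (hball hy)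
  simp only [ContinuousLinearMap.id_apply] at h
  rw [dist_eq_norm, dist_eq_norm]
  change ‖f x - f y - (x - y)‖ ≤ (1 - (L : ℝ)⁻¹) * ‖x - y‖ at h
  have h1 : ‖f x - f y‖ ≤ ‖f x - f y - (x - y)‖ + ‖x - y‖ := by
    simpa using norm_add_le (f x - f y - (x - y)) (x - y)
  have h2 : ‖x - y‖ ≤ ‖f x - f y - (x - y)‖ + ‖f x - f y‖ := by
    rw [norm_sub_rev (f x - f y)]
    simpa using norm_add_le (x - y - (f x - f y)) (f x - f y)
  have h3 : (L : ℝ) * (L : ℝ)⁻¹ = 1 := mul_inv_cancel₀ (by positivity)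
  have h4 : 0 < (L : ℝ)⁻¹ := by positivity
  constructor
  · have : 2 - (L : ℝ)⁻¹ ≤ L := by nlinarith [sq_nonneg ((L : ℝ) - 1)]
    calc ‖f x - f y‖ ≤ (2 - (L : ℝ)⁻¹) * ‖x - y‖ := by linarith
      _ ≤ _ := by gcongr
  · have h5 : (L : ℝ)⁻¹ * ‖x - y‖ ≤ ‖f x - f y‖ := by linarith
    calc ‖x - y‖ = L * ((L : ℝ)⁻¹ * ‖x - y‖) := by rw [← mul_assoc, h3, one_mul]
      _ ≤ _ := by gcongr

/-- The volume of a right cylinder with base `B` in the hyperplane orthogonal to `ν`. No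
measurability of `B` is needed, as the product formula for boxes holds for all sets. -/
theorem volume_cylinder {n : ℕ} {ν : Space n} (hν : ‖ν‖ = 1) {B : Set (Space n)}
    (hB : ∀ b ∈ B, inner ℝ ν b = 0) (I : Set ℝ) :
    volume {x : Space n | ∃ b ∈ B, ∃ t ∈ I, x = b + t • ν} = μHE[n - 1] B * volume I := by
  have hν0 : ν ≠ 0 := fun h => by simp [h] at hν
  set s := Submodule.span ℝ {ν} with hs
  have hmp := s.measurePreserving_measurableEquivProd (0 : Space n)
  rw [finrank_euclideanSpace_fin, EuclideanSpace.euclideanHausdorffMeasure_eq_volume] at hmp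
  set e := s.measurableEquivProd (0 : Space n) with he
  have hfr : Module.finrank ℝ sᗮ = n - 1 := by
    have h1 := s.finrank_add_finrank_orthogonal
    rw [finrank_span_singleton hν0, finrank_euclideanSpace_fin] at h1
    omega
  have hset : {x : Space n | ∃ b ∈ B, ∃ t ∈ I, x = b + t • ν} =
      e ⁻¹' ((LinearIsometryEquiv.toSpanUnitSingleton ν hν '' I) ×ˢ
        {w : sᗮ | (w : Space n) ∈ B}) := by
    rw [← e.image_symm, Set.ext_iff]
    intro x
    constructor
    · rintro ⟨b, hb, t, ht, rfl⟩
      have hbs : b ∈ sᗮ := by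
        rw [hs, Submodule.mem_orthogonal_singleton_iff_inner_right]
        exact hB b hb
      refine ⟨(LinearIsometryEquiv.toSpanUnitSingleton ν hν t, ⟨b, hbs⟩),
        ⟨⟨t, ht, rfl⟩, hb⟩, ?_⟩
      simp [he, LinearIsometryEquiv.toSpanUnitSingleton_apply, add_comm]
    · rintro ⟨⟨_, w⟩, ⟨⟨t, ht, rfl⟩, hw⟩, rfl⟩
      refine ⟨w, hw, t, ht, ?_⟩
      simp [he, LinearIsometryEquiv.toSpanUnitSingleton_apply, add_comm]
  rw [hset, hmp.measure_preimage_equiv, Measure.volume_eq_prod, Measure.prod_prod, mul_comm]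
  congr 1
  · rw [← InnerProductSpace.euclideanHausdorffMeasure_eq_volume, hfr,
      ← isometry_subtype_coe.euclideanHausdorffMeasure_image]
    congr 1
    ext b
    constructor
    · rintro ⟨w, hw, rfl⟩
      exact hw
    · intro hb
      refine ⟨⟨b, ?_⟩, hb, rfl⟩
      rw [hs, Submodule.mem_orthogonal_singleton_iff_inner_right]
      exact hB b hb
  · have := (LinearIsometryEquiv.toSpanUnitSingleton ν hν).symm.measurePreserving
    rw [LinearIsometryEquiv.image_eq_preimage_symm]
    exact this.measure_preimage_equiv
      (f := (LinearIsometryEquiv.toSpanUnitSingleton ν hν).symm.toHomeomorph.toMeasurableEquiv) I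

/-! ### Area as the limit of shell volumes -/

/-- The chart around a point `z` of the zero set of `d`: in the directions orthogonal to
`ν = ∇d(z)` it is the nearest point projection `x - d(x) ∇d(x)`, and in the direction `ν` it is
`d`. -/
noncomputable def tubeChart {n : ℕ} (d : Space n → ℝ) (z x : Space n) : Space n :=
  (x - d x • ∇ d x - z) - inner ℝ (∇ d z) (x - d x • ∇ d x - z) • ∇ d z + d x • ∇ d z

/-- The part of the shell `{-w ≤ d < w}` that projects onto `A`. -/
def shellOver {n : ℕ} (d : Space n → ℝ) (A : Set (Space n)) (w : ℝ) :
    Set (Space n) :=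
  {x | d x ∈ Ico (-w) w ∧ x - d x • ∇ d x ∈ A}

theorem measurable_gradient {n : ℕ} (d : Space n → ℝ) : Measurable (∇ d) :=
  (InnerProductSpace.toDual ℝ (Space n)).symm.continuous.measurable.comp (measurable_fderiv ℝ d)

namespace IsTubularDist

variable {n : ℕ} {Sig : Set (Space n)} {d : Space n → ℝ} {R K : ℝ} {z : Space n}

theorem abs_lt_of_mem (h : IsTubularDist Sig d R K) (hz : z ∈ Sig) : |d z| < R := by
  rw [h.mem_iff.1 hz, abs_zero]; exact h.pos

theorem contDiffAt_tubeChart (h : IsTubularDist Sig d R K) {x : Space n} (hx : |d x| < R) :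
    ContDiffAt ℝ 1 (tubeChart d z) x := by
  have h1 : ContDiffAt ℝ 1 d x := (h.contDiffAt x hx).of_le (by norm_num)
  have h2 : ContDiffAt ℝ 1 (∇ d) x := contDiffAt_gradient (h.contDiffAt x hx)
  have h3 : ContDiffAt ℝ 1 (fun x => x - d x • ∇ d x - z) x :=
    (contDiffAt_id.sub (h1.smul h2)).sub contDiffAt_const
  exact (h3.sub ((contDiffAt_const.inner ℝ h3).smul contDiffAt_const)).add
    (h1.smul contDiffAt_const)

theorem inner_tubeChart (h : IsTubularDist Sig d R K) (hz : z ∈ Sig) (x : Space n) :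
    inner ℝ (∇ d z) (tubeChart d z x) = d x := by
  unfold tubeChart
  rw [inner_add_right, inner_sub_right, inner_smul_right, inner_smul_right,
    real_inner_self_eq_norm_sq, h.norm_gradient z (h.abs_lt_of_mem hz)]
  ring

theorem tubeChart_self (h : IsTubularDist Sig d R K) (hz : z ∈ Sig) : tubeChart d z z = 0 := by
  simp [tubeChart, h.mem_iff.1 hz]

/-- The term `d x • ∇d x` contributes `⟪ν, v⟫ ν` to the derivative, which the last term of the chart
restores. -/
theorem hasStrictFDerivAt_tubeChart (h : IsTubularDist Sig d R K) (hz : z ∈ Sig) :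
    HasStrictFDerivAt (tubeChart d z) (ContinuousLinearMap.id ℝ (Space n)) z := by
  have hz0 := h.abs_lt_of_mem hz
  have h0 := (h.contDiffAt_tubeChart (z := z) hz0).hasStrictFDerivAt (by norm_num)
  suffices fderiv ℝ (tubeChart d z) z = ContinuousLinearMap.id ℝ (Space n) by rwa [this] at h0
  have h1 := h.hasFDerivAt hz0
  have h2 := h.hasFDerivAt_gradient hz0
  have h3 : HasFDerivAt (fun x => x - d x • ∇ d x - z) _ z :=
    ((hasFDerivAt_id z).sub (h1.smul h2)).sub_const z
  have h4 : HasFDerivAt (tubeChart d z) _ z :=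
    (h3.sub (((hasFDerivAt_const (∇ d z) z).inner ℝ h3).smul_const (∇ d z))).add
      (h1.smul_const (∇ d z))
  rw [h4.fderiv]
  ext1 v
  simp [h.mem_iff.1 hz, inner_sub_right, inner_smul_right,
    h.norm_gradient z hz0]

theorem measurableSet_shellOver (h : IsTubularDist Sig d R K) {A : Set (Space n)}
    (hA : MeasurableSet A) (w : ℝ) : MeasurableSet (shellOver d A w) :=
  (h.measurable measurableSet_Ico).inter
    ((measurable_id.sub (h.measurable.smul (measurable_gradient d))) hA)

theorem tubeChart_add_smul (h : IsTubularDist Sig d R K) {a : Space n} (ha : a ∈ Sig) {t : ℝ}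
    (ht : |t| < R) : tubeChart d z (a + t • ∇ d a) = tubeChart d z a + t • ∇ d z := by
  have ha0 := h.mem_iff.1 ha
  have hx : |d a| + |t| < R := by rw [ha0, abs_zero, zero_add]; exact ht
  unfold tubeChart
  rw [h.gradient_add_smul hx, h.dist_add_smul hx, ha0]
  simp

/-- The chart straightens the part of the shell over `A` to a right cylinder. -/
theorem image_tubeChart_shellOver (h : IsTubularDist Sig d R K) {A : Set (Space n)} (hA : A ⊆ Sig)
    {w : ℝ} (hw : w < R / 2) :
    tubeChart d z '' shellOver d A w =
      {x | ∃ b ∈ tubeChart d z '' A, ∃ t ∈ Ico (-w) w, x = b + t • ∇ d z} := by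
  have hR := h.pos
  have hlt : ∀ t ∈ Ico (-w) w, |t| < R / 2 := by
    intro t ht
    rw [abs_lt]; constructor <;> linarith [ht.1, ht.2]
  ext y
  constructor
  · rintro ⟨x, ⟨hx1, hx2⟩, rfl⟩
    refine ⟨_, ⟨_, hx2, rfl⟩, d x, hx1, ?_⟩
    have hx : |d x| + |(-d x)| < R := by rw [abs_neg]; linarith [hlt _ hx1]
    have e := h.gradient_add_smul hx
    have e2 := h.add_smul_neg hx
    rw [neg_smul, ← sub_eq_add_neg] at e
    rw [neg_neg, neg_smul, ← sub_eq_add_neg] at e2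
    rw [← h.tubeChart_add_smul (hA hx2) (by linarith [hlt _ hx1]), e2]
  · rintro ⟨_, ⟨a, ha, rfl⟩, t, ht, rfl⟩
    have ha0 := h.mem_iff.1 (hA ha)
    have htR : |t| < R := by linarith [hlt t ht]
    have hx : |d a| + |t| < R := by rw [ha0, abs_zero, zero_add]; exact htR
    refine ⟨a + t • ∇ d a, ⟨?_, ?_⟩, h.tubeChart_add_smul (hA ha) htR⟩
    · rw [h.dist_add_smul hx, ha0, zero_add]; exact ht
    · rw [h.gradient_add_smul hx, h.dist_add_smul hx, ha0]
      simpa using ha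

theorem volume_image_shellOver (h : IsTubularDist Sig d R K) (hz : z ∈ Sig) {A : Set (Space n)}
    (hA : A ⊆ Sig) {w : ℝ} (hw : w < R / 2) :
    volume (tubeChart d z '' shellOver d A w) =
      μHE[n - 1] (tubeChart d z '' A) * ENNReal.ofReal (2 * w) := by
  rw [h.image_tubeChart_shellOver hA hw,
    volume_cylinder (h.norm_gradient z (h.abs_lt_of_mem hz)), Real.volume_Ico]
  · congr 2; ring
  · rintro _ ⟨a, ha, rfl⟩
    rw [h.inner_tubeChart hz, h.mem_iff.1 (hA ha)]

/-- Near each point of `Sig` the volume of a thin shell is comparable with the area of its base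
times its height, with a constant as close to `1` as desired. -/
theorem exists_volume_shellOver_near (h : IsTubularDist Sig d R K) (hz : z ∈ Sig) {L : ℝ≥0}
    (hL : 1 < L) : ∃ ρ > 0, ∀ A ⊆ Sig ∩ Metric.ball z ρ, ∀ w : ℝ, 0 < w → w < ρ →
      volume (shellOver d A w) ≤ (L : ℝ≥0∞) ^ (2 * n) * (μHE[n - 1] A * ENNReal.ofReal (2 * w)) ∧
      μHE[n - 1] A * ENNReal.ofReal (2 * w) ≤ (L : ℝ≥0∞) ^ (2 * n) * volume (shellOver d A w) := by
  obtain ⟨ρ, hρ, hbl⟩ := exists_biLipschitzOn (h.hasStrictFDerivAt_tubeChart hz) hL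
  have hR := h.pos
  refine ⟨min (ρ / 2) (R / 2), by positivity, fun A hA w hw hw0 => ?_⟩
  have hwR : w < R / 2 := hw0.trans_le (min_le_right _ _)
  have hwρ : w < ρ / 2 := hw0.trans_le (min_le_left _ _)
  have hAS : A ⊆ Sig := fun x hx => (hA hx).1
  have hAb : ∀ a ∈ A, dist a z < ρ / 2 := fun x hx => (hA hx).2.trans_le (min_le_left _ _)
  have b1 : BiLipschitzOn L (tubeChart d z) A := hbl.mono fun x hx => by
    have := hAb x hx
    rw [Metric.mem_ball]; linarith
  have b2 : BiLipschitzOn L (tubeChart d z) (shellOver d A w) := by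
    refine hbl.mono fun x hx => ?_
    have h1 := hAb _ hx.2
    have h2 : |d x| ≤ w := abs_le.2 ⟨hx.1.1, hx.1.2.le⟩
    have h3 : dist x (x - d x • ∇ d x) = |d x| := by
      rw [dist_eq_norm, sub_sub_cancel, norm_smul, h.norm_gradient x (by linarith), mul_one,
        Real.norm_eq_abs]
    have := dist_triangle x (x - d x • ∇ d x) z
    rw [Metric.mem_ball]; linarith
  have hL1 : (1 : ℝ≥0∞) ≤ L := by exact_mod_cast hL.le
  have hpow : (L : ℝ≥0∞) ^ (n - 1) ≤ (L : ℝ≥0∞) ^ n := pow_le_pow_right₀ hL1 (by omega)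
  have hv := h.volume_image_shellOver hz hAS hwR
  constructor
  · calc volume (shellOver d A w)
        ≤ (L : ℝ≥0∞) ^ n * volume (tubeChart d z '' shellOver d A w) := b2.volume_le_image
      _ ≤ (L : ℝ≥0∞) ^ n * (((L : ℝ≥0∞) ^ n * μHE[n - 1] A) * ENNReal.ofReal (2 * w)) := by
          rw [hv]
          gcongr
          exact (b1.measure_image_le _).trans (by gcongr)
      _ = _ := by rw [two_mul n, pow_add]; ring
  · calc μHE[n - 1] A * ENNReal.ofReal (2 * w)
        ≤ ((L : ℝ≥0∞) ^ n * μHE[n - 1] (tubeChart d z '' A)) * ENNReal.ofReal (2 * w) := by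
          gcongr
          exact (b1.measure_le_image _).trans (by gcongr)
      _ = (L : ℝ≥0∞) ^ n * volume (tubeChart d z '' shellOver d A w) := by rw [hv]; ring
      _ ≤ (L : ℝ≥0∞) ^ n * ((L : ℝ≥0∞) ^ n * volume (shellOver d A w)) := by
          gcongr
          exact b2.volume_image_le
      _ = _ := by rw [two_mul n, pow_add]; ring

/-- The local comparison extends to all of `Sig`, with the same constant, since the sets that
project onto disjoint pieces of `Sig` are disjoint. -/
theorem exists_volume_shell (h : IsTubularDist Sig d R K) {L : ℝ≥0}
    (hL : 1 < L) : ∃ ρ > 0, ∀ w : ℝ, 0 < w → w < ρ →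
      volume (d ⁻¹' Ico (-w) w) ≤
        (L : ℝ≥0∞) ^ (2 * n) * (μHE[n - 1] Sig * ENNReal.ofReal (2 * w)) ∧
      μHE[n - 1] Sig * ENNReal.ofReal (2 * w) ≤
        (L : ℝ≥0∞) ^ (2 * n) * volume (d ⁻¹' Ico (-w) w) := by
  have key : ∃ s, Sig ⊆ s ∧ MeasurableSet s ∧ ∃ ρ > 0, ∀ A ⊆ Sig ∩ s, MeasurableSet A →
      ∀ w : ℝ, 0 < w → w < ρ →
      volume (shellOver d A w) ≤ (L : ℝ≥0∞) ^ (2 * n) * (μHE[n - 1] A * ENNReal.ofReal (2 * w)) ∧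
      μHE[n - 1] A * ENNReal.ofReal (2 * w) ≤
        (L : ℝ≥0∞) ^ (2 * n) * volume (shellOver d A w) := by
    refine h.isCompact.induction_on (p := fun B => ∃ s, B ⊆ s ∧ MeasurableSet s ∧ ∃ ρ > 0,
      ∀ A ⊆ Sig ∩ s, MeasurableSet A → ∀ w : ℝ, 0 < w → w < ρ →
      volume (shellOver d A w) ≤ (L : ℝ≥0∞) ^ (2 * n) * (μHE[n - 1] A * ENNReal.ofReal (2 * w)) ∧
      μHE[n - 1] A * ENNReal.ofReal (2 * w) ≤
        (L : ℝ≥0∞) ^ (2 * n) * volume (shellOver d A w)) ?_ ?_ ?_ ?_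
    · refine ⟨∅, Subset.rfl, MeasurableSet.empty, 1, one_pos, fun A hA _ w _ _ => ?_⟩
      have : A = ∅ := subset_empty_iff.1 (hA.trans inter_subset_right)
      subst this
      simp [shellOver]
    · rintro s t hst ⟨s', h1, h2⟩
      exact ⟨s', hst.trans h1, h2⟩
    · rintro s t ⟨s', h1, h2, ρ, hρ, h3⟩ ⟨t', k1, k2, σ, hσ, k3⟩
      refine ⟨s' ∪ t', union_subset_union h1 k1, h2.union k2, min ρ σ, lt_min hρ hσ,
        fun A hA hAm w hw hw0 => ?_⟩
      have a := h3 (A ∩ s') (fun x hx => ⟨(hA hx.1).1, hx.2⟩) (hAm.inter h2) w hw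
        (hw0.trans_le (min_le_left _ _))
      have b := k3 (A \ s') (fun x hx => ⟨(hA hx.1).1, (hA hx.1).2.resolve_left hx.2⟩)
        (hAm.diff h2) w hw (hw0.trans_le (min_le_right _ _))
      have e1 := measure_inter_add_sdiff (μ := μHE[n - 1]) A h2
      have e2 : volume (shellOver d (A ∩ s') w) + volume (shellOver d (A \ s') w) =
          volume (shellOver d A w) := by
        rw [← measure_union _ (h.measurableSet_shellOver (hAm.diff h2) w)]
        · congr 1
          ext x
          simp only [shellOver, mem_union, mem_ofPred_eq, mem_inter_iff, Set.mem_sdiff]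
          tauto
        · exact disjoint_left.2 fun x hx hy => hy.2.2 hx.2.2
      rw [← e1, ← e2, add_mul, mul_add, mul_add]
      exact ⟨add_le_add a.1 b.1, add_le_add a.2 b.2⟩
    · intro z hz
      obtain ⟨ρ, hρ, hz'⟩ := h.exists_volume_shellOver_near hz hL
      exact ⟨Metric.ball z ρ, mem_nhdsWithin_of_mem_nhds (Metric.ball_mem_nhds z hρ),
        Metric.ball z ρ, Subset.rfl, measurableSet_ball, ρ, hρ, fun A hA _ => hz' A hA⟩
  obtain ⟨s, hs, -, ρ, hρ, hv⟩ := key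
  have hR := h.pos
  refine ⟨min ρ (R / 2), by positivity, fun w hw hw0 => ?_⟩
  have e : shellOver d Sig w = d ⁻¹' Ico (-w) w := by
    refine Subset.antisymm (fun x hx => hx.1) fun x hx => ⟨hx, h.sub_smul_gradient_mem ?_⟩
    have := hw0.trans_le (min_le_right _ _)
    rw [abs_lt]; constructor <;> linarith [hx.1, hx.2]
  have := hv Sig (fun x hx => ⟨hx, hs hx⟩) h.isCompact.isClosed.measurableSet w hw
    (hw0.trans_le (min_le_left _ _))
  rwa [e] at this

/-- The Minkowski content of `Sig` is its Hausdorff measure. -/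
theorem tendsto_volume_shell (h : IsTubularDist Sig d R K) {S : ℝ} (hS : 0 < S)
    (hSig : μHE[n - 1] Sig = ENNReal.ofReal S) :
    Tendsto (fun w => volume.real (d ⁻¹' Ico (-w) w) / (2 * w)) (𝓝[>] 0) (𝓝 S) := by
  have key : ∀ L : ℝ≥0, 1 < L → ∀ᶠ w in 𝓝[>] (0 : ℝ),
      volume.real (d ⁻¹' Ico (-w) w) / (2 * w) ≤ L ^ (2 * n) * S ∧
      S ≤ L ^ (2 * n) * (volume.real (d ⁻¹' Ico (-w) w) / (2 * w)) := by
    intro L hL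
    obtain ⟨ρ, hρ, hv⟩ := h.exists_volume_shell hL
    filter_upwards [Ioo_mem_nhdsGT hρ] with w hw
    obtain ⟨h1, h2⟩ := hv w hw.1 hw.2
    have hw0 := hw.1
    have hfin := (h.volume_shell_lt_top (-w) w).ne
    rw [hSig, ← ENNReal.ofReal_mul hS.le] at h1 h2
    have t1 := ENNReal.toReal_mono (by finiteness) h1
    have t2 := ENNReal.toReal_mono (by finiteness) h2
    rw [ENNReal.toReal_mul, ENNReal.toReal_pow, ENNReal.coe_toReal,
      ENNReal.toReal_ofReal (by positivity)] at t1 t2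
    rw [div_le_iff₀ (by positivity), ← mul_div_assoc, le_div_iff₀ (by positivity)]
    exact ⟨by rw [mul_assoc]; exact t1, t2⟩
  have hc : Tendsto (fun L : ℝ≥0 => (L : ℝ) ^ (2 * n) * S) (𝓝[>] 1) (𝓝 S) := by
    have : Continuous fun L : ℝ≥0 => (L : ℝ) ^ (2 * n) * S := by fun_prop
    have := this.tendsto 1
    simp only [NNReal.coe_one, one_pow, one_mul] at this
    exact this.mono_left nhdsWithin_le_nhds
  have hc' : Tendsto (fun L : ℝ≥0 => S / (L : ℝ) ^ (2 * n)) (𝓝[>] 1) (𝓝 S) := by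
    have : ContinuousAt (fun L : ℝ≥0 => S / (L : ℝ) ^ (2 * n)) 1 :=
      continuousAt_const.div (by fun_prop) (by simp)
    have := this.tendsto
    simp only [NNReal.coe_one, one_pow, div_one] at this
    exact this.mono_left nhdsWithin_le_nhds
  rw [tendsto_order]
  constructor
  · intro a ha
    obtain ⟨L, hL1, hL⟩ := ((hc'.eventually_const_lt ha).and self_mem_nhdsWithin).exists
    have hL0 : (0 : ℝ) < L := by exact_mod_cast zero_lt_one.trans hL
    filter_upwards [key L hL] with w hw
    rw [lt_div_iff₀ (by positivity)] at hL1
    have := hw.2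
    by_contra! hcon
    nlinarith [pow_pos hL0 (2 * n)]
  · intro a ha
    obtain ⟨L, hL1, hL⟩ := ((hc.eventually_lt_const ha).and self_mem_nhdsWithin).exists
    filter_upwards [key L hL] with w hw
    exact hw.1.trans_lt hL1

end IsTubularDist

/-! ### Poincaré inequality in local parametrizations -/

/-- A dilation by a factor of at least `1 / 2` costs at most `2 ^ n`. -/
theorem lintegral_add_smul_le {n : ℕ} {F : Space n → ℝ≥0∞} (hF : Measurable F) {s : ℝ}
    (hs : 1 / 2 ≤ s) (v : Space n) : ∫⁻ y, F (v + s • y) ≤ 2 ^ n * ∫⁻ y, F y := by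
  have hs0 : 0 < s := by linarith
  have h1 : ∫⁻ y, F (v + s • y) = ∫⁻ y, F (v + y) ∂(Measure.map (s • ·) volume) := by
    rw [lintegral_map (by fun_prop) (by fun_prop)]
  rw [h1, Measure.map_addHaar_smul volume hs0.ne', lintegral_smul_measure,
    lintegral_add_left_eq_self, finrank_euclideanSpace_fin, smul_eq_mul]
  gcongr
  rw [← ENNReal.ofReal_ofNat 2, ← ENNReal.ofReal_pow (by norm_num)]
  apply ENNReal.ofReal_le_ofReal
  rw [abs_of_nonneg (by positivity), ← inv_pow]
  gcongr
  rw [inv_le_comm₀ hs0 (by norm_num)]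
  linarith

theorem lintegral_rotate {α β γ : Type*} [MeasurableSpace α] [MeasurableSpace β]
    [MeasurableSpace γ] (μ : Measure α) (ν : Measure β) (κ : Measure γ) [SFinite μ] [SFinite ν]
    [SFinite κ] {H : α → β → γ → ℝ≥0∞} (hH : Measurable fun p : α × β × γ => H p.1 p.2.1 p.2.2) :
    ∫⁻ x, ∫⁻ y, ∫⁻ s, H x y s ∂κ ∂ν ∂μ = ∫⁻ s, ∫⁻ x, ∫⁻ y, H x y s ∂ν ∂μ ∂κ := by
  have h1 : ∀ x, ∫⁻ y, ∫⁻ s, H x y s ∂κ ∂ν = ∫⁻ s, ∫⁻ y, H x y s ∂ν ∂κ := fun x =>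
    lintegral_lintegral_swap (f := fun y s => H x y s)
      (hH.comp (measurable_const.prodMk measurable_id)).aemeasurable
  have h2 : Measurable fun p : α × γ => ∫⁻ y, H p.1 y p.2 ∂ν :=
    Measurable.lintegral_prod_right' (f := fun p : (α × γ) × β => H p.1.1 p.2 p.1.2)
      (hH.comp (measurable_fst.fst.prodMk (measurable_snd.prodMk measurable_fst.snd)))
  simp_rw [h1]
  exact lintegral_lintegral_swap (f := fun x s => ∫⁻ y, H x y s ∂ν) h2.aemeasurable

/-- For pairs of points of a convex set, averaging over the segments is controlled by the average
over the set: on each half of the segments one end point can be frozen, and the other one moves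
the intermediate point with a factor at least `1 / 2`. -/
theorem lintegral_segment_le {n : ℕ} {T : Set (Space n)} (hT : Convex ℝ T) (hTm : MeasurableSet T)
    {G : Space n → ℝ≥0∞} (hG : Measurable G) :
    ∫⁻ x in T, ∫⁻ y in T, ∫⁻ s in Icc (0 : ℝ) 1, G (x + s • (y - x)) ≤
      2 ^ n * volume T * ∫⁻ x in T, G x := by
  set F := T.indicator G with hF
  have hFm : Measurable F := hG.indicator hTm
  have hFint : ∫⁻ x, F x = ∫⁻ x in T, G x := lintegral_indicator hTm G
  have hseg : ∀ x ∈ T, ∀ y ∈ T, ∀ s ∈ Icc (0 : ℝ) 1,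
      G (x + s • (y - x)) = F ((1 - s) • x + s • y) := by
    intro x hx y hy s hs
    have e : x + s • (y - x) = (1 - s) • x + s • y := by module
    have : (1 - s) • x + s • y ∈ T := hT hx hy (by linarith [hs.2]) hs.1 (by ring)
    rw [e, hF, indicator_of_mem this]
  have e1 : ∫⁻ x in T, ∫⁻ y in T, ∫⁻ s in Icc (0 : ℝ) 1, G (x + s • (y - x)) =
      ∫⁻ x in T, ∫⁻ y in T, ∫⁻ s in Icc (0 : ℝ) 1, F ((1 - s) • x + s • y) := by
    refine setLIntegral_congr_fun hTm fun x hx => ?_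
    refine setLIntegral_congr_fun hTm fun y hy => ?_
    exact setLIntegral_congr_fun measurableSet_Icc fun s hs => hseg x hx y hy s hs
  have hm3 : Measurable fun p : Space n × Space n × ℝ => F ((1 - p.2.2) • p.1 + p.2.2 • p.2.1) := by
    refine hFm.comp ?_
    fun_prop
  have e2 : ∫⁻ x in T, ∫⁻ y in T, ∫⁻ s in Icc (0 : ℝ) 1, F ((1 - s) • x + s • y) =
      ∫⁻ s in Icc (0 : ℝ) 1, ∫⁻ x in T, ∫⁻ y in T, F ((1 - s) • x + s • y) :=
    lintegral_rotate _ _ _ hm3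
  have hJ : ∀ s ∈ Icc (0 : ℝ) 1, ∫⁻ x in T, ∫⁻ y in T, F ((1 - s) • x + s • y) ≤
      2 ^ n * volume T * ∫⁻ x in T, G x := by
    intro s hs
    have hb : ∀ (v : Space n) (t : ℝ), 1 / 2 ≤ t →
        ∫⁻ y in T, F (v + t • y) ≤ 2 ^ n * ∫⁻ x in T, G x := by
      intro v t ht
      refine (setLIntegral_le_lintegral _ _).trans ?_
      rw [← hFint]
      exact lintegral_add_smul_le hFm ht v
    have hconst : ∫⁻ _ in T, (2 ^ n * ∫⁻ x in T, G x) = 2 ^ n * volume T * ∫⁻ x in T, G x := by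
      rw [setLIntegral_const]; ring
    rw [← hconst]
    -- for `s ≥ 1 / 2` freeze `x`, for `s ≤ 1 / 2` freeze `y`
    rcases le_total (1 / 2) s with h | h
    · exact lintegral_mono fun x => hb _ s h
    · rw [lintegral_lintegral_swap]
      · refine lintegral_mono fun y => ?_
        simp_rw [add_comm _ (s • y)]
        exact hb _ (1 - s) (by linarith)
      · refine Measurable.aemeasurable (hFm.comp ?_)
        fun_prop
  rw [e1, e2]
  calc _ ≤ ∫⁻ s in Icc (0 : ℝ) 1, (2 ^ n * volume T * ∫⁻ x in T, G x) :=
        setLIntegral_mono measurable_const hJ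
    _ = _ := by rw [setLIntegral_const]; simp

/-- A local parametrization of a neighbourhood of a point of `Sig` by a ball, in which `d` becomes
the linear coordinate in the direction `ν`. The constants `2` and `1 / 2` are convenient values near
`1`, the derivative at the centre being the identity. -/
structure IsLocalParam {n : ℕ} (d : Space n → ℝ) (ν : Space n) (ρ : ℝ) (Ψ : Space n → Space n) :
    Prop where
  pos : 0 < ρ
  norm_dir : ‖ν‖ = 1
  contDiffAt : ∀ y ∈ Metric.ball 0 ρ, ContDiffAt ℝ 1 Ψ y
  norm_fderiv_le : ∀ y ∈ Metric.ball 0 ρ, ‖fderiv ℝ Ψ y‖ ≤ 2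
  det_mem : ∀ y ∈ Metric.ball 0 ρ, |(fderiv ℝ Ψ y).det| ∈ Icc (1 / 2 : ℝ) 2
  dist_eq : ∀ y ∈ Metric.ball 0 ρ, d (Ψ y) = inner ℝ ν y
  injOn : InjOn Ψ (Metric.ball 0 ρ)
  isOpen_image : IsOpen (Ψ '' Metric.ball 0 ρ)

/-- The parametrization is the inverse of `tubeChart`. -/
theorem IsTubularDist.exists_isLocalParam {n : ℕ} {Sig : Set (Space n)} {d : Space n → ℝ}
    {R K : ℝ} (h : IsTubularDist Sig d R K) {z : Space n} (hz : z ∈ Sig) {B : Set (Space n)}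
    (hB : IsOpen B) (hzB : z ∈ B) :
    ∃ ν ρ Ψ, IsLocalParam d ν ρ Ψ ∧ z ∈ Ψ '' Metric.ball 0 ρ ∧ Ψ '' Metric.ball 0 ρ ⊆ B := by
  have hz0 := h.abs_lt_of_mem hz
  have hc : ContDiffAt ℝ 1 (tubeChart d z) z := h.contDiffAt_tubeChart hz0
  have hd : HasFDerivAt (tubeChart d z)
      ((ContinuousLinearEquiv.refl ℝ (Space n) : Space n ≃L[ℝ] Space n) :
        Space n →L[ℝ] Space n) z := (h.hasStrictFDerivAt_tubeChart hz).hasFDerivAt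
  set e := hc.toOpenPartialHomeomorph (tubeChart d z) hd one_ne_zero with he
  have hzs : z ∈ e.source := hc.mem_toOpenPartialHomeomorph_source hd one_ne_zero
  have hez : e z = 0 := h.tubeChart_self hz
  have h0t : (0 : Space n) ∈ e.target := hez ▸ e.map_source hzs
  have he0 : e.symm 0 = z := by rw [← hez, e.left_inv hzs]
  have hΨc : ContDiffAt ℝ 1 e.symm 0 := by
    refine e.contDiffAt_symm h0t (f₀' := ContinuousLinearEquiv.refl ℝ (Space n)) ?_ ?_
    · rw [he0]; exact hd
    · rw [he0]; exact hc
  have hΨd : fderiv ℝ e.symm 0 = ContinuousLinearMap.id ℝ (Space n) := by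
    have := e.hasFDerivAt_symm (f' := ContinuousLinearEquiv.refl ℝ (Space n)) h0t
      (by rw [he0]; exact hd)
    exact this.fderiv
  have hfc : ContinuousAt (fderiv ℝ e.symm) 0 :=
    (hΨc.fderiv_right (m := 0) (by norm_num)).continuousAt
  have ev1 : ∀ᶠ y in 𝓝 (0 : Space n), ContDiffAt ℝ 1 e.symm y := hΨc.eventually (by simp)
  have ev2 : ∀ᶠ y in 𝓝 (0 : Space n), ‖fderiv ℝ e.symm y‖ < 2 := by
    refine hfc.norm.eventually_lt_const ?_
    simp only [hΨd]
    exact ContinuousLinearMap.norm_id_le.trans_lt one_lt_two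
  have ev3 : ∀ᶠ y in 𝓝 (0 : Space n), |(fderiv ℝ e.symm y).det| ∈ Ioo (1 / 2 : ℝ) 2 := by
    have hcont : ContinuousAt (fun y => |(fderiv ℝ e.symm y).det|) 0 :=
      (ContinuousLinearMap.continuous_det.continuousAt.comp hfc).abs
    refine hcont.eventually_mem (Ioo_mem_nhds ?_ ?_) <;>
    · rw [hΨd]
      have : (ContinuousLinearMap.id ℝ (Space n)).det = 1 := LinearMap.det_id
      rw [this]; norm_num
  have ev4 : ∀ᶠ y in 𝓝 (0 : Space n), y ∈ e.target := e.open_target.mem_nhds h0t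
  have ev5 : ∀ᶠ y in 𝓝 (0 : Space n), e.symm y ∈ B :=
    hΨc.continuousAt.eventually_mem (hB.mem_nhds (by rwa [he0]))
  obtain ⟨ρ, hρ, hall⟩ := Metric.eventually_nhds_iff_ball.1
    (ev1.and (ev2.and (ev3.and (ev4.and ev5))))
  have hbt : Metric.ball 0 ρ ⊆ e.target := fun y hy => (hall y hy).2.2.2.1
  refine ⟨∇ d z, ρ, e.symm, ⟨hρ, h.norm_gradient z hz0, fun y hy => (hall y hy).1,
    fun y hy => (hall y hy).2.1.le, fun y hy => Ioo_subset_Icc_self (hall y hy).2.2.1,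
    fun y hy => ?_, ?_, ?_⟩, ⟨0, Metric.mem_ball_self hρ, he0⟩, ?_⟩
  · rw [← h.inner_tubeChart hz]
    congr 1
    exact e.right_inv (hbt hy)
  · exact e.symm.injOn.mono hbt
  · exact e.symm.isOpen_image_of_subset_source Metric.isOpen_ball hbt
  · rintro _ ⟨y, hy, rfl⟩
    exact (hall y hy).2.2.2.2

namespace IsLocalParam

variable {n : ℕ} {d : Space n → ℝ} {ν : Space n} {ρ : ℝ} {Ψ : Space n → Space n}

/-- The part of the parameter ball that corresponds to the tube of radius `r`. -/
def slab {n : ℕ} (ν : Space n) (ρ r : ℝ) : Set (Space n) :=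
  Metric.ball 0 ρ ∩ {y | |inner ℝ ν y| < r}

theorem isOpen_slab (ν : Space n) (ρ r : ℝ) : IsOpen (slab ν ρ r) :=
  Metric.isOpen_ball.inter (isOpen_lt (by fun_prop) continuous_const)

theorem convex_slab (ν : Space n) (ρ r : ℝ) : Convex ℝ (slab ν ρ r) := by
  refine (convex_ball _ _).inter ?_
  have : {y : Space n | |inner ℝ ν y| < r} = innerSL ℝ ν ⁻¹' Ioo (-r) r := by
    ext y; simp [abs_lt]
  rw [this]
  exact (convex_Ioo _ _).linear_preimage (innerSL ℝ ν).toLinearMap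

theorem image_slab (h : IsLocalParam d ν ρ Ψ) (r : ℝ) :
    Ψ '' slab ν ρ r = Ψ '' Metric.ball 0 ρ ∩ {x | |d x| < r} := by
  ext x
  constructor
  · rintro ⟨y, ⟨hy1, hy2⟩, rfl⟩
    exact ⟨⟨y, hy1, rfl⟩, by simpa [h.dist_eq y hy1] using hy2⟩
  · rintro ⟨⟨y, hy1, rfl⟩, hy2⟩
    exact ⟨y, ⟨hy1, by simpa [h.dist_eq y hy1] using hy2⟩, rfl⟩

theorem lintegral_image (h : IsLocalParam d ν ρ Ψ) (r : ℝ) (F : Space n → ℝ≥0∞) :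
    ∫⁻ x in Ψ '' slab ν ρ r, F x =
      ∫⁻ y in slab ν ρ r, ENNReal.ofReal |(fderiv ℝ Ψ y).det| * F (Ψ y) :=
  lintegral_image_eq_lintegral_abs_det_fderiv_mul volume (isOpen_slab ν ρ r).measurableSet
    (fun y hy => ((h.contDiffAt y hy.1).differentiableAt one_ne_zero).hasFDerivAt.hasFDerivWithinAt)
    (h.injOn.mono inter_subset_left) F

theorem lintegral_image_le (h : IsLocalParam d ν ρ Ψ) (r : ℝ) (F : Space n → ℝ≥0∞) :
    ∫⁻ x in Ψ '' slab ν ρ r, F x ≤ 2 * ∫⁻ y in slab ν ρ r, F (Ψ y) := by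
  rw [h.lintegral_image, ← lintegral_const_mul' _ _ (by simp)]
  refine setLIntegral_mono' (isOpen_slab ν ρ r).measurableSet fun y hy => ?_
  gcongr
  exact (ENNReal.ofReal_le_ofReal (h.det_mem y hy.1).2).trans_eq (ENNReal.ofReal_ofNat 2)

theorem le_lintegral_image (h : IsLocalParam d ν ρ Ψ) (r : ℝ) (F : Space n → ℝ≥0∞) :
    ∫⁻ y in slab ν ρ r, F (Ψ y) ≤ 2 * ∫⁻ x in Ψ '' slab ν ρ r, F x := by
  rw [h.lintegral_image, ← lintegral_const_mul' _ _ (by simp)]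
  refine setLIntegral_mono' (isOpen_slab ν ρ r).measurableSet fun y hy => ?_
  rw [← mul_assoc]
  refine le_mul_of_one_le_left' ?_
  have e : (2 : ℝ≥0∞) * ENNReal.ofReal |(fderiv ℝ Ψ y).det| =
      ENNReal.ofReal (2 * |(fderiv ℝ Ψ y).det|) := by
    rw [ENNReal.ofReal_mul zero_le_two, ENNReal.ofReal_ofNat]
  rw [e, ENNReal.one_le_ofReal]
  linarith [(h.det_mem y hy.1).1]

/-- The factor `2` is not sharp. -/
theorem exists_eq_add_smul (hν : ‖ν‖ = 1) (y : Space n) :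
    ∃ b, inner ℝ ν b = 0 ∧ y = b + (inner ℝ ν y : ℝ) • ν ∧ ‖b‖ ≤ 2 * ‖y‖ := by
  refine ⟨y - (inner ℝ ν y : ℝ) • ν, ?_, by module, ?_⟩
  · rw [inner_sub_right, inner_smul_right, real_inner_self_eq_norm_sq, hν]; ring
  · refine (norm_sub_le _ _).trans ?_
    have := abs_real_inner_le_norm ν y
    rw [norm_smul, hν, Real.norm_eq_abs]
    rw [hν] at this
    linarith

/-- Discs in the hyperplane orthogonal to `ν` have positive and finite measure: a cylinder over the
disc contains a ball and is contained in a ball. -/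
theorem measure_disc (hν : ‖ν‖ = 1) {σ : ℝ} (hσ : 0 < σ) :
    μHE[n - 1] {b : Space n | inner ℝ ν b = 0 ∧ ‖b‖ < σ} ≠ 0 ∧
    μHE[n - 1] {b : Space n | inner ℝ ν b = 0 ∧ ‖b‖ < σ} ≠ ⊤ := by
  have hv := volume_cylinder hν (B := {b : Space n | inner ℝ ν b = 0 ∧ ‖b‖ < σ})
    (fun b hb => hb.1) (Ioo (-1) 1)
  set A := {x : Space n | ∃ b ∈ {b : Space n | inner ℝ ν b = 0 ∧ ‖b‖ < σ}, ∃ t ∈ Ioo (-1 : ℝ) 1,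
    x = b + t • ν} with hA
  constructor
  · intro h0
    rw [h0, zero_mul] at hv
    have hsub : Metric.ball (0 : Space n) (min (σ / 2) 1) ⊆ A := by
      intro y hy
      rw [mem_ball_zero_iff, lt_min_iff] at hy
      obtain ⟨b, hb1, hb2, hb3⟩ := exists_eq_add_smul hν y
      refine ⟨b, ⟨hb1, by linarith⟩, _, ?_, hb2⟩
      have := abs_real_inner_le_norm ν y
      rw [hν] at this
      rw [mem_Ioo, ← abs_lt]
      linarith
    have := measure_mono_null hsub hv
    exact (Metric.measure_ball_pos volume (0 : Space n) (by positivity)).ne' this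
  · intro h0
    rw [h0, Real.volume_Ioo, ENNReal.top_mul (by norm_num)] at hv
    have hsub : A ⊆ Metric.ball (0 : Space n) (σ + 1) := by
      rintro _ ⟨b, ⟨-, hb⟩, t, ht, rfl⟩
      rw [mem_ball_zero_iff]
      refine (norm_add_le _ _).trans_lt ?_
      rw [norm_smul, hν, mul_one, Real.norm_eq_abs]
      have := abs_lt.2 ht
      linarith
    exact ((measure_mono hsub).trans_lt measure_ball_lt_top).ne hv

theorem exists_volume_slab_le (hν : ‖ν‖ = 1) (hρ : 0 < ρ) :
    ∃ c : ℝ≥0, ∀ r : ℝ, volume (slab ν ρ r) ≤ c * ENNReal.ofReal r := by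
  obtain ⟨-, h2⟩ := measure_disc hν (σ := 2 * ρ) (by positivity)
  refine ⟨2 * (μHE[n - 1] {b : Space n | inner ℝ ν b = 0 ∧ ‖b‖ < 2 * ρ}).toNNReal, fun r => ?_⟩
  have hv := volume_cylinder hν (B := {b : Space n | inner ℝ ν b = 0 ∧ ‖b‖ < 2 * ρ})
    (fun b hb => hb.1) (Ioo (-r) r)
  refine (measure_mono (fun y hy => ?_)).trans (hv.le.trans ?_)
  · obtain ⟨b, hb1, hb2, hb3⟩ := exists_eq_add_smul hν y
    have := mem_ball_zero_iff.1 hy.1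
    exact ⟨b, ⟨hb1, by linarith⟩, _, abs_lt.1 hy.2, hb2⟩
  · rw [ENNReal.coe_mul, ENNReal.coe_toNNReal h2, Real.volume_Ioo, sub_neg_eq_add, ← two_mul,
      ENNReal.ofReal_mul (by norm_num)]
    simp only [ENNReal.ofReal_ofNat, ENNReal.coe_ofNat]
    apply le_of_eq; ring

theorem exists_le_volume_slab (hν : ‖ν‖ = 1) (hρ : 0 < ρ) :
    ∃ c : ℝ≥0, 0 < c ∧ ∀ r : ℝ, r < ρ / 2 → c * ENNReal.ofReal r ≤ volume (slab ν ρ r) := by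
  obtain ⟨h1, h2⟩ := measure_disc hν (σ := ρ / 2) (by positivity)
  refine ⟨2 * (μHE[n - 1] {b : Space n | inner ℝ ν b = 0 ∧ ‖b‖ < ρ / 2}).toNNReal,
    mul_pos two_pos (ENNReal.toNNReal_pos h1 h2), fun r hr => ?_⟩
  have hv := volume_cylinder hν (B := {b : Space n | inner ℝ ν b = 0 ∧ ‖b‖ < ρ / 2})
    (fun b hb => hb.1) (Ioo (-r) r)
  refine le_trans (le_trans (le_of_eq ?_) hv.ge) (measure_mono ?_)
  · rw [ENNReal.coe_mul, ENNReal.coe_toNNReal h2, Real.volume_Ioo, sub_neg_eq_add, ← two_mul,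
      ENNReal.ofReal_mul (by norm_num)]
    simp only [ENNReal.ofReal_ofNat, ENNReal.coe_ofNat]
    ring
  · rintro _ ⟨b, ⟨hb1, hb2⟩, t, ht, rfl⟩
    have htr : |t| < r := abs_lt.2 ht
    refine ⟨?_, ?_⟩
    · rw [mem_ball_zero_iff]
      refine (norm_add_le _ _).trans_lt ?_
      rw [norm_smul, hν, mul_one, Real.norm_eq_abs]
      linarith
    · change |inner ℝ ν (b + t • ν)| < r
      rw [inner_add_right, inner_smul_right, real_inner_self_eq_norm_sq, hν, hb1]
      simpa using htr

/-- The fundamental theorem of calculus along the image of a segment of the parameter ball. -/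
theorem enorm_sub_le (h : IsLocalParam d ν ρ Ψ) {f : Space n → ℝ} (hf : ContDiff ℝ 1 f)
    {x y : Space n} (hx : x ∈ Metric.ball 0 ρ) (hy : y ∈ Metric.ball 0 ρ) :
    ‖f (Ψ x) - f (Ψ y)‖ₑ ≤ ENNReal.ofReal (4 * ρ) *
      ∫⁻ s in Icc (0 : ℝ) 1, ‖fderiv ℝ f (Ψ (x + s • (y - x)))‖ₑ := by
  have hρ := h.pos
  have hin : ∀ s ∈ Icc (0 : ℝ) 1, x + s • (y - x) ∈ Metric.ball (0 : Space n) ρ := by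
    intro s hs
    exact (convex_ball 0 ρ).add_smul_sub_mem hx hy hs
  have hd : ∀ s ∈ Icc (0 : ℝ) 1, HasDerivAt (fun s : ℝ => f (Ψ (x + s • (y - x))))
      (fderiv ℝ f (Ψ (x + s • (y - x))) (fderiv ℝ Ψ (x + s • (y - x)) (y - x))) s := by
    intro s hs
    have h1 : HasDerivAt (fun s : ℝ => x + s • (y - x)) (y - x) s := by
      simpa using ((hasDerivAt_id s).smul_const (y - x)).const_add x
    have h2 := ((h.contDiffAt _ (hin s hs)).differentiableAt one_ne_zero).hasFDerivAt
    have h3 := ((hf.differentiable one_ne_zero) (Ψ (x + s • (y - x)))).hasFDerivAt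
    exact (h3.comp_hasDerivAt s (h2.comp_hasDerivAt s h1) :)
  have hc : ContDiffOn ℝ 1 (fun s : ℝ => f (Ψ (x + s • (y - x)))) (Icc 0 1) := by
    intro s hs
    have h1 : ContDiffAt ℝ 1 (fun s : ℝ => x + s • (y - x)) s := by fun_prop
    exact (hf.contDiffAt.comp s ((h.contDiffAt _ (hin s hs)).comp s h1)).contDiffWithinAt
  have key := enorm_sub_le_lintegral_deriv_of_contDiffOn_Icc hc zero_le_one
  simp only [one_smul, zero_smul, add_zero, add_sub_cancel] at key
  rw [← enorm_neg, neg_sub]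
  refine key.trans ?_
  rw [← lintegral_const_mul' _ _ ENNReal.ofReal_ne_top]
  refine setLIntegral_mono' measurableSet_Icc fun s hs => ?_
  rw [(hd s hs).deriv]
  have hxy : ‖y - x‖ ≤ 2 * ρ := by
    have := norm_sub_le y x
    rw [mem_ball_zero_iff] at hx hy
    linarith
  rw [← ofReal_norm, ← ofReal_norm, ← ENNReal.ofReal_mul (by positivity)]
  apply ENNReal.ofReal_le_ofReal
  calc _ ≤ ‖fderiv ℝ f (Ψ (x + s • (y - x)))‖ * ‖fderiv ℝ Ψ (x + s • (y - x)) (y - x)‖ :=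
        ContinuousLinearMap.le_opNorm _ _
    _ ≤ ‖fderiv ℝ f (Ψ (x + s • (y - x)))‖ * (2 * (2 * ρ)) := by
        gcongr
        exact ((fderiv ℝ Ψ _).le_opNorm _).trans
          (mul_le_mul (h.norm_fderiv_le _ (hin s hs)) hxy (norm_nonneg _) (by norm_num))
    _ = _ := by ring

/-- The Poincaré inequality on the image of a slab. The slab being convex, its diameter in the
directions of the hypersurface enters only through the constant, while the factor `|slab|` carries
the dependence on the thickness `r`. -/
theorem poincare (h : IsLocalParam d ν ρ Ψ) {f : Space n → ℝ} (hf : ContDiff ℝ 1 f) (r : ℝ) :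
    ∫⁻ x in Ψ '' slab ν ρ r, ∫⁻ y in Ψ '' slab ν ρ r, ‖f x - f y‖ₑ ≤
      ENNReal.ofReal (32 * ρ) * 2 ^ n * volume (slab ν ρ r) *
        ∫⁻ x in Ψ '' slab ν ρ r, ‖fderiv ℝ f x‖ₑ := by
  classical
  set T := slab ν ρ r with hT
  have hTm : MeasurableSet T := (isOpen_slab ν ρ r).measurableSet
  set G : Space n → ℝ≥0∞ := T.indicator fun y => ‖fderiv ℝ f (Ψ y)‖ₑ with hG
  have hGm : Measurable G := by
    rw [hG, ← piecewise_eq_indicator]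
    refine ContinuousOn.measurable_piecewise (fun y hy => ?_) continuousOn_const hTm
    have h1 : ContinuousAt Ψ y := (h.contDiffAt y hy.1).continuousAt
    have h2 : Continuous (fderiv ℝ f) := hf.continuous_fderiv one_ne_zero
    exact ((h2.continuousAt.comp h1).enorm).continuousWithinAt
  have step : ∀ x ∈ T, ∀ y ∈ T, ‖f (Ψ x) - f (Ψ y)‖ₑ ≤
      ENNReal.ofReal (4 * ρ) * ∫⁻ s in Icc (0 : ℝ) 1, G (x + s • (y - x)) := by
    intro x hx y hy
    refine (h.enorm_sub_le hf hx.1 hy.1).trans (le_of_eq ?_)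
    congr 1
    refine setLIntegral_congr_fun measurableSet_Icc fun s hs => ?_
    have : x + s • (y - x) ∈ T := (convex_slab ν ρ r).add_smul_sub_mem hx hy hs
    simp only [hG, indicator_of_mem this]
  calc ∫⁻ x in Ψ '' T, ∫⁻ y in Ψ '' T, ‖f x - f y‖ₑ
      ≤ 2 * ∫⁻ x in T, ∫⁻ y in Ψ '' T, ‖f (Ψ x) - f y‖ₑ := h.lintegral_image_le r _
    _ ≤ 2 * ∫⁻ x in T, 2 * ∫⁻ y in T, ‖f (Ψ x) - f (Ψ y)‖ₑ := by
        gcongr with x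
        exact h.lintegral_image_le r fun y => ‖f (Ψ x) - f y‖ₑ
    _ = 4 * ∫⁻ x in T, ∫⁻ y in T, ‖f (Ψ x) - f (Ψ y)‖ₑ := by
        rw [lintegral_const_mul' _ _ (by simp), ← mul_assoc]
        norm_num
    _ ≤ 4 * ∫⁻ x in T, ∫⁻ y in T, ENNReal.ofReal (4 * ρ) *
          ∫⁻ s in Icc (0 : ℝ) 1, G (x + s • (y - x)) := by
        gcongr 4 * ?_
        exact setLIntegral_mono' hTm fun x hx => setLIntegral_mono' hTm fun y hy => step x hx y hy
    _ = 4 * (ENNReal.ofReal (4 * ρ) * ∫⁻ x in T, ∫⁻ y in T,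
          ∫⁻ s in Icc (0 : ℝ) 1, G (x + s • (y - x))) := by
        simp_rw [lintegral_const_mul' _ _ ENNReal.ofReal_ne_top]
    _ ≤ 4 * (ENNReal.ofReal (4 * ρ) * (2 ^ n * volume T * ∫⁻ x in T, G x)) := by
        gcongr
        exact lintegral_segment_le (convex_slab ν ρ r) hTm hGm
    _ = 4 * (ENNReal.ofReal (4 * ρ) * (2 ^ n * volume T *
          ∫⁻ x in T, ‖fderiv ℝ f (Ψ x)‖ₑ)) := by
        congr 3
        exact setLIntegral_congr_fun hTm fun x hx => indicator_of_mem hx _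
    _ ≤ 4 * (ENNReal.ofReal (4 * ρ) * (2 ^ n * volume T *
          (2 * ∫⁻ x in Ψ '' T, ‖fderiv ℝ f x‖ₑ))) := by
        gcongr
        exact h.le_lintegral_image r fun x => ‖fderiv ℝ f x‖ₑ
    _ = _ := by
        have e : ENNReal.ofReal (32 * ρ) = 8 * ENNReal.ofReal (4 * ρ) := by
          rw [← ENNReal.ofReal_ofNat 8, ← ENNReal.ofReal_mul (by norm_num)]
          congr 1; ring
        have e' : (8 : ℝ≥0∞) = 4 * 2 := by norm_num
        rw [e, e']; ring

end IsLocalParam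

/-! ### Uniform Poincaré inequality on thin tubes -/

/-- On thin tubes, the mean oscillation of `C¹` functions between the parts in `A` and in `B` is
controlled by `r` times the total variation on the tube, with a constant that does not depend on
the width `r` of the tube. -/
def IsLinked {n : ℕ} (d : Space n → ℝ) (A B : Set (Space n)) : Prop :=
  ∃ C : ℝ≥0, ∃ r₀ : ℝ, 0 < r₀ ∧ ∀ r : ℝ, 0 < r → r < r₀ → ∀ f : Space n → ℝ, ContDiff ℝ 1 f →
    ∫⁻ x in A ∩ {x | |d x| < r}, ∫⁻ y in B ∩ {x | |d x| < r}, ‖f x - f y‖ₑ ≤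
      C * ENNReal.ofReal r * ∫⁻ x in {x | |d x| < r}, ‖fderiv ℝ f x‖ₑ

theorem IsLocalParam.isLinked {n : ℕ} {d : Space n → ℝ} {ν : Space n} {ρ : ℝ}
    {Ψ : Space n → Space n} (h : IsLocalParam d ν ρ Ψ) :
    IsLinked d (Ψ '' Metric.ball 0 ρ) (Ψ '' Metric.ball 0 ρ) := by
  obtain ⟨c, hc⟩ := IsLocalParam.exists_volume_slab_le h.norm_dir h.pos
  refine ⟨(32 * ρ).toNNReal * 2 ^ n * c, 1, one_pos, fun r _ _ f hf => ?_⟩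
  rw [← h.image_slab r]
  refine (h.poincare hf r).trans ?_
  push_cast
  calc _ ≤ ENNReal.ofReal (32 * ρ) * 2 ^ n * (c * ENNReal.ofReal r) *
        ∫⁻ x in {x | |d x| < r}, ‖fderiv ℝ f x‖ₑ := by
        gcongr
        · exact hc r
        · rw [h.image_slab]; exact inter_subset_right
    _ = _ := by rw [ENNReal.ofReal]; ring

namespace IsLinked

variable {n : ℕ} {d : Space n → ℝ} {A B A' B' D : Set (Space n)}

theorem mono (h : IsLinked d A B) (hA : A' ⊆ A) (hB : B' ⊆ B) : IsLinked d A' B' := by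
  obtain ⟨C, r₀, hr₀, h⟩ := h
  refine ⟨C, r₀, hr₀, fun r hr hr' f hf => le_trans ?_ (h r hr hr' f hf)⟩
  refine (lintegral_mono_set (inter_subset_inter_left _ hA)).trans ?_
  exact lintegral_mono fun x => lintegral_mono_set (inter_subset_inter_left _ hB)

theorem symm (h : IsLinked d A B) : IsLinked d B A := by
  obtain ⟨C, r₀, hr₀, h⟩ := h
  refine ⟨C, r₀, hr₀, fun r hr hr' f hf => le_trans (le_of_eq ?_) (h r hr hr' f hf)⟩
  rw [lintegral_lintegral_swap]
  · simp_rw [enorm_sub_rev]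
  · have : Continuous fun p : Space n × Space n => ‖f p.1 - f p.2‖ₑ := by
      have := hf.continuous
      fun_prop
    exact this.measurable.aemeasurable

theorem union_left (h : IsLinked d A B) (h' : IsLinked d A' B) : IsLinked d (A ∪ A') B := by
  obtain ⟨C, r₀, hr₀, h⟩ := h
  obtain ⟨C', r₀', hr₀', h'⟩ := h'
  refine ⟨C + C', min r₀ r₀', lt_min hr₀ hr₀', fun r hr hr' f hf => ?_⟩
  rw [union_inter_distrib_right]
  refine (lintegral_union_le _ _ _).trans ?_
  rw [ENNReal.coe_add, add_mul, add_mul]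
  exact add_le_add (h r hr (hr'.trans_le (min_le_left _ _)) f hf)
    (h' r hr (hr'.trans_le (min_le_right _ _)) f hf)

theorem union_right (h : IsLinked d A B) (h' : IsLinked d A B') : IsLinked d A (B ∪ B') :=
  (h.symm.union_left h'.symm).symm

/-- Linking is transitive through an intermediate set that fills a fixed fraction of the tube. -/
theorem trans (h : IsLinked d A B) (h' : IsLinked d B D) {c : ℝ≥0} (hc : 0 < c) {c' : ℝ≥0}
    {r₁ : ℝ} (hr₁ : 0 < r₁)
    (hB : ∀ r, 0 < r → r < r₁ → c * ENNReal.ofReal r ≤ volume (B ∩ {x | |d x| < r}))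
    (hU : ∀ r, 0 < r → r < r₁ → volume {x | |d x| < r} ≤ c' * ENNReal.ofReal r) :
    IsLinked d A D := by
  obtain ⟨C, r₀, hr₀, h⟩ := h
  obtain ⟨C', r₀', hr₀', h'⟩ := h'
  refine ⟨c⁻¹ * c' * (C + C'), min r₁ (min r₀ r₀'), by positivity, fun r hr hr' f hf => ?_⟩
  have hrr₁ : r < r₁ := hr'.trans_le (min_le_left _ _)
  have h1 := h r hr (hr'.trans_le ((min_le_right _ _).trans (min_le_left _ _))) f hf
  have h2 := h' r hr (hr'.trans_le ((min_le_right _ _).trans (min_le_right _ _))) f hf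
  have hVB := hB r hr hrr₁
  have hVU := hU r hr hrr₁
  set U := {x | |d x| < r} with hUdef
  set I := ∫⁻ x in U, ‖fderiv ℝ f x‖ₑ with hI
  have hfc := hf.continuous
  have hm : Continuous fun p : Space n × Space n => ‖f p.1 - f p.2‖ₑ := by fun_prop
  have hVA : volume (A ∩ U) ≤ volume U := measure_mono inter_subset_right
  have hVD : volume (D ∩ U) ≤ volume U := measure_mono inter_subset_right
  set J := ∫⁻ x in A ∩ U, ∫⁻ y in D ∩ U, ‖f x - f y‖ₑ with hJ
  have key : J * volume (B ∩ U) ≤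
      (C * ENNReal.ofReal r * I) * volume U + volume U * (C' * ENNReal.ofReal r * I) := by
    calc J * volume (B ∩ U)
        = ∫⁻ x in A ∩ U, ∫⁻ y in D ∩ U, ∫⁻ w in B ∩ U, ‖f x - f y‖ₑ := by
          simp_rw [setLIntegral_const]
          rw [hJ, ← lintegral_mul_const]
          · refine lintegral_congr fun x => ?_
            rw [lintegral_mul_const]
            exact (by fun_prop : Continuous fun y => ‖f x - f y‖ₑ).measurable
          · exact hm.measurable.lintegral_prod_right'
      _ ≤ ∫⁻ x in A ∩ U, ∫⁻ y in D ∩ U, ∫⁻ w in B ∩ U, (‖f x - f w‖ₑ + ‖f w - f y‖ₑ) := by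
          refine lintegral_mono fun x => lintegral_mono fun y => lintegral_mono fun w => ?_
          have : f x - f y = (f x - f w) + (f w - f y) := by ring
          rw [this]
          exact enorm_add_le _ _
      _ = ∫⁻ x in A ∩ U, ∫⁻ y in D ∩ U,
            ((∫⁻ w in B ∩ U, ‖f x - f w‖ₑ) + ∫⁻ w in B ∩ U, ‖f w - f y‖ₑ) := by
          refine lintegral_congr fun x => lintegral_congr fun y => ?_
          exact lintegral_add_left
            (by fun_prop : Continuous fun w => ‖f x - f w‖ₑ).measurable _
      _ = (∫⁻ x in A ∩ U, ∫⁻ w in B ∩ U, ‖f x - f w‖ₑ) * volume (D ∩ U) +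
            volume (A ∩ U) * ∫⁻ y in D ∩ U, ∫⁻ w in B ∩ U, ‖f w - f y‖ₑ := by
          have hm1 : Measurable fun x => ∫⁻ w in B ∩ U, ‖f x - f w‖ₑ :=
            hm.measurable.lintegral_prod_right'
          have e1 : ∀ x, ∫⁻ y in D ∩ U,
              ((∫⁻ w in B ∩ U, ‖f x - f w‖ₑ) + ∫⁻ w in B ∩ U, ‖f w - f y‖ₑ) =
              (∫⁻ w in B ∩ U, ‖f x - f w‖ₑ) * volume (D ∩ U) +
              ∫⁻ y in D ∩ U, ∫⁻ w in B ∩ U, ‖f w - f y‖ₑ := by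
            intro x
            rw [lintegral_add_left measurable_const, setLIntegral_const]
          simp_rw [e1]
          rw [lintegral_add_left (hm1.mul_const _), lintegral_mul_const _ hm1, setLIntegral_const,
            mul_comm (volume (A ∩ U))]
      _ ≤ (C * ENNReal.ofReal r * I) * volume U + volume U * (C' * ENNReal.ofReal r * I) := by
          gcongr
          rw [lintegral_lintegral_swap]
          · exact h2
          · exact (by fun_prop : Continuous fun p : Space n × Space n =>
              ‖f p.2 - f p.1‖ₑ).measurable.aemeasurable
  have hr0 : ENNReal.ofReal r ≠ 0 := by simpa using hr
  have hc0 : (c : ℝ≥0∞) ≠ 0 := by exact_mod_cast hc.ne'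
  have key2 : J * (c * ENNReal.ofReal r) ≤
      (c' * ((C + C') * ENNReal.ofReal r * I)) * ENNReal.ofReal r := by
    calc J * (c * ENNReal.ofReal r) ≤ J * volume (B ∩ U) := by gcongr
      _ ≤ _ := key
      _ = volume U * ((C + C') * ENNReal.ofReal r * I) := by ring
      _ ≤ (c' * ENNReal.ofReal r) * ((C + C') * ENNReal.ofReal r * I) := by gcongr
      _ = _ := by ring
  rw [← mul_assoc, ENNReal.mul_le_mul_iff_left hr0 ENNReal.ofReal_ne_top] at key2
  rw [ENNReal.coe_mul, ENNReal.coe_mul, ENNReal.coe_inv hc.ne', ENNReal.coe_add]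
  calc J = (c : ℝ≥0∞)⁻¹ * (J * c) := by
        rw [mul_comm J, ← mul_assoc, ENNReal.inv_mul_cancel hc0 ENNReal.coe_ne_top, one_mul]
    _ ≤ (c : ℝ≥0∞)⁻¹ * (c' * ((C + C') * ENNReal.ofReal r * I)) := by gcongr
    _ = _ := by ring

end IsLinked

namespace IsTubularDist

variable {n : ℕ} {Sig : Set (Space n)} {d : Space n → ℝ} {R K : ℝ}

theorem exists_le_volume_inter (h : IsTubularDist Sig d R K) {z : Space n} (hz : z ∈ Sig)
    {B : Set (Space n)} (hB : IsOpen B) (hzB : z ∈ B) :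
    ∃ c : ℝ≥0, 0 < c ∧ ∃ r₀ : ℝ, 0 < r₀ ∧ ∀ r : ℝ, r < r₀ →
      c * ENNReal.ofReal r ≤ volume (B ∩ {x | |d x| < r}) := by
  obtain ⟨ν, ρ, Ψ, hΨ, -, hsub⟩ := h.exists_isLocalParam hz hB hzB
  obtain ⟨c, hc, hv⟩ := IsLocalParam.exists_le_volume_slab hΨ.norm_dir hΨ.pos
  refine ⟨c / 2, by positivity, ρ / 2, by have := hΨ.pos; positivity, fun r hr => ?_⟩
  have h1 := hΨ.le_lintegral_image r fun _ => 1
  simp only [lintegral_const, one_mul, Measure.restrict_apply_univ] at h1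
  have h2 : volume (Ψ '' IsLocalParam.slab ν ρ r) ≤ volume (B ∩ {x | |d x| < r}) := by
    rw [hΨ.image_slab]
    exact measure_mono (inter_subset_inter_left _ hsub)
  have h3 := ((hv r hr).trans h1).trans (mul_le_mul_right h2 2)
  rw [ENNReal.coe_div two_ne_zero, ENNReal.coe_ofNat, ENNReal.mul_comm_div, ← mul_div_assoc]
  exact ENNReal.div_le_of_le_mul' h3

/-- The uniform `L¹` Poincaré inequality on thin tubes around a connected hypersurface. Being linked
near a pair of points of `Sig` is an open equivalence relation, so by connectedness any two points
have linked neighbourhoods; compactness, applied in one variable after the other, links a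
neighbourhood of `Sig` with itself. -/
theorem exists_poincare (h : IsTubularDist Sig d R K) (hconn : IsConnected Sig) {c' : ℝ≥0} {r₁ : ℝ}
    (hr₁ : 0 < r₁) (hU : ∀ r, 0 < r → r < r₁ → volume {x | |d x| < r} ≤ c' * ENNReal.ofReal r) :
    ∃ C : ℝ≥0, ∃ r₀ : ℝ, 0 < r₀ ∧ ∀ r : ℝ, 0 < r → r < r₀ → ∀ f : Space n → ℝ, ContDiff ℝ 1 f →
    ∫⁻ x in {x | |d x| < r}, ∫⁻ y in {x | |d x| < r}, ‖f x - f y‖ₑ ≤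
      C * ENNReal.ofReal r * ∫⁻ x in {x | |d x| < r}, ‖fderiv ℝ f x‖ₑ := by
  have hP : ∀ x ∈ Sig, ∀ y ∈ Sig, ∃ A B, IsOpen A ∧ IsOpen B ∧ x ∈ A ∧ y ∈ B ∧ IsLinked d A B := by
    intro x hx y hy
    refine hconn.isPreconnected.induction₂
      (fun x y => ∃ A B, IsOpen A ∧ IsOpen B ∧ x ∈ A ∧ y ∈ B ∧ IsLinked d A B) ?_ ?_ ?_ hx hy
    · intro z hz
      obtain ⟨ν, ρ, Ψ, hΨ, hzΨ, -⟩ := h.exists_isLocalParam hz isOpen_univ (mem_univ z)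
      filter_upwards [mem_nhdsWithin_of_mem_nhds (hΨ.isOpen_image.mem_nhds hzΨ)] with w hw
      exact ⟨_, _, hΨ.isOpen_image, hΨ.isOpen_image, hzΨ, hw, hΨ.isLinked⟩
    · rintro x y z - hy - ⟨A, B, hA, hB, hxA, hyB, h1⟩ ⟨B', D, hB', hD, hyB', hzD, h2⟩
      refine ⟨A, D, hA, hD, hxA, hzD, ?_⟩
      obtain ⟨c, hc, r₀, hr₀, hv⟩ := h.exists_le_volume_inter hy (hB.inter hB') ⟨hyB, hyB'⟩
      exact IsLinked.trans (h1.mono Subset.rfl inter_subset_left)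
        (h2.mono inter_subset_right Subset.rfl) hc (lt_min hr₀ hr₁)
        (fun r _ hr => hv r (hr.trans_le (min_le_left _ _)))
        (fun r hr hr' => hU r hr (hr'.trans_le (min_le_right _ _)))
    · rintro x y - - ⟨A, B, hA, hB, hxA, hyB, h1⟩
      exact ⟨B, A, hB, hA, hyB, hxA, h1.symm⟩
  have hempty : ∀ B, IsLinked d ∅ B := fun B =>
    ⟨0, 1, one_pos, fun r _ _ f _ => by simp⟩
  have hQ : ∀ x ∈ Sig, ∃ A T, IsOpen A ∧ IsOpen T ∧ x ∈ A ∧ Sig ⊆ T ∧ IsLinked d A T := by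
    intro x hx
    refine h.isCompact.induction_on (p := fun s => ∃ A T, IsOpen A ∧ IsOpen T ∧ x ∈ A ∧ s ⊆ T ∧
      IsLinked d A T) ⟨univ, ∅, isOpen_univ, isOpen_empty, mem_univ x, Subset.rfl,
        (hempty _).symm⟩ ?_ ?_ ?_
    · rintro s t hst ⟨A, T, hA, hT, hxA, hsT, hl⟩
      exact ⟨A, T, hA, hT, hxA, hst.trans hsT, hl⟩
    · rintro s t ⟨A, T, hA, hT, hxA, hsT, hl⟩ ⟨A', T', hA', hT', hxA', hsT', hl'⟩
      exact ⟨A ∩ A', T ∪ T', hA.inter hA', hT.union hT', ⟨hxA, hxA'⟩, union_subset_union hsT hsT',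
        (hl.mono inter_subset_left Subset.rfl).union_right
          (hl'.mono inter_subset_right Subset.rfl)⟩
    · intro y hy
      obtain ⟨A, B, hA, hB, hxA, hyB, hl⟩ := hP x hx y hy
      exact ⟨B, mem_nhdsWithin_of_mem_nhds (hB.mem_nhds hyB), A, B, hA, hB, hxA, Subset.rfl, hl⟩
  have hL : ∃ A T, IsOpen A ∧ IsOpen T ∧ Sig ⊆ A ∧ Sig ⊆ T ∧ IsLinked d A T := by
    refine h.isCompact.induction_on (p := fun s => ∃ A T, IsOpen A ∧ IsOpen T ∧ s ⊆ A ∧ Sig ⊆ T ∧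
      IsLinked d A T) ⟨∅, univ, isOpen_empty, isOpen_univ, Subset.rfl, subset_univ _,
        hempty _⟩ ?_ ?_ ?_
    · rintro s t hst ⟨A, T, hA, hT, hsA, hsT, hl⟩
      exact ⟨A, T, hA, hT, hst.trans hsA, hsT, hl⟩
    · rintro s t ⟨A, T, hA, hT, hsA, hsT, hl⟩ ⟨A', T', hA', hT', hsA', hsT', hl'⟩
      exact ⟨A ∪ A', T ∩ T', hA.union hA', hT.inter hT', union_subset_union hsA hsA',
        subset_inter hsT hsT', (hl.mono Subset.rfl inter_subset_left).union_left
          (hl'.mono Subset.rfl inter_subset_right)⟩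
    · intro x hx
      obtain ⟨A, T, hA, hT, hxA, hsT, hl⟩ := hQ x hx
      exact ⟨A, mem_nhdsWithin_of_mem_nhds (hA.mem_nhds hxA), A, T, hA, hT, Subset.rfl, hsT, hl⟩
  obtain ⟨A, T, hA, hT, hSA, hST, C, r₀, hr₀, hC⟩ := hL
  obtain ⟨ρ, hρ, hsub⟩ := h.isCompact.exists_thickening_subset_open (hA.inter hT)
    (subset_inter hSA hST)
  refine ⟨C, min r₀ ρ, lt_min hr₀ hρ, fun r hr hr' f hf => ?_⟩
  have hin : {x | |d x| < r} ⊆ A ∩ T := by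
    intro x hx
    apply hsub
    obtain ⟨z, hz, hxz⟩ := (Metric.infDist_lt_iff h.nonempty).1 ((h.abs_eq x).symm.trans_lt hx)
    exact Metric.mem_thickening_iff.2 ⟨z, hz, hxz.trans (hr'.trans_le (min_le_right _ _))⟩
  have := hC r hr (hr'.trans_le (min_le_left _ _)) f hf
  rwa [inter_eq_self_of_subset_right (hin.trans inter_subset_left),
    inter_eq_self_of_subset_right (hin.trans inter_subset_right)] at this

end IsTubularDist

/-! ### Passage to functions of bounded variation -/

theorem totalVariation_spec {n : ℕ} {U : Set (Space n)} {φ : Space n → ℝ} (h : IsSignBV U φ) :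
    IsTotalVariation U φ (totalVariation U φ) := by
  rw [totalVariation, dif_pos h.2.2]
  exact h.2.2.choose_spec

theorem gradient_comp_sub {n : ℕ} {f : Space n → ℝ} (hf : Differentiable ℝ f) (x y : Space n) :
    ∇ (fun y => f (x - y)) y = -∇ f (x - y) := by
  apply HasGradientAt.gradient
  rw [hasGradientAt_iff_hasFDerivAt, map_neg, toDual_gradient]
  have h1 : HasFDerivAt (fun y : Space n => x - y) (-ContinuousLinearMap.id ℝ (Space n)) y :=
    (hasFDerivAt_id y).const_sub x
  have h2 := (hf (x - y)).hasFDerivAt.comp y h1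
  refine h2.congr_fderiv ?_
  ext1 v
  simp

/-- The gradient of a mollification of `φ` is the mollification of its distributional gradient, so
its norm is bounded by the mollification of the total variation measure. -/
theorem fderiv_convolution_le {n : ℕ} {U : Set (Space n)} (hU : IsOpen U) {φ : Space n → ℝ}
    (hφ : IntegrableOn φ U) {m : Measure (Space n)} (hm : IsTotalVariation U φ m)
    {f : Space n → ℝ} (hf : ContDiff ℝ 1 f) (hfc : HasCompactSupport f) {x : Space n}
    (hx : ∀ y, x - y ∈ tsupport f → y ∈ U) :
    ‖fderiv ℝ (f ⋆[ContinuousLinearMap.lsmul ℝ ℝ, volume] U.indicator φ) x‖ₑ ≤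
      ∫⁻ y, ‖f (x - y)‖ₑ ∂m := by
  obtain ⟨hfin, -, σ, hσ, hσ1, hint⟩ := hm
  have hψ : Integrable (U.indicator φ) := (integrable_indicator_iff hU.measurableSet).2 hφ
  set g : Space n → ℝ := fun y => f (x - y) with hg
  have hgc : ContDiff ℝ 1 g := hf.comp (contDiff_const.sub contDiff_id)
  have hsub : tsupport g ⊆ (fun y => x - y) ⁻¹' tsupport f := by
    refine closure_minimal (fun y hy => subset_tsupport f hy) ?_
    exact (isClosed_tsupport f).preimage (by fun_prop)
  have hgcs : HasCompactSupport g := hfc.comp_homeomorph (Homeomorph.subLeft x)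
  have key := hint g hgc hgcs fun y hy => hx y (hsub hy)
  have hd := (hfc.hasFDerivAt_convolution_left (ContinuousLinearMap.lsmul ℝ ℝ) hf
    hψ.locallyIntegrable x).fderiv
  have hgrad : Integrable (fun y => U.indicator φ y • ∇ g y) := by
    have h1 : Continuous (∇ g) :=
      (InnerProductSpace.toDual ℝ (Space n)).symm.continuous.comp
        (hgc.continuous_fderiv one_ne_zero)
    have h2 : HasCompactSupport (∇ g) :=
      (hgcs.fderiv ℝ).comp_left (g := (InnerProductSpace.toDual ℝ (Space n)).symm) (map_zero _)
    obtain ⟨C, hC⟩ := h2.exists_bound_of_continuous h1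
    exact Integrable.smul_bdd hψ C h1.aestronglyMeasurable (Eventually.of_forall hC)
  have e1 : fderiv ℝ (f ⋆[ContinuousLinearMap.lsmul ℝ ℝ, volume] U.indicator φ) x =
      InnerProductSpace.toDual ℝ (Space n) (-∫ y in U, φ y • ∇ g y) := by
    rw [hd, convolution_eq_swap, ← integral_neg, ← integral_indicator hU.measurableSet]
    have e2 : (U.indicator fun y => -(φ y • ∇ g y)) = fun y => -(U.indicator φ y • ∇ g y) := by
      funext y
      by_cases hy : y ∈ U <;> simp [hy]
    rw [e2]
    have := ((InnerProductSpace.toDual ℝ (Space n)).toContinuousLinearEquiv.toContinuousLinearMap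
      ).integral_comp_comm hgrad.neg
    refine Eq.trans (integral_congr_ae (Eventually.of_forall fun y => ?_)) this
    have h3 : ∇ g y = -∇ f (x - y) := gradient_comp_sub (hf.differentiable one_ne_zero) x y
    ext v
    simp [h3, mul_comm]
  rw [e1, ← ofReal_norm, LinearIsometryEquiv.norm_map, ofReal_norm, key, neg_neg]
  refine (enorm_integral_le_lintegral_enorm _).trans (lintegral_mono_ae ?_)
  filter_upwards [hσ1] with y hy
  rw [enorm_smul, ← ofReal_norm (σ y), hy]
  simp [hg]

/-- A Poincaré inequality for smooth functions on a subset `V` of `U`, at a positive distance from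
the boundary of `U`, extends to functions of bounded variation on `U` by mollification. -/
theorem lintegral_sub_le_of_poincare {n : ℕ} {U V : Set (Space n)} (hU : IsOpen U)
    (hV : MeasurableSet V) {φ : Space n → ℝ} (hφ : IntegrableOn φ U) {m : Measure (Space n)}
    (hm : IsTotalVariation U φ m) {τ : ℝ} (hτ : 0 < τ)
    (hVU : ∀ x ∈ V, Metric.closedBall x τ ⊆ U) {C : ℝ≥0∞}
    (hC : ∀ f : Space n → ℝ, ContDiff ℝ 1 f →
      ∫⁻ x in V, ∫⁻ y in V, ‖f x - f y‖ₑ ≤ C * ∫⁻ x in V, ‖fderiv ℝ f x‖ₑ) :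
    ∫⁻ x in V, ∫⁻ y in V, ‖φ x - φ y‖ₑ ≤ C * m univ := by
  have hfin : IsFiniteMeasure m := hm.1
  have hψ : Integrable (U.indicator φ) := (integrable_indicator_iff hU.measurableSet).2 hφ
  let b : ℕ → ContDiffBump (0 : Space n) := fun k =>
    ⟨τ / (2 * (k + 1)), τ / (k + 1), by positivity, by
      apply div_lt_div_of_pos_left hτ (by positivity)
      have : (0 : ℝ) ≤ k := by positivity
      linarith⟩
  have hb : Tendsto (fun k => (b k).rOut) atTop (𝓝 0) := by
    have := (tendsto_const_div_atTop_nhds_zero_nat τ).comp (tendsto_add_atTop_nat 1)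
    refine this.congr fun k => ?_
    simp [b]
  set F : ℕ → Space n → ℝ := fun k =>
    ((b k).normed volume) ⋆[ContinuousLinearMap.lsmul ℝ ℝ, volume] U.indicator φ with hF
  have hlim : ∀ᵐ x, Tendsto (fun k => F k x) atTop (𝓝 (U.indicator φ x)) :=
    ContDiffBump.ae_convolution_tendsto_right_of_locallyIntegrable (K := 2) hb
      (Eventually.of_forall fun k => le_of_eq (by simp only [b]; field_simp))
      hψ.locallyIntegrable
  have hFc : ∀ k, ContDiff ℝ 1 (F k) := fun k =>
    (b k).hasCompactSupport_normed.contDiff_convolution_left _ (b k).contDiff_normed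
      hψ.locallyIntegrable
  have hbound : ∀ k, ∫⁻ x in V, ‖fderiv ℝ (F k) x‖ₑ ≤ m univ := by
    intro k
    have hs : ∀ x ∈ V, ‖fderiv ℝ (F k) x‖ₑ ≤ ∫⁻ y, ‖(b k).normed volume (x - y)‖ₑ ∂m := by
      intro x hx
      refine fderiv_convolution_le hU hφ hm (b k).contDiff_normed (b k).hasCompactSupport_normed
        fun y hy => hVU x hx ?_
      rw [ContDiffBump.tsupport_normed_eq, mem_closedBall_zero_iff] at hy
      rw [Metric.mem_closedBall, dist_comm, dist_eq_norm]
      refine hy.trans ?_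
      change τ / (k + 1) ≤ τ
      apply div_le_self hτ.le
      have : (0 : ℝ) ≤ k := by positivity
      linarith
    have hcont : Continuous fun p : Space n × Space n => ‖(b k).normed volume (p.1 - p.2)‖ₑ := by
      have := (b k).continuous_normed (μ := volume)
      fun_prop
    calc ∫⁻ x in V, ‖fderiv ℝ (F k) x‖ₑ
        ≤ ∫⁻ x in V, ∫⁻ y, ‖(b k).normed volume (x - y)‖ₑ ∂m := setLIntegral_mono' hV hs
      _ ≤ ∫⁻ x, ∫⁻ y, ‖(b k).normed volume (x - y)‖ₑ ∂m := setLIntegral_le_lintegral _ _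
      _ = ∫⁻ y, (∫⁻ x, ‖(b k).normed volume (x - y)‖ₑ) ∂m :=
          lintegral_lintegral_swap hcont.measurable.aemeasurable
      _ = ∫⁻ _, 1 ∂m := by
          refine lintegral_congr fun y => ?_
          rw [lintegral_sub_right_eq_self (fun x => ‖(b k).normed volume x‖ₑ) y]
          rw [← ofReal_integral_norm_eq_lintegral_enorm (b k).integrable_normed]
          simp_rw [Real.norm_eq_abs, abs_of_nonneg ((b k).nonneg_normed _)]
          rw [(b k).integral_normed, ENNReal.ofReal_one]
      _ = m univ := by simp
  have hsmooth : ∀ k, ∫⁻ x in V, ∫⁻ y in V, ‖F k x - F k y‖ₑ ≤ C * m univ := fun k =>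
    (hC _ (hFc k)).trans (mul_le_mul_right (hbound k) C)
  have hlimV : ∀ᵐ x ∂(volume.restrict V), Tendsto (fun k => F k x) atTop (𝓝 (φ x)) := by
    filter_upwards [ae_restrict_of_ae hlim, ae_restrict_mem hV] with x hx hxV
    rwa [indicator_of_mem (hVU x hxV (Metric.mem_closedBall_self hτ.le))] at hx
  have hcF : ∀ k, Continuous (F k) := fun k => (hFc k).continuous
  -- Fatou's lemma in each variable
  have inner : ∀ᵐ x ∂(volume.restrict V), ∫⁻ y in V, ‖φ x - φ y‖ₑ ≤
      liminf (fun k => ∫⁻ y in V, ‖F k x - F k y‖ₑ) atTop := by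
    filter_upwards [hlimV] with x hx
    refine le_trans (le_of_eq ?_) (lintegral_liminf_le fun k => ?_)
    · refine lintegral_congr_ae ?_
      filter_upwards [hlimV] with y hy
      exact ((hx.sub hy).enorm).liminf_eq.symm
    · have := hcF k
      exact (by fun_prop : Continuous fun y => ‖F k x - F k y‖ₑ).measurable
  calc ∫⁻ x in V, ∫⁻ y in V, ‖φ x - φ y‖ₑ
      ≤ ∫⁻ x in V, liminf (fun k => ∫⁻ y in V, ‖F k x - F k y‖ₑ) atTop :=
        lintegral_mono_ae inner
    _ ≤ liminf (fun k => ∫⁻ x in V, ∫⁻ y in V, ‖F k x - F k y‖ₑ) atTop := by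
        refine lintegral_liminf_le fun k => ?_
        have := hcF k
        exact (by fun_prop : Continuous fun p : Space n × Space n =>
          ‖F k p.1 - F k p.2‖ₑ).measurable.lintegral_prod_right'
    _ ≤ C * m univ := by
        refine (liminf_le_liminf (Eventually.of_forall hsmooth)).trans ?_
        simp

/-- For functions with values `±1` the double integral of `|φ(x) - φ(y)|` is
`|U|² - (∫ φ)²`. -/
theorem lintegral_sub_sign {n : ℕ} {U : Set (Space n)} (hUfin : volume U ≠ ⊤) {φ : Space n → ℝ}
    (hφ : IntegrableOn φ U) (hs : ∀ᵐ x ∂(volume.restrict U), φ x = -1 ∨ φ x = 1) :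
    ∫⁻ x in U, ∫⁻ y in U, ‖φ x - φ y‖ₑ =
      ENNReal.ofReal (volume.real U ^ 2 - (∫ x in U, φ x) ^ 2) := by
  have : IsFiniteMeasure (volume.restrict U) := ⟨by simpa using hUfin.lt_top⟩
  set μ := volume.restrict U with hμ
  have hφ' : Integrable φ μ := hφ
  have hi : ∀ x, Integrable (fun y => 1 - φ x * φ y) μ := fun x =>
    (integrable_const 1).sub (hφ'.const_mul _)
  have e1 : ∀ᵐ x ∂μ, ∫⁻ y, ‖φ x - φ y‖ₑ ∂μ = ENNReal.ofReal (μ.real univ - φ x * ∫ y, φ y ∂μ) := by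
    filter_upwards [hs] with x hx
    have h1 : ∫⁻ y, ‖φ x - φ y‖ₑ ∂μ = ∫⁻ y, ENNReal.ofReal (1 - φ x * φ y) ∂μ := by
      refine lintegral_congr_ae ?_
      filter_upwards [hs] with y hy
      rw [← ofReal_norm, Real.norm_eq_abs]
      congr 1
      rcases hx with hx | hx <;> rcases hy with hy | hy <;> rw [hx, hy] <;> norm_num
    rw [h1, ← ofReal_integral_eq_lintegral_ofReal (hi x), integral_sub (integrable_const 1)
      (hφ'.const_mul _), integral_const_mul]
    · simp
    · filter_upwards [hs] with y hy
      rcases hx with hx | hx <;> rcases hy with hy | hy <;> simp [hx, hy]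
  have hI : |∫ y, φ y ∂μ| ≤ μ.real univ := by
    have := norm_integral_le_of_norm_le_const (μ := μ) (f := φ) (C := 1) (by
      filter_upwards [hs] with y hy
      rcases hy with hy | hy <;> simp [hy])
    simpa using this
  rw [lintegral_congr_ae e1, ← ofReal_integral_eq_lintegral_ofReal, integral_sub
    (integrable_const _) (hφ'.mul_const _), integral_mul_const]
  · simp [hμ, sq]
  · exact (integrable_const _).sub (hφ'.mul_const _)
  · filter_upwards [hs] with x hx
    have := abs_le.1 hI
    rcases hx with hx | hx <;> simp only [hx, Pi.zero_apply] <;> linarith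

/-- If `∬ |φ(x) - φ(y)| ≤ D |U|`, then replacing `φ` by `1` increases the weighted volume
`|∫ w φ|` by at most `M D`, for weights `0 ≤ w ≤ M`. -/
theorem integral_weight_le {n : ℕ} {U : Set (Space n)} (hUm : MeasurableSet U)
    (hU0 : 0 < volume.real U) {φ : Space n → ℝ}
    (hφ : IntegrableOn φ U) (hs : ∀ᵐ x ∂(volume.restrict U), φ x = -1 ∨ φ x = 1) {D : ℝ}
    (hD : ∫⁻ x in U, ∫⁻ y in U, ‖φ x - φ y‖ₑ ≤ ENNReal.ofReal (D * volume.real U))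
    (hD0 : 0 ≤ D) {w : Space n → ℝ} {M : ℝ} (hw : IntegrableOn w U)
    (hw0 : ∀ x ∈ U, 0 ≤ w x) (hwM : ∀ x ∈ U, w x ≤ M) :
    ∫ x in U, w x ≤ |∫ x in U, w x * φ x| + M * D := by
  have hUfin : volume U ≠ ⊤ := fun h => by simp [Measure.real, h] at hU0
  rw [lintegral_sub_sign hUfin hφ hs, ENNReal.ofReal_le_ofReal_iff (by positivity)] at hD
  set V := volume.real U with hV
  set I := ∫ x in U, φ x with hI
  have hone : IntegrableOn (fun _ => (1 : ℝ)) U := integrableOn_const hUfin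
  have hvol : ∫ x in U, (1 : ℝ) = V := by simp [hV]
  have hwφ : IntegrableOn (fun x => w x * φ x) U := by
    refine Integrable.mul_bdd (c := 1) hw hφ.aestronglyMeasurable ?_
    filter_upwards [hs] with x hx
    rcases hx with hx | hx <;> simp [hx]
  have hM0 : 0 ≤ M := by
    obtain ⟨x, hx⟩ := nonempty_of_measure_ne_zero (s := U) (μ := volume)
      (fun h => by simp [hV, Measure.real, h] at hU0)
    exact (hw0 x hx).trans (hwM x hx)
  have minus : (∫ x in U, w x) - ∫ x in U, w x * φ x ≤ M * (V - I) := by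
    rw [← integral_sub hw hwφ, ← hvol, hI, ← integral_sub hone hφ, ← integral_const_mul]
    refine integral_mono_ae (hw.sub hwφ) ((hone.sub hφ).const_mul M) ?_
    filter_upwards [hs, ae_restrict_mem hUm] with x hx hxU
    have := hw0 x hxU
    have := hwM x hxU
    rcases hx with hx | hx <;> rw [hx] <;> linarith
  have plus : (∫ x in U, w x) + ∫ x in U, w x * φ x ≤ M * (V + I) := by
    rw [← integral_add hw hwφ, ← hvol, hI, ← integral_add hone hφ, ← integral_const_mul]
    refine integral_mono_ae (hw.add hwφ) ((hone.add hφ).const_mul M) ?_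
    filter_upwards [hs, ae_restrict_mem hUm] with x hx hxU
    have := hw0 x hxU
    have := hwM x hxU
    rcases hx with hx | hx <;> rw [hx] <;> linarith
  have a1 := le_abs_self (∫ x in U, w x * φ x)
  have a2 := neg_abs_le (∫ x in U, w x * φ x)
  -- the smaller one of `V - I` and `V + I` is at most `(V² - I²) / V`
  rcases le_total 0 I with h0 | h0
  · have : V - I ≤ D := by
      by_contra! hcon
      nlinarith
    nlinarith
  · have : V + I ≤ D := by
      by_contra! hcon
      nlinarith
    nlinarith

namespace IsTubularDist

variable {n : ℕ} {Sig : Set (Space n)} {d : Space n → ℝ} {R K : ℝ}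

/-- A uniform Poincaré inequality for smooth functions on the tubes of radius less than `r₀` extends
to functions of bounded variation: apply the smooth inequality on an exhaustion of the tube by
thinner tubes, which have a positive distance from its boundary. -/
theorem lintegral_sub_tube_le (h : IsTubularDist Sig d R K) {C : ℝ≥0} {r₀ : ℝ}
    (hC : ∀ r : ℝ, 0 < r → r < r₀ → ∀ f : Space n → ℝ, ContDiff ℝ 1 f →
      ∫⁻ x in {x | |d x| < r}, ∫⁻ y in {x | |d x| < r}, ‖f x - f y‖ₑ ≤
      C * ENNReal.ofReal r * ∫⁻ x in {x | |d x| < r}, ‖fderiv ℝ f x‖ₑ)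
    {r : ℝ} (hr : 0 < r) (hr₀ : r < r₀) {φ : Space n → ℝ}
    (hφ : IntegrableOn φ {x | |d x| < r}) {m : Measure (Space n)}
    (hm : IsTotalVariation {x | |d x| < r} φ m) :
    ∫⁻ x in {x | |d x| < r}, ∫⁻ y in {x | |d x| < r}, ‖φ x - φ y‖ₑ ≤
      C * ENNReal.ofReal r * m univ := by
  set T : ℕ → Set (Space n) := fun k => {x | |d x| < r * (1 - 1 / (k + 2))} with hT
  have hk : ∀ k : ℕ, 0 < 1 / ((k : ℝ) + 2) ∧ 1 / ((k : ℝ) + 2) < 1 := fun k => by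
    have : (0 : ℝ) ≤ k := by positivity
    exact ⟨by positivity, (div_lt_one (by positivity)).2 (by linarith)⟩
  have hmono : Monotone T := by
    intro i j hij x hx
    refine lt_of_lt_of_le (show |d x| < _ from hx) ?_
    gcongr
  have hUnion : ⋃ k, T k = {x | |d x| < r} := by
    refine Subset.antisymm (iUnion_subset fun k x hx =>
      lt_trans (show |d x| < _ from hx) ?_) fun x hx => ?_
    · nlinarith [(hk k).1]
    · have hlim : Tendsto (fun k : ℕ => r * (1 - 1 / ((k : ℝ) + 2))) atTop (𝓝 (r * (1 - 0))) := by
        refine Tendsto.const_mul _ (tendsto_const_nhds.sub ?_)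
        exact tendsto_const_nhds.div_atTop
          (tendsto_atTop_add_const_right _ _ tendsto_natCast_atTop_atTop)
      rw [sub_zero, mul_one] at hlim
      obtain ⟨k, hk⟩ := (hlim.eventually_const_lt hx).exists
      exact mem_iUnion.2 ⟨k, hk⟩
  have hstep : ∀ k, ∫⁻ x in T k, ∫⁻ y in T k, ‖φ x - φ y‖ₑ ≤ C * ENNReal.ofReal r * m univ := by
    intro k
    obtain ⟨hk0, hk1⟩ := hk k
    have hrk : 0 < r * (1 - 1 / ((k : ℝ) + 2)) := mul_pos hr (by linarith)
    have hrk' : r * (1 - 1 / ((k : ℝ) + 2)) ≤ r := by nlinarith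
    refine lintegral_sub_le_of_poincare (h.isOpen_tube r) (h.isOpen_tube _).measurableSet hφ hm
      (τ := r * (1 / ((k : ℝ) + 2)) / 2) (by positivity) (fun x hx y hy => ?_) fun f hf => ?_
    · have h1 := h.abs_le_add_dist y x
      have h2 : |d x| < r * (1 - 1 / ((k : ℝ) + 2)) := hx
      have h3 := Metric.mem_closedBall.1 hy
      change |d y| < r
      nlinarith
    · refine (hC _ hrk (hrk'.trans_lt hr₀) f hf).trans ?_
      gcongr
  have hAE : AEMeasurable (fun p : Space n × Space n => ‖φ p.1 - φ p.2‖ₑ)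
      ((volume.restrict {x | |d x| < r}).prod (volume.restrict {x | |d x| < r})) := by
    have h1 := hφ.aestronglyMeasurable.comp_fst (ν := volume.restrict {x | |d x| < r})
    have h2 := hφ.aestronglyMeasurable.comp_snd (μ := volume.restrict {x | |d x| < r})
    exact (h1.sub h2).enorm
  rw [← lintegral_prod _ hAE, Measure.prod_restrict, ← hUnion]
  have hprod : (⋃ k, T k) ×ˢ (⋃ k, T k) = ⋃ k, T k ×ˢ T k := by
    rw [iUnion_prod_of_monotone hmono hmono]
  rw [hprod, setLIntegral_iUnion_of_directed]
  · refine iSup_le fun k => ?_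
    rw [← Measure.prod_restrict]
    exact (lintegral_prod_le _).trans (hstep k)
  · exact (hmono.set_prod hmono).directed_le

/-- On thin tubes, passing from `φ` to the constant `1` costs at most a fixed multiple of the
total variation of `φ`, uniformly in the width of the tube. -/
theorem exists_integral_weight_tube_le (h : IsTubularDist Sig d R K) (hconn : IsConnected Sig)
    {c' : ℝ≥0} {r₁ : ℝ} (hr₁ : 0 < r₁)
    (hU : ∀ r, 0 < r → r < r₁ → volume {x | |d x| < r} ≤ c' * ENNReal.ofReal r) :
    ∃ C r₀ : ℝ, 0 < C ∧ 0 < r₀ ∧ ∀ r : ℝ, 0 < r → r < r₀ → ∀ φ : Space n → ℝ,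
      IsSignBV {x | |d x| < r} φ → ∀ (w : Space n → ℝ) (M : ℝ), IntegrableOn w {x | |d x| < r} →
      (∀ x, |d x| < r → 0 ≤ w x) → (∀ x, |d x| < r → w x ≤ M) →
      ∫ x in {x | |d x| < r}, w x ≤ |∫ x in {x | |d x| < r}, w x * φ x| +
        M * (C * (totalVariation {x | |d x| < r} φ).real univ) := by
  obtain ⟨C, r₀, hr₀, hC⟩ := h.exists_poincare hconn hr₁ hU
  obtain ⟨z, hz⟩ := h.nonempty
  obtain ⟨c, hc, r₂, hr₂, hv⟩ := h.exists_le_volume_inter hz isOpen_univ (mem_univ z)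
  have hc0 : (0 : ℝ) < c := hc
  refine ⟨(C + 1) / c, min r₀ (min r₁ r₂), by positivity, by positivity,
    fun r hr hr' φ hφ w M hw hw0 hwM => ?_⟩
  have hrr₀ : r < r₀ := hr'.trans_le (min_le_left _ _)
  have hrr₁ : r < r₁ := hr'.trans_le ((min_le_right _ _).trans (min_le_left _ _))
  have hrr₂ : r < r₂ := hr'.trans_le ((min_le_right _ _).trans (min_le_right _ _))
  have hm := totalVariation_spec hφ
  have hfin : IsFiniteMeasure (totalVariation {x | |d x| < r} φ) := hm.1
  have hvU : volume {x | |d x| < r} ≠ ⊤ :=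
    ((hU r hr hrr₁).trans_lt (by finiteness)).ne
  have hlow : c * r ≤ volume.real {x | |d x| < r} := by
    have := hv r hrr₂
    rw [univ_inter] at this
    have := ENNReal.toReal_mono hvU this
    rwa [ENNReal.toReal_mul, ENNReal.toReal_ofReal hr.le, ENNReal.coe_toReal] at this
  refine integral_weight_le (h.isOpen_tube r).measurableSet
    (lt_of_lt_of_le (by positivity) hlow) hφ.1 hφ.2.1 ?_ (by positivity) hw hw0 hwM
  refine (h.lintegral_sub_tube_le hC hr hrr₀ hφ.1 hm).trans ?_
  rw [← ofReal_measureReal, ← ENNReal.ofReal_coe_nnreal, ← ENNReal.ofReal_mul (by positivity),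
    ← ENNReal.ofReal_mul (by positivity)]
  apply ENNReal.ofReal_le_ofReal
  set mm := (totalVariation {x | |d x| < r} φ).real univ
  have hmm : 0 ≤ mm := measureReal_nonneg
  have e : (C + 1) / c * mm * (c * r) = (C + 1) * r * mm := by field_simp
  calc C * r * mm ≤ (C + 1) * r * mm := by gcongr; linarith
    _ = (C + 1) / c * mm * (c * r) := e.symm
    _ ≤ _ := by gcongr

end IsTubularDist

/-! ### The weight along the profile -/

namespace IsLayerWeight

variable {lam lamBar : ℝ} {Wt : ℝ → ℝ}

theorem one_sub_lt (h : IsLayerWeight lam lamBar Wt) : 1 - lam < lamBar⁻¹ * (1 - lam) := by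
  have h1 := h.lam_lt_one
  have h2 := (one_lt_inv₀ h.lamBar_pos).2 h.lamBar_lt_one
  nlinarith

/-- At the threshold itself the weight vanishes by continuity. -/
theorem eq_zero_threshold (h : IsLayerWeight lam lamBar Wt) : Wt (lamBar⁻¹ * (1 - lam)) = 0 := by
  have hpos : 0 < lamBar⁻¹ * (1 - lam) := by have := h.one_sub_lt; linarith [h.lam_lt_one]
  have hc : ContinuousWithinAt Wt (Ioi (lamBar⁻¹ * (1 - lam))) (lamBar⁻¹ * (1 - lam)) :=
    h.contDiff.continuous.continuousWithinAt
  refine tendsto_nhds_unique hc ((tendsto_const_nhds (x := (0 : ℝ))).congr' ?_)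
  filter_upwards [self_mem_nhdsWithin] with s hs
  exact (h.eq_zero s (lt_of_lt_of_le hs (le_abs_self s))).symm

/-- The weight is nonincreasing towards the value `0` at the threshold. -/
theorem nonneg_of_nonneg (h : IsLayerWeight lam lamBar Wt) {s : ℝ} (hs : 0 ≤ s) : 0 ≤ Wt s := by
  have h1 := h.one_sub_lt
  rcases le_or_gt s (1 - lam) with h2 | h2
  · rw [h.eq_one s (by rwa [abs_of_nonneg hs])]; exact zero_le_one
  · rcases le_or_gt s (lamBar⁻¹ * (1 - lam)) with h3 | h3
    · rw [← h.eq_zero_threshold]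
      exact h.antitoneOn ⟨h2.le, h3⟩ ⟨h1.le, le_rfl⟩ h3
    · rw [h.eq_zero s (by rwa [abs_of_nonneg hs])]

theorem antitoneOn_Ici (h : IsLayerWeight lam lamBar Wt) : AntitoneOn Wt (Ici 0) := by
  intro x hx y hy hxy
  have hx0 : 0 ≤ x := hx
  have hy0 : 0 ≤ y := hy
  have h1 := h.one_sub_lt
  rcases lt_or_ge (lamBar⁻¹ * (1 - lam)) y with h2 | h2
  · rw [h.eq_zero y (by rwa [abs_of_nonneg hy0])]
    exact h.nonneg_of_nonneg hx0
  · rcases le_total x (1 - lam) with h3 | h3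
    · rw [h.eq_one x (by rwa [abs_of_nonneg hx0])]
      rcases le_total y (1 - lam) with h4 | h4
      · rw [h.eq_one y (by rwa [abs_of_nonneg hy0])]
      · rw [← h.eq_one (1 - lam) (by rw [abs_of_nonneg]; linarith [h.lam_lt_one])]
        exact h.antitoneOn ⟨le_rfl, h1.le⟩ ⟨h4, h2⟩ h4
    · exact h.antitoneOn ⟨h3, hxy.trans h2⟩ ⟨h3.trans hxy, h2⟩ hxy

/-- The weight in the perimeter term is `1` wherever the weight in the volume term is positive. -/
theorem eq_one_of_pos (h : IsLayerWeight lam lamBar Wt) {s : ℝ} (hs : 0 < Wt s) :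
    Wt (lamBar * s) = 1 := by
  have h1 : |s| ≤ lamBar⁻¹ * (1 - lam) := by
    by_contra! hcon
    exact hs.ne' (h.eq_zero s hcon)
  refine h.eq_one _ ?_
  rw [abs_mul, abs_of_pos h.lamBar_pos]
  calc lamBar * |s| ≤ lamBar * (lamBar⁻¹ * (1 - lam)) := by
        have := h.lamBar_pos.le
        gcongr
    _ = 1 - lam := by rw [← mul_assoc, mul_inv_cancel₀ h.lamBar_pos.ne', one_mul]

/-- In the weight, the cut-off profile may be replaced by the rescaled optimal profile: they agree
for `|r| ≤ δ / 2`, and beyond that distance both take values where the weight vanishes. -/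
theorem comp_scaledProfile (h : IsLayerWeight lam lamBar Wt) {q : ℝ → ℝ} (hq : IsOptimalProfile q)
    {η : ℝ → ℝ} (hη : IsCutoff η) {T δ ε : ℝ} (hT : q T = lamBar⁻¹ * (1 - lam)) (hδ : 0 < δ)
    (hε : 0 < ε) (hTε : ε * T < δ / 2) (r : ℝ) :
    Wt (scaledProfile q η δ ε r) = Wt (q (r / ε)) := by
  unfold scaledProfile
  rcases le_or_gt |r| (δ / 2) with h1 | h1
  · rw [hη.eq_one]
    · simp
    · rw [mem_Icc, ← abs_le, abs_div, abs_mul, abs_of_pos hδ, abs_two, div_le_one hδ]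
      linarith
  · have hTr : T < |r| / ε := by rw [lt_div_iff₀ hε]; linarith
    have hqr : lamBar⁻¹ * (1 - lam) < q (|r| / ε) := hT ▸ hq.strictMono hTr
    obtain ⟨e0, e1⟩ := hη.mem_Icc (2 * r / δ)
    have hq1 := (hq.mem_Ioo (|r| / ε)).2
    have hz : Wt (q (r / ε)) = 0 := by
      refine h.eq_zero _ ?_
      rwa [hq.abs_eq, abs_div, abs_of_pos hε]
    rw [hz]
    refine h.eq_zero _ ?_
    rcases lt_trichotomy r 0 with h0 | h0 | h0
    · rw [Real.sign_of_neg h0]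
      rw [abs_of_neg h0, neg_div, hq.odd] at hqr hq1
      refine lt_of_lt_of_le ?_ (neg_le_abs _)
      nlinarith
    · rw [h0, abs_zero] at h1; linarith
    · rw [Real.sign_of_pos h0]
      rw [abs_of_pos h0] at hqr hq1
      refine lt_of_lt_of_le ?_ (le_abs_self _)
      nlinarith

end IsLayerWeight

/-! ### Minimality of the constant function -/

theorem integral_gradient_eq_zero {n : ℕ} {g : Space n → ℝ} (hg : ContDiff ℝ 1 g)
    (hgc : HasCompactSupport g) : ∫ x, ∇ g x = 0 := by
  have hc : Continuous (∇ g) :=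
    (InnerProductSpace.toDual ℝ (Space n)).symm.continuous.comp (hg.continuous_fderiv one_ne_zero)
  have hcs : HasCompactSupport (∇ g) :=
    (hgc.fderiv ℝ).comp_left (g := (InnerProductSpace.toDual ℝ (Space n)).symm) (map_zero _)
  have hi : Integrable (∇ g) := hc.integrable_of_hasCompactSupport hcs
  refine ext_inner_left ℝ fun v => ?_
  have e : ∀ x, inner ℝ v (∇ g x) = fderiv ℝ g x v := fun x => by
    rw [real_inner_comm, inner_gradient]
  rw [inner_zero_right, ← integral_inner hi]
  have := integral_mul_fderiv_eq_neg_fderiv_mul_of_integrable (μ := (volume : Measure (Space n)))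
    (f := fun _ => (1 : ℝ)) (g := g) (v := v) (by simp) ?_
    (by simpa using hg.continuous.integrable_of_hasCompactSupport hgc) (by fun_prop)
    (fun x _ => hg.differentiable one_ne_zero x)
  · simp only [one_mul, fderiv_fun_const, Pi.zero_apply, zero_apply, zero_mul,
      integral_zero, neg_zero] at this
    simp_rw [e]
    exact this
  · simp_rw [one_mul, ← e]
    exact hi.const_inner v

theorem isTotalVariation_one {n : ℕ} (U : Set (Space n)) : IsTotalVariation U (fun _ => 1) 0 := by
  refine ⟨inferInstance, by simp, fun _ => 0, measurable_const, by simp, fun g hg hgc hgU => ?_⟩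
  simp only [one_smul, integral_zero_measure, neg_zero]
  rw [setIntegral_eq_integral_of_forall_compl_eq_zero, integral_gradient_eq_zero hg hgc]
  intro x hx
  have : fderiv ℝ g x = 0 := by
    by_contra hcon
    exact hx (hgU (support_fderiv_subset ℝ hcon))
  rw [gradient, this, map_zero]

theorem isSignBV_one {n : ℕ} {U : Set (Space n)} (hU : volume U ≠ ⊤) :
    IsSignBV U (fun _ => 1) :=
  ⟨integrableOn_const hU, Eventually.of_forall fun _ => Or.inr rfl, 0, isTotalVariation_one U⟩

theorem totalVariation_one {n : ℕ} {U : Set (Space n)} (hUo : IsOpen U) (hU : volume U ≠ ⊤) :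
    totalVariation U (fun _ => 1) = 0 :=
  IsTotalVariation.unique hUo (totalVariation_spec (isSignBV_one hU)) (isTotalVariation_one U)

theorem tube_eq {n : ℕ} (E : Set (Space n)) (r : ℝ) : tube E r = {x | |signedDist E x| < r} := by
  ext x
  simp only [tube, mem_ofPred_eq, abs_signedDist]

/-- The volume of the tubes around `∂E` in terms of its area. -/
theorem exists_volume_tube {n : ℕ} {Ω E : Set (Space n)} {S R K : ℝ} (h : IsEnclosedRegion Ω E S)
    (hd : IsTubularDist (frontier E) (signedDist E) R K) :
    ∃ C s₀ : ℝ, 0 ≤ C ∧ 0 < s₀ ∧ ∀ r : ℝ, 0 < r → r ≤ s₀ →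
      |volume.real {x | |signedDist E x| < r} - 2 * r * S| ≤ C * r ^ 3 :=
  hd.exists_volume_tube_sub_le (hd.tendsto_volume_shell h.area_pos h.area_eq)

theorem IsTubularDist.volume_tube_ne_top {n : ℕ} {Sig : Set (Space n)} {d : Space n → ℝ} {R K : ℝ}
    (h : IsTubularDist Sig d R K) (r : ℝ) : volume {x | |d x| < r} ≠ ⊤ := by
  refine ((measure_mono fun x hx => ?_).trans_lt (h.volume_shell_lt_top (-r) r)).ne
  exact ⟨(abs_lt.1 hx).1.le, (abs_lt.1 hx).2⟩

/-- If the weight is positive on the tube of radius `ε a`, then for small `ε` the constant `1` is a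
minimizer there, since the perimeter term carries the large factor `ε ^ (-3/2)` against the factor
`ε⁻¹` of the volume term. -/
theorem exists_isLeast_sharpFunctional {lam lamBar : ℝ} {Wt : ℝ → ℝ}
    (hWt : IsLayerWeight lam lamBar Wt) {q : ℝ → ℝ} (hq : IsOptimalProfile q) {n : ℕ}
    {Ω E : Set (Space n)} {S δ : ℝ} (h : IsEnclosedRegion Ω E S) (hδ : IsTubeWidth Ω E δ) {a : ℝ}
    (ha : 0 < a) (hpos : ∀ t, |t| < a → 0 < Wt (q t)) (hle : ∀ t, |t| < a → Wt (q t) ≤ 1) :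
    ∃ ε₀ : ℝ, 0 < ε₀ ∧ ∀ η : ℝ → ℝ, IsCutoff η → ∀ ε : ℝ, 0 < ε → ε < ε₀ →
      IsLeast (sharpFunctional lamBar Wt (tube E (ε * a)) (phaseField q η E δ ε) ε ''
          {φ | IsSignBV (tube E (ε * a)) φ})
        (sharpFunctional lamBar Wt (tube E (ε * a)) (phaseField q η E δ ε) ε (fun _ => 1)) ∧
      sharpFunctional lamBar Wt (tube E (ε * a)) (phaseField q η E δ ε) ε (fun _ => 1) =
        1 / ε * ∫ x in {x | |signedDist E x| < ε * a}, Wt (q (signedDist E x / ε)) := by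
  obtain ⟨R, K, hd⟩ := exists_isTubularDist h hδ
  obtain ⟨C₁, s₀, hC₁, hs₀, hvol⟩ := exists_volume_tube h hd
  have hS := h.area_pos
  obtain ⟨C, r₀, hC, hr₀, hmin⟩ := hd.exists_integral_weight_tube_le h.isConnected_frontier
    (c' := (2 * S + C₁).toNNReal) (r₁ := min s₀ 1) (by positivity) fun r hr hr' => by
      have hrs := hr'.le.trans (min_le_left _ _)
      have hr1 := hr'.le.trans (min_le_right _ _)
      have h1 := (abs_le.1 (hvol r hr hrs)).2
      rw [← ofReal_measureReal (hd.volume_tube_ne_top r)]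
      change _ ≤ ENNReal.ofReal (2 * S + C₁) * _
      rw [← ENNReal.ofReal_mul (by positivity)]
      apply ENNReal.ofReal_le_ofReal
      have h2 : r ^ 3 ≤ r := by
        have : r ^ 3 ≤ r ^ 1 := pow_le_pow_of_le_one hr.le hr1 (by norm_num)
        simpa using this
      nlinarith
  have hpos0 : 0 < lamBar⁻¹ * (1 - lam) := by have := hWt.one_sub_lt; linarith [hWt.lam_lt_one]
  obtain ⟨T, hT⟩ := hq.exists_eq ⟨by linarith, hWt.threshold_lt_one⟩
  have hT0 : 0 < T := hq.pos_of_pos (hT ▸ hpos0)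
  refine ⟨min (r₀ / a) (min (δ / 2 / T) ((C ^ 2)⁻¹)), by have := hδ.1; positivity,
    fun η hη ε hε hε' => ?_⟩
  have hε1 : ε * a < r₀ := (lt_div_iff₀ ha).1 (hε'.trans_le (min_le_left _ _))
  have hε2 : ε * T < δ / 2 :=
    (lt_div_iff₀ hT0).1 (hε'.trans_le ((min_le_right _ _).trans (min_le_left _ _)))
  have hε3 : ε < (C ^ 2)⁻¹ := hε'.trans_le ((min_le_right _ _).trans (min_le_right _ _))
  rw [tube_eq]
  set U := {x | |signedDist E x| < ε * a} with hU
  set u := phaseField q η E δ ε with hu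
  have hUo : IsOpen U := hd.isOpen_tube _
  have hUfin : volume U ≠ ⊤ := hd.volume_tube_ne_top _
  have hWu : ∀ x, Wt (u x) = Wt (q (signedDist E x / ε)) := fun x =>
    hWt.comp_scaledProfile hq hη hT hδ.1 hε hε2 _
  have hUa : ∀ x ∈ U, |signedDist E x / ε| < a := by
    intro x hx
    rw [abs_div, abs_of_pos hε, div_lt_iff₀ hε, mul_comm]
    exact hx
  have hW0 : ∀ x ∈ U, 0 < Wt (u x) := fun x hx => hWu x ▸ hpos _ (hUa x hx)
  have hW1 : ∀ x ∈ U, Wt (u x) ≤ 1 := fun x hx => hWu x ▸ hle _ (hUa x hx)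
  have hsecond : ∀ φ, ∫ x in U, 1 / ε ^ (3 / 2 : ℝ) * Wt (lamBar * u x) ∂(totalVariation U φ) =
      1 / ε ^ (3 / 2 : ℝ) * (totalVariation U φ).real U := by
    intro φ
    rw [setIntegral_congr_fun (g := fun _ => 1 / ε ^ (3 / 2 : ℝ)) hUo.measurableSet]
    · rw [setIntegral_const, smul_eq_mul, mul_comm]
    · intro x hx
      simp only [hWt.eq_one_of_pos (hW0 x hx), mul_one]
  have hval : sharpFunctional lamBar Wt U u ε (fun _ => 1) = ∫ x in U, 1 / ε * Wt (u x) := by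
    unfold sharpFunctional
    rw [hsecond, totalVariation_one hUo hUfin]
    simp only [mul_one, measureReal_zero_apply, mul_zero, add_zero]
    refine abs_of_nonneg (setIntegral_nonneg hUo.measurableSet fun x hx => ?_)
    have := hW0 x hx
    positivity
  have hint : IntegrableOn (fun x => 1 / ε * Wt (u x)) U := by
    have hm : Measurable fun x => 1 / ε * Wt (u x) := by
      simp_rw [hWu]
      exact (hWt.contDiff.continuous.measurable.comp (hq.differentiable.continuous.measurable.comp
        (hd.measurable.div_const ε))).const_mul _
    refine Measure.integrableOn_of_bounded (M := 1 / ε) hUfin hm.aestronglyMeasurable ?_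
    filter_upwards [ae_restrict_mem hUo.measurableSet] with x hx
    have := hW0 x hx
    rw [Real.norm_eq_abs, abs_of_pos (by positivity)]
    exact mul_le_of_le_one_right (by positivity) (hW1 x hx)
  refine ⟨⟨⟨_, isSignBV_one hUfin, rfl⟩, ?_⟩, ?_⟩
  · rintro _ ⟨φ, hφ, rfl⟩
    rw [hval]
    unfold sharpFunctional
    rw [hsecond]
    refine (hmin (ε * a) (by positivity) hε1 φ hφ _ (1 / ε) hint (fun x hx => ?_)
      (fun x hx => ?_)).trans ?_
    · have := hW0 x hx
      positivity
    · exact mul_le_of_le_one_right (by positivity) (hW1 x hx)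
    · have hm := totalVariation_spec hφ
      have hfin : IsFiniteMeasure (totalVariation U φ) := hm.1
      have e : (totalVariation U φ).real U = (totalVariation U φ).real univ := by
        have := measureReal_add_measureReal_compl (μ := totalVariation U φ) hUo.measurableSet
        rw [← this]
        simp [Measure.real, hm.2.1]
      rw [e]
      have hm0 : 0 ≤ (totalVariation U φ).real univ := measureReal_nonneg
      -- `C ε⁻¹ ≤ ε ^ (-3/2)` because `C ≤ ε ^ (-1/2)`
      have hC1 : C * √ε ≤ 1 := by
        have h1 : C ^ 2 * ε ≤ 1 := by
          rw [lt_inv_comm₀ hε (by positivity), ← one_div, lt_div_iff₀ hε] at hε3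
          exact hε3.le
        have h2 : (C * √ε) ^ 2 ≤ 1 := by rwa [mul_pow, Real.sq_sqrt hε.le]
        exact (sq_le_one_iff₀ (by positivity)).1 h2
      have e2 : ε ^ (3 / 2 : ℝ) = ε * √ε := by
        rw [Real.sqrt_eq_rpow, ← Real.rpow_one_add' hε.le (by norm_num)]
        norm_num
      have key : 1 / ε * C ≤ 1 / ε ^ (3 / 2 : ℝ) := by
        rw [e2, div_mul_eq_mul_div, one_mul, div_le_div_iff₀ hε (by positivity)]
        nlinarith [Real.sqrt_nonneg ε]
      have := mul_le_mul_of_nonneg_right key hm0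
      linarith
  · rw [hval, integral_const_mul]
    simp_rw [hWu]

/-! ### Layer cake formula -/

/-- The superlevel sets of an even function that is nonincreasing on `[0, ∞)` are symmetric
intervals; they are open by continuity. -/
theorem exists_superlevel {g : ℝ → ℝ} (hg : Continuous g) (heven : ∀ t, g (-t) = g t)
    (hanti : AntitoneOn g (Ici 0)) {T : ℝ} (hT : ∀ t, T < |t| → g t = 0) {s : ℝ} (hs : 0 ≤ s)
    (hs1 : s < g 0) : ∃ a, 0 < a ∧ a ≤ T ∧ ∀ t, s < g t ↔ |t| < a := by
  have habs : ∀ t, g |t| = g t := by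
    intro t
    rcases abs_choice t with h | h <;> rw [h]
    exact heven t
  set A := {t | s < g t} with hA
  have hAo : IsOpen A := isOpen_lt continuous_const hg
  have hle : ∀ t ∈ A, |t| ≤ T := by
    intro t ht
    by_contra! hcon
    have ht' : s < g t := ht
    rw [hT t hcon] at ht'
    linarith
  have hbdd : BddAbove A := ⟨T, fun t ht => (le_abs_self t).trans (hle t ht)⟩
  have h0 : (0 : ℝ) ∈ A := hs1
  have hopen : ∀ t ∈ A, t < sSup A := by
    intro t ht
    obtain ⟨ρ, hρ, hball⟩ := Metric.isOpen_iff.1 hAo t ht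
    have : t + ρ / 2 ∈ A := hball (by
      rw [Metric.mem_ball, Real.dist_eq, add_sub_cancel_left, abs_of_pos (by positivity)]
      linarith)
    have := le_csSup hbdd this
    linarith
  refine ⟨sSup A, hopen 0 h0, csSup_le ⟨0, h0⟩ fun t ht => (le_abs_self t).trans (hle t ht),
    fun t => ⟨fun ht => hopen _ ?_, fun ht => ?_⟩⟩
  · change s < g |t|
    rwa [habs]
  · obtain ⟨t', ht', htt'⟩ := exists_lt_of_lt_csSup ⟨0, h0⟩ ht
    have ht'0 : s < g t' := ht'
    rw [← habs t]
    exact ht'0.trans_le (hanti (abs_nonneg t) ((abs_nonneg t).trans htt'.le) htt'.le)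

/-- By the layer cake formula the volume expansion of tubes gives the expansion of the integral of
an even, radially nonincreasing function of `d / ε`. -/
theorem IsTubularDist.integral_comp_sub_le {n : ℕ} {Sig : Set (Space n)} {d : Space n → ℝ}
    {R K : ℝ} (h : IsTubularDist Sig d R K) {C s₀ S : ℝ} (hC : 0 ≤ C)
    (hvol : ∀ r : ℝ, 0 < r → r ≤ s₀ → |volume.real {x | |d x| < r} - 2 * r * S| ≤ C * r ^ 3)
    {g : ℝ → ℝ} (hg : Continuous g) (heven : ∀ t, g (-t) = g t) (hanti : AntitoneOn g (Ici 0))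
    (hg0 : g 0 = 1) (hgn : ∀ t, 0 ≤ g t) {T : ℝ} (hT : ∀ t, T < |t| → g t = 0)
    {ε : ℝ} (hε : 0 < ε) (hεT : ε * T ≤ s₀) :
    |(∫ x, g (d x / ε)) - ε * S * ∫ t, g t| ≤ C * (ε * T) ^ 3 := by
  have habs : ∀ t, g |t| = g t := by
    intro t
    rcases abs_choice t with h | h <;> rw [h]
    exact heven t
  have hg1 : ∀ t, g t ≤ 1 := by
    intro t
    rw [← hg0, ← habs t]
    exact hanti (le_refl (0 : ℝ)) (abs_nonneg t) (abs_nonneg t)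
  have hlev : ∀ s : ℝ, ∃ a, s ∈ Ioo (0 : ℝ) 1 → 0 < a ∧ a ≤ T ∧ ∀ t, s < g t ↔ |t| < a := by
    intro s
    by_cases hs : s ∈ Ioo (0 : ℝ) 1
    · obtain ⟨a, ha⟩ := exists_superlevel hg heven hanti hT hs.1.le (by rw [hg0]; exact hs.2)
      exact ⟨a, fun _ => ha⟩
    · exact ⟨0, fun h => absurd h hs⟩
  choose a ha using hlev
  have hdiv : ∀ x b, |d x / ε| < b ↔ |d x| < ε * b := by
    intro x b
    rw [abs_div, abs_of_pos hε, div_lt_iff₀ hε, mul_comm]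
  have hset1 : ∀ s ∈ Ioo (0 : ℝ) 1, {x | s < g (d x / ε)} = {x | |d x| < ε * a s} := by
    intro s hs
    ext x
    exact ((ha s hs).2.2 _).trans (hdiv x _)
  have hset2 : ∀ s ∈ Ioo (0 : ℝ) 1, volume.real {t | s < g t} = 2 * a s := by
    intro s hs
    have : {t | s < g t} = Ioo (-a s) (a s) := by
      ext t
      exact ((ha s hs).2.2 t).trans abs_lt
    rw [this, Real.volume_real_Ioo_of_le (by linarith [(ha s hs).1])]
    ring
  have hmeas : Measurable fun x => g (d x / ε) := hg.measurable.comp (h.measurable.div_const ε)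
  have hint1 : Integrable fun x => g (d x / ε) := by
    have hsupp : Function.support (fun x => g (d x / ε)) ⊆ {x | |d x| < ε * (T + 1)} := by
      intro x hx
      change |d x| < ε * (T + 1)
      rw [← hdiv]
      by_contra! hcon
      exact hx (hT _ (by linarith))
    rw [← integrableOn_iff_integrable_of_support_subset hsupp]
    refine Measure.integrableOn_of_bounded (M := 1) (h.volume_tube_ne_top _)
      hmeas.aestronglyMeasurable (Eventually.of_forall fun x => ?_)
    rw [Real.norm_eq_abs, abs_of_nonneg (hgn _)]
    exact hg1 _
  have hint2 : Integrable g := by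
    refine hg.integrable_of_hasCompactSupport
      (HasCompactSupport.of_support_subset_isCompact (isCompact_Icc (a := -T) (b := T)) ?_)
    intro t ht
    rw [mem_Icc, ← abs_le]
    by_contra! hcon
    exact ht (hT t hcon)
  -- since `0 ≤ f ≤ 1`, only the levels in `(0, 1)` contribute
  have hcut : ∀ {α : Type} [MeasurableSpace α] (μ : Measure α) (f : α → ℝ), Integrable f μ →
      (∀ x, 0 ≤ f x) → (∀ x, f x ≤ 1) →
      ∫ x, f x ∂μ = ∫ s in Ioo (0 : ℝ) 1, μ.real {x | s < f x} := by
    intro α _ μ f hi h0 h1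
    rw [hi.integral_eq_integral_meas_lt (Eventually.of_forall h0)]
    refine setIntegral_eq_of_subset_of_forall_sdiff_eq_zero measurableSet_Ioi Ioo_subset_Ioi_self
      fun s hs => ?_
    have hs1 : 1 ≤ s := by
      by_contra! hcon
      exact hs.2 ⟨hs.1, hcon⟩
    have : {x | s < f x} = ∅ := by
      ext x
      simpa using (h1 x).trans hs1
    rw [this, measureReal_empty]
  have hmeas_level : ∀ {α : Type} [MeasurableSpace α] (μ : Measure α) (f : α → ℝ),
      Measurable fun s : ℝ => μ.real {x | s < f x} := by
    intro α _ μ f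
    have : Antitone fun s : ℝ => μ {x | s < f x} := fun s s' hss =>
      measure_mono fun x hx => hss.trans_lt hx
    exact this.measurable.ennreal_toReal
  have hint : ∀ {α : Type} [MeasurableSpace α] (μ : Measure α) (f : α → ℝ) (M : ℝ),
      (∀ s ∈ Ioo (0 : ℝ) 1, μ.real {x | s < f x} ≤ M) →
      IntegrableOn (fun s : ℝ => μ.real {x | s < f x}) (Ioo 0 1) := by
    intro α _ μ f M hM
    refine Measure.integrableOn_of_bounded (M := M) (by simp)
      (hmeas_level μ f).aestronglyMeasurable ?_
    filter_upwards [ae_restrict_mem measurableSet_Ioo] with s hs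
    rw [Real.norm_eq_abs, abs_of_nonneg measureReal_nonneg]
    exact hM s hs
  rw [hcut volume _ hint1 (fun x => hgn _) (fun x => hg1 _), hcut volume g hint2 hgn hg1,
    ← integral_const_mul, ← integral_sub]
  · rw [← Real.norm_eq_abs]
    refine (norm_setIntegral_le_of_norm_le_const (C := C * (ε * T) ^ 3)
      measure_Ioo_lt_top fun s hs => ?_).trans
      (by rw [Real.volume_real_Ioo_of_le zero_le_one, sub_zero, mul_one])
    obtain ⟨h1, h2, -⟩ := ha s hs
    have h3 : ε * a s ≤ ε * T := by gcongr
    have h4 : 0 < ε * a s := by positivity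
    rw [hset1 s hs, hset2 s hs, Real.norm_eq_abs]
    calc _ = |volume.real {x | |d x| < ε * a s} - 2 * (ε * a s) * S| := by ring_nf
      _ ≤ C * (ε * a s) ^ 3 := hvol _ h4 (h3.trans hεT)
      _ ≤ C * (ε * T) ^ 3 := by gcongr
  · refine hint volume _ (volume.real {x | |d x| < ε * T}) fun s hs => ?_
    rw [hset1 s hs]
    obtain ⟨h1, h2, -⟩ := ha s hs
    refine measureReal_mono (fun x hx => ?_) (h.volume_tube_ne_top _)
    have hx' : |d x| < ε * a s := hx
    exact hx'.trans_le (by gcongr)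
  · refine (hint volume g (2 * T) fun s hs => ?_).const_mul _
    rw [hset2 s hs]
    linarith [(ha s hs).2.1]

end DiffuseWillmore

theorem proposition4p1 (lam lamBar : ℝ) (Wt : ℝ → ℝ) (hWt : IsLayerWeight lam lamBar Wt)
    (q : ℝ → ℝ) (hq : IsOptimalProfile q) (r₁ : ℝ) (hr₁ : q r₁ = 1 - lam) :
    -- the tube `U_{r(ε)}` with `r(ε) = ε q⁻¹(1 - λ)`
    (∃ c₀ : ℝ, 0 < c₀ ∧
      ∀ (n : ℕ), n = 2 ∨ n = 3 → ∀ (Ω E : Set (Space n)) (S : ℝ), IsEnclosedRegion Ω E S →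
      ∀ δ : ℝ, IsTubeWidth Ω E δ → ∃ ε₀ : ℝ, 0 < ε₀ ∧ ∃ C : ℝ,
      ∀ η : ℝ → ℝ, IsCutoff η → ∀ ε : ℝ, 0 < ε → ε < ε₀ →
        let u : Space n → ℝ := phaseField q η E δ ε
        let U : Set (Space n) := tube E (ε * r₁)
        IsLeast (sharpFunctional lamBar Wt U u ε '' {φ | IsSignBV U φ})
            (sharpFunctional lamBar Wt U u ε (fun _ => 1)) ∧
          |sharpFunctional lamBar Wt U u ε (fun _ => 1) - c₀ * S| ≤ C * ε ^ 2) ∧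
    -- the layer `{W̃(u_ε) > 0}`, for even `W̃`
    ((∀ s, Wt (-s) = Wt s) → ∃ c₀ : ℝ, 0 < c₀ ∧
      ∀ (n : ℕ), n = 2 ∨ n = 3 → ∀ (Ω E : Set (Space n)) (S : ℝ), IsEnclosedRegion Ω E S →
      ∀ δ : ℝ, IsTubeWidth Ω E δ → ∃ ε₀ : ℝ, 0 < ε₀ ∧ ∃ C : ℝ,
      ∀ η : ℝ → ℝ, IsCutoff η → ∀ ε : ℝ, 0 < ε → ε < ε₀ →
        let u : Space n → ℝ := phaseField q η E δ ε
        let U : Set (Space n) := {x | 0 < Wt (u x)}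
        IsLeast (sharpFunctional lamBar Wt U u ε '' {φ | IsSignBV U φ})
            (sharpFunctional lamBar Wt U u ε (fun _ => 1)) ∧
          |sharpFunctional lamBar Wt U u ε (fun _ => 1) - c₀ * S| ≤ C * ε ^ 2) := by
  have hlam := hWt.lam_lt_one
  constructor
  · -- on the tube of radius `ε r₁` the weight is `1`, so the value is `ε⁻¹` times its volume
    have hr0 : 0 < r₁ := hq.pos_of_pos (by rw [hr₁]; linarith)
    have hone : ∀ t, |t| < r₁ → Wt (q t) = 1 := by
      intro t ht
      refine hWt.eq_one _ ?_
      rw [hq.abs_eq, ← hr₁]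
      exact (hq.strictMono ht).le
    refine ⟨2 * r₁, by positivity, fun n _ Ω E S h δ hδ => ?_⟩
    obtain ⟨R, K, hd⟩ := exists_isTubularDist h hδ
    obtain ⟨C, s₀, hC, hs₀, hvol⟩ := exists_volume_tube h hd
    obtain ⟨ε₁, hε₁, hmin⟩ := exists_isLeast_sharpFunctional hWt hq h hδ hr0
      (fun t ht => by rw [hone t ht]; exact one_pos) (fun t ht => (hone t ht).le)
    refine ⟨min ε₁ (s₀ / r₁), by positivity, C * r₁ ^ 3, fun η hη ε hε hε' => ?_⟩
    obtain ⟨hleast, hval⟩ := hmin η hη ε hε (hε'.trans_le (min_le_left _ _))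
    refine ⟨hleast, ?_⟩
    have hεs : ε * r₁ ≤ s₀ := ((lt_div_iff₀ hr0).1 (hε'.trans_le (min_le_right _ _))).le
    have hb := hvol (ε * r₁) (by positivity) hεs
    rw [hval, setIntegral_congr_fun (g := fun _ => 1) (hd.isOpen_tube _).measurableSet,
      setIntegral_const, smul_eq_mul, mul_one]
    · calc _ = 1 / ε * |volume.real {x | |signedDist E x| < ε * r₁} - 2 * (ε * r₁) * S| := by
            rw [← abs_of_pos (show 0 < 1 / ε by positivity), ← abs_mul,
              abs_of_pos (show 0 < 1 / ε by positivity)]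
            congr 1
            field_simp
        _ ≤ 1 / ε * (C * (ε * r₁) ^ 3) := by gcongr
        _ = C * r₁ ^ 3 * ε ^ 2 := by field_simp
    · intro x hx
      refine hone _ ?_
      rw [abs_div, abs_of_pos hε, div_lt_iff₀ hε, mul_comm]
      exact hx
  · intro heven
    have hpos0 : 0 < lamBar⁻¹ * (1 - lam) := by have := hWt.one_sub_lt; linarith
    obtain ⟨T, hT⟩ := hq.exists_eq ⟨by linarith, hWt.threshold_lt_one⟩
    have hT0 : 0 < T := hq.pos_of_pos (hT ▸ hpos0)
    -- in the second part the constant is the integral of `W̃ ∘ q`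
    set g : ℝ → ℝ := fun t => Wt (q t) with hg
    have hgc : Continuous g := hWt.contDiff.continuous.comp hq.differentiable.continuous
    have hge : ∀ t, g (-t) = g t := fun t => by simp only [hg, hq.odd, heven]
    have hga : AntitoneOn g (Ici 0) := fun s hs t ht hst =>
      hWt.antitoneOn_Ici (hq.zero ▸ hq.strictMono.monotone hs)
        (hq.zero ▸ hq.strictMono.monotone ht) (hq.strictMono.monotone hst)
    have hg0 : g 0 = 1 := hWt.eq_one _ (by rw [hq.zero, abs_zero]; linarith)
    have habs : ∀ s, Wt |s| = Wt s := by
      intro s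
      rcases abs_choice s with h | h <;> rw [h]
      exact heven s
    have hgn : ∀ t, 0 ≤ g t := fun t => by
      change 0 ≤ Wt (q t)
      rw [← habs]
      exact hWt.nonneg_of_nonneg (abs_nonneg _)
    have hg1 : ∀ t, g t ≤ 1 := by
      intro t
      change Wt (q t) ≤ 1
      rw [← habs, hq.abs_eq, ← hg0]
      exact hga (le_refl (0 : ℝ)) (abs_nonneg t) (abs_nonneg t)
    have hgT : ∀ t, T < |t| → g t = 0 := fun t ht => by
      refine hWt.eq_zero _ ?_
      rw [hq.abs_eq, ← hT]
      exact hq.strictMono ht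
    have hgi : Integrable g := by
      refine hgc.integrable_of_hasCompactSupport
        (HasCompactSupport.of_support_subset_isCompact (isCompact_Icc (a := -T) (b := T)) ?_)
      intro t ht
      rw [mem_Icc, ← abs_le]
      by_contra! hcon
      exact ht (hgT t hcon)
    obtain ⟨a, ha0, haT, ha⟩ := exists_superlevel hgc hge hga hgT le_rfl
      (by rw [hg0]; exact one_pos)
    have hc0 : 0 < ∫ t, g t := by
      rw [integral_pos_iff_support_of_nonneg hgn hgi]
      refine IsOpen.measure_pos _ (isOpen_ne_fun hgc continuous_const) ⟨0, ?_⟩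
      change g 0 ≠ 0
      rw [hg0]
      exact one_ne_zero
    refine ⟨∫ t, g t, hc0, fun n _ Ω E S h δ hδ => ?_⟩
    obtain ⟨R, K, hd⟩ := exists_isTubularDist h hδ
    obtain ⟨C, s₀, hC, hs₀, hvol⟩ := exists_volume_tube h hd
    obtain ⟨ε₁, hε₁, hmin⟩ := exists_isLeast_sharpFunctional hWt hq h hδ ha0
      (fun t ht => (ha t).2 ht) (fun t ht => hg1 t)
    have hδ0 := hδ.1
    refine ⟨min ε₁ (min (s₀ / T) (δ / 2 / T)), by positivity, C * T ^ 3,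
      fun η hη ε hε hε' => ?_⟩
    have hε1 : ε * T ≤ s₀ := ((lt_div_iff₀ hT0).1
      (hε'.trans_le ((min_le_right _ _).trans (min_le_left _ _)))).le
    have hε2 : ε * T < δ / 2 := (lt_div_iff₀ hT0).1
      (hε'.trans_le ((min_le_right _ _).trans (min_le_right _ _)))
    have hmem : ∀ x, 0 < g (signedDist E x / ε) ↔ |signedDist E x| < ε * a := by
      intro x
      rw [ha, abs_div, abs_of_pos hε, div_lt_iff₀ hε, mul_comm]
    have hU : {x | 0 < Wt (phaseField q η E δ ε x)} = tube E (ε * a) := by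
      rw [tube_eq]
      ext x
      rw [mem_ofPred_eq, mem_ofPred_eq, ← hmem, phaseField,
        hWt.comp_scaledProfile hq hη hT hδ0 hε hε2]
    obtain ⟨hleast, hval⟩ := hmin η hη ε hε (hε'.trans_le (min_le_left _ _))
    intro u U
    have hUe : U = tube E (ε * a) := hU
    rw [hUe]
    refine ⟨hleast, ?_⟩
    have hb := hd.integral_comp_sub_le hC hvol hgc hge hga hg0 hgn hgT hε hε1
    rw [hval, setIntegral_eq_integral_of_forall_compl_eq_zero]
    · calc _ = 1 / ε * |(∫ x, g (signedDist E x / ε)) - ε * S * ∫ t, g t| := by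
            rw [← abs_of_pos (show 0 < 1 / ε by positivity), ← abs_mul,
              abs_of_pos (show 0 < 1 / ε by positivity)]
            congr 1
            field_simp
            rfl
        _ ≤ 1 / ε * (C * (ε * T) ^ 3) := by gcongr
        _ = C * T ^ 3 * ε ^ 2 := by field_simp
    · intro x hx
      exact le_antisymm (not_lt.1 fun hcon => hx ((hmem x).1 hcon)) (hgn _)
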